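/- Let $\Bbbk$ be a field. A Yetter–Drinfeld module over $\Bbbk\mathbb Z$ is a $\mathbb Z$-graded vector space $V=\bigoplus_n V_n$ (the "internal" grading) with a degree preserving action of $\mathbb Z$, given by the automorphism $t$ by which the generator acts. These form a braided monoidal category ${}^{\Bbbk\mathbb Z}_{\Bbbk\mathbb Z}\mathcal{YD}$ with braiding $c(v\otimes w)=(t^n\cdot w)\otimes v$ for $v\in V_n$. Consider * (if $\operatorname{char}\Bbbk\neq2$) the Jordan plane $A=\Bbbk\langle x,y\rangle/(yx-xy+\tfrac12x^2)$, with $t\cdot x=x$, $t\cdot y=x+y$; * (for every $\Bbbk$) the super Jordan plane $A=\Bbbk\langle x,y\rangle/(x^2,\;y^2x-xy^2-xyx)$, with $t\cdot x=-x$, $t\cdot y=x-y$; where $t$ acts by algebra automorphisms, $x,y$ have internal degree $1$, and the counit $\varepsilon$ is the algebra map with $\varepsilon(x)=\varepsilon(y)=0$. In each of the two cases the following hold. 1. There is exactly one coproduct $\Delta:A\to A\otimes A$ for which $x,y$ are primitive and $A$ is a bimonoid in ${}^{\Bbbk\mathbb Z}_{\Bbbk\mathbb Z}\mathcal{YD}$.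 2. The explicit complex $P_\bullet\to A$ below, with $P_n=A\otimes V_n\otimes A$, each $V_n$ finite dimensional and graded, $V_0=\Bbbk$, augmentation $\mu:A\otimes A\to A$, the tensor product grading, and action $t(a\otimes v\otimes b)=t(a)\,t(1\otimes v\otimes1)\,t(b)$, is a complex of $A$-bimodules in ${}^{\Bbbk\mathbb Z}_{\Bbbk\mathbb Z}\mathcal{YD}$ and a projective resolution of $A$ as an $A$-bimodule. It is minimal: its differentials vanish after applying $\Bbbk\otimes_A-\otimes_A\Bbbk$. In both cases $V_1=\langle x,y\rangle$, in degree $1$, with $t$ acting on $1\otimes v\otimes 1$, $v\in V_1$, as on $v$, and $d_0(1\otimes v\otimes1)=v\otimes1-1\otimes v$ for $v=x,y$; also $t(1\otimes1)=1\otimes 1$ in $P_0$. * Jordan plane: $V_2=\langle r\rangle$ in degree $2$, $t(1\otimes r\otimes1)=1\otimes r\otimes1$, $V_n=0$ for $n\ge3$, and $$d_1(1\otimes r\otimes 1)=y\otimes x\otimes1+1\otimes y\otimes x-x\otimes y\otimes1-1\otimes x\otimes y+\tfrac12x\otimes x\otimes1+\tfrac12\,1\otimes x\otimes x .$$ * Super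 Jordan plane: for $n\ge2$, $V_n$ has the basis $x^n,\;y^2x^{n-1}$, in degrees $n$ and $n+1$, $$t(1\otimes x^n\otimes1)=(-1)^n\,1\otimes x^n\otimes1,$$ $$t(1\otimes y^2x^{n-1}\otimes1)=-1\otimes x^n\otimes y+(-1)^{n-1}(x-y)\otimes x^n\otimes1+(-1)^{n-1}\,1\otimes y^2x^{n-1}\otimes1;$$ $$d_1(1\otimes x^2\otimes1)=x\otimes x\otimes1+1\otimes x\otimes x,$$ $$d_1(1\otimes y^2x\otimes1)=y^2\otimes x\otimes1+y\otimes y\otimes x+1\otimes y\otimes yx-xy\otimes y\otimes1-x\otimes y\otimes y-1\otimes x\otimes y^2-xy\otimes x\otimes1-x\otimes y\otimes x-1\otimes x\otimes yx;$$ and for $n\ge2$ $$d_n(1\otimes x^{n+1}\otimes1)=x\otimes x^n\otimes1+(-1)^{n+1}\,1\otimes x^n\otimes x,$$ $$d_n(1\otimes y^2x^n\otimes1)=y^2\otimes x^n\otimes1+(-1)^{n+1}\,1\otimes y^2x^{n-1}\otimes x-x\otimes y^2x^{n-1}\otimes1-xy\otimes x^n\otimes1-1\otimes x^n\otimes y^2-1\otimes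 x^n\otimes yx .$$ 3. Let $H^\bullet(A,\Bbbk)$ be the Hochschild cohomology of $A$ with coefficients in the trivial bimodule $\Bbbk$, computed by Hochschild cochains $f:A^{\otimes n}\to\Bbbk$, with $(t\cdot f)(v)=f(t^{-1}v)$, and with the internal degree $h$ part formed by the classes of cocycles that vanish on every internal degree $s\ne-h$. Each $\operatorname{Hom}_{AA}(P_n,\Bbbk)$, with the action and grading given by the same formulas, is in ${}^{\Bbbk\mathbb Z}_{\Bbbk\mathbb Z}\mathcal{YD}$, and some comparison map from $P_\bullet$ to the bar resolution induces isomorphisms $H^n(A,\Bbbk)\to H^n(\operatorname{Hom}_{AA}(P_\bullet,\Bbbk))$ for all $n$ which respect the actions of $t$ and the internal gradings. 4. With the opposite of the cup product, $f\smallsmile g=g\cup f$, where $(g\cup f)(w\otimes v)=g(w)f(v)$, $H^\bullet(A,\Bbbk)$ is a graded braided commutative algebra in ${}^{\Bbbk\mathbb Z}_{\Bbbk\mathbb Z}\mathcal{YD}$: every $H^n(A,\Bbbk)$ is a Yetter–Drinfeld module, product and unit are morphisms of Yetter–Drinfeld modules, the product is associative and unital, and $$f\smallsmile g=(-1)^{pq}\,(t^h\cdot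 g)\smallsmile f$$ for $f\in H^p(A,\Bbbk)$ of internal degree $h$ and $g\in H^q(A,\Bbbk)$. -/

import Mathlib

open scoped TensorProduct

namespace HochYD
noncomputable section
variable {k : Type*} [Field k]

section Cochains
variable {A : Type*} [Ring A] [Algebra k A] {M : Type*} [AddCommGroup M] [Module k M]

theorem contractNth_update {n : ℕ} (j : Fin n) (a : Fin (n + 1) → A) (i : Fin (n + 1)) :
    ∃ (i' : Fin n) (g : A →ₗ[k] A), ∀ x : A,
      Fin.contractNth j.castSucc (· * ·) (Function.update a i x) =
        Function.update (Fin.contractNth j.castSucc (· * ·) a) i' (g x) := by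
  rcases lt_trichotomy (i : ℕ) (j : ℕ) with h | h | h
  · refine ⟨⟨i, by omega⟩, LinearMap.id, fun x => ?_⟩
    ext l
    simp only [Fin.contractNth, Function.update_apply, Fin.ext_iff, Fin.val_castSucc, Fin.val_succ,
      LinearMap.id_apply]
    split_ifs <;> first | rfl | omega
  · refine ⟨j, LinearMap.mulRight k (a j.succ), fun x => ?_⟩
    ext l
    simp only [Fin.contractNth, Function.update_apply, Fin.ext_iff, Fin.val_castSucc, Fin.val_succ,
      LinearMap.mulRight_apply]
    split_ifs <;> first | rfl | omega | skip
    have : l = j := Fin.ext (by omega)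
    subst this; rfl
  · by_cases h1 : (i : ℕ) = j + 1
    · refine ⟨j, LinearMap.mulLeft k (a j.castSucc), fun x => ?_⟩
      ext l
      simp only [Fin.contractNth, Function.update_apply, Fin.ext_iff, Fin.val_castSucc,
        Fin.val_succ, LinearMap.mulLeft_apply]
      split_ifs <;> first | rfl | omega | skip
      have : l = j := Fin.ext (by omega)
      subst this; rfl
    · refine ⟨⟨i - 1, by omega⟩, LinearMap.id, fun x => ?_⟩
      ext l
      simp only [Fin.contractNth, Function.update_apply, Fin.ext_iff, Fin.val_castSucc,
        Fin.val_succ, LinearMap.id_apply]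
      split_ifs <;> first | rfl | omega

/-- `(a₁, …, a_{n+1}) ↦ f (a₁, …, a_j a_{j+1}, …, a_{n+1})` -/
def contract {n : ℕ} (f : MultilinearMap k (fun _ : Fin n => A) M) (j : Fin n) :
    MultilinearMap k (fun _ : Fin (n + 1) => A) M where
  toFun a := f (Fin.contractNth j.castSucc (· * ·) a)
  map_update_add' a i x y := by
    rename_i inst
    obtain rfl : inst = instDecidableEqFin _ := Subsingleton.elim _ _
    obtain ⟨i', g, hg⟩ := contractNth_update (k := k) j a i
    simp only [hg, map_add, MultilinearMap.map_update_add]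
  map_update_smul' a i c x := by
    rename_i inst
    obtain rfl : inst = instDecidableEqFin _ := Subsingleton.elim _ _
    obtain ⟨i', g, hg⟩ := contractNth_update (k := k) j a i
    simp only [hg, map_smul, MultilinearMap.map_update_smul]

/-- `(a₁, …, a_{n+1}) ↦ a₁ · f (a₂, …, a_{n+1})` -/
def firstFace (L : A →ₗ[k] M →ₗ[k] M) {n : ℕ} (f : MultilinearMap k (fun _ : Fin n => A) M) :
    MultilinearMap k (fun _ : Fin (n + 1) => A) M :=
  LinearMap.uncurryLeft
    { toFun := fun a => (L a).compMultilinearMap f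
      map_add' := fun a b => by ext; simp
      map_smul' := fun c a => by ext; simp }

/-- `(a₁, …, a_{n+1}) ↦ f (a₁, …, aₙ) · a_{n+1}` -/
def lastFace (R : A →ₗ[k] M →ₗ[k] M) {n : ℕ} (f : MultilinearMap k (fun _ : Fin n => A) M) :
    MultilinearMap k (fun _ : Fin (n + 1) => A) M :=
  MultilinearMap.uncurryRight (R.flip.compMultilinearMap f)

/-- The Hochschild differential on cochains with values in a module `M` with left and right actions
`L` and `R` of `A`:
`(df)(a₁, …, a_{n+1}) = a₁ f(a₂, …) + ∑ⱼ (-1)^j f(…, a_j a_{j+1}, …) + (-1)^(n+1) f(…, aₙ) a_{n+1}`. -/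
def hochD (L R : A →ₗ[k] M →ₗ[k] M) (n : ℕ) :
    MultilinearMap k (fun _ : Fin n => A) M →ₗ[k] MultilinearMap k (fun _ : Fin (n + 1) => A) M where
  toFun f := firstFace L f + ∑ j : Fin n, (-1 : k) ^ ((j : ℕ) + 1) • contract f j
    + (-1 : k) ^ (n + 1) • lastFace R f
  map_add' f g := by
    ext a
    simp [firstFace, lastFace, contract, Finset.sum_add_distrib]
    abel
  map_smul' c f := by
    ext a
    simp [firstFace, lastFace, contract, Finset.smul_sum, smul_comm _ c]

theorem hochD_apply (L R : A →ₗ[k] M →ₗ[k] M) (n : ℕ) (f : MultilinearMap k (fun _ : Fin n => A) M)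
    (a : Fin (n + 1) → A) :
    hochD L R n f a = L (a 0) (f fun i => a i.succ)
      + ∑ j : Fin n, (-1 : k) ^ ((j : ℕ) + 1) • f (Fin.contractNth j.castSucc (· * ·) a)
      + (-1 : k) ^ (n + 1) • R (a (Fin.last n)) (f fun i => a i.castSucc) := by
  simp [hochD, firstFace, lastFace, contract]
  rfl


end Cochains

section Cohomology
variable {X Y : ℕ → Type*} [∀ n, AddCommGroup (X n)] [∀ n, Module k (X n)]
  [∀ n, AddCommGroup (Y n)] [∀ n, Module k (Y n)]

/-- The coboundaries in degree `n` of a cochain complex starting in degree `0`. -/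
def coboundaries (d : ∀ n, X n →ₗ[k] X (n + 1)) : ∀ n, Submodule k (X n)
  | 0 => ⊥
  | n + 1 => LinearMap.range (d n)

/-- The `n`-th cohomology, cocycles modulo coboundaries, of a cochain complex starting in degree `0`. -/
abbrev Cohomology (d : ∀ n, X n →ₗ[k] X (n + 1)) (n : ℕ) : Type _ :=
  ↥(LinearMap.ker (d n)) ⧸ (coboundaries d n).submoduleOf (LinearMap.ker (d n))

/-- The cohomology class of a cocycle. -/
abbrev Cohomology.mk (d : ∀ n, X n →ₗ[k] X (n + 1)) (n : ℕ) :
    ↥(LinearMap.ker (d n)) →ₗ[k] Cohomology d n :=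
  Submodule.mkQ _

/-- The map induced in cohomology by a cochain map. -/
def Cohomology.map (dX : ∀ n, X n →ₗ[k] X (n + 1)) (dY : ∀ n, Y n →ₗ[k] Y (n + 1))
    (φ : ∀ n, X n →ₗ[k] Y n) (hφ : ∀ n, dY n ∘ₗ φ n = φ (n + 1) ∘ₗ dX n) (n : ℕ) :
    Cohomology dX n →ₗ[k] Cohomology dY n :=
  Submodule.mapQ _ _
    ((φ n).restrict fun x (hx : dX n x = 0) => by
      have := LinearMap.congr_fun (hφ n) x
      simp only [LinearMap.comp_apply, hx, map_zero] at this
      exact this)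
    (by
      rintro ⟨x, hx⟩ h
      simp only [Submodule.submoduleOf, Submodule.mem_comap, Submodule.subtype_apply] at h
      simp only [Submodule.submoduleOf, Submodule.mem_comap, Submodule.subtype_apply]
      cases n with
      | zero =>
        obtain rfl : x = 0 := h
        exact map_zero (φ 0)
      | succ n =>
        obtain ⟨y, rfl⟩ := h
        exact ⟨φ n y, LinearMap.congr_fun (hφ n) y⟩)

/-- The automorphism induced in cohomology by an automorphism of a cochain complex. -/
def Cohomology.mapEquiv (d : ∀ n, X n →ₗ[k] X (n + 1)) (e : ∀ n, X n ≃ₗ[k] X n)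
    (he : ∀ n, d n ∘ₗ (e n : X n →ₗ[k] X n) = (e (n + 1) : X (n + 1) →ₗ[k] X (n + 1)) ∘ₗ d n)
    (n : ℕ) : Cohomology d n ≃ₗ[k] Cohomology d n :=
  LinearEquiv.ofLinearMap
    (Cohomology.map d d (fun n => (e n : X n →ₗ[k] X n)) he n)
    (Cohomology.map d d (fun n => ((e n).symm : X n →ₗ[k] X n)) (fun n => by
      ext x
      have := LinearMap.congr_fun (he n) ((e n).symm x)
      simp only [LinearMap.comp_apply, LinearEquiv.coe_coe, LinearEquiv.apply_symm_apply] at this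
      simp [this]) n)
    (by
      apply Submodule.linearMap_qext
      ext x
      exact congrArg Submodule.Quotient.mk (Subtype.ext ((e n).apply_symm_apply x.1)))
    (by
      apply Submodule.linearMap_qext
      ext x
      exact congrArg Submodule.Quotient.mk (Subtype.ext ((e n).symm_apply_apply x.1)))

/-- The subspace of cohomology classes represented by cocycles in given subspaces. -/
def Cohomology.grading (d : ∀ n, X n →ₗ[k] X (n + 1)) (gr : ∀ n, ℤ → Submodule k (X n))
    (n : ℕ) (g : ℤ) : Submodule k (Cohomology d n) :=
  ((gr n g).submoduleOf (LinearMap.ker (d n))).map (Cohomology.mk d n)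

end Cohomology

section Trivial
variable {A : Type*} [Ring A] [Algebra k A] (ε : A →ₐ[k] k)

/-- Hochschild cochains with trivial coefficients, that is `k`-linear maps `A^{⊗ n} → k`. -/
abbrev Cochain (k A : Type*) [Field k] [Ring A] [Algebra k A] (n : ℕ) : Type _ :=
  MultilinearMap k (fun _ : Fin n => A) k

/-- The action of `A` on `k` through the counit. -/
def trivialAction : A →ₗ[k] k →ₗ[k] k := (LinearMap.mul k k).comp ε.toLinearMap

/-- The Hochschild differential with coefficients in the trivial bimodule `k`. -/
def cochainD (n : ℕ) : Cochain k A n →ₗ[k] Cochain k A (n + 1) :=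
  hochD (trivialAction ε) (trivialAction ε) n

/-- The Hochschild cohomology `H^n(A, k)` with trivial coefficients. -/
abbrev HH (n : ℕ) : Type _ := Cohomology (cochainD ε) n

/-- The cup product `(f ∪ g)(a₁, …, a_{p+q}) = f(a₁, …, a_p) g(a_{p+1}, …, a_{p+q})`. -/
def cup {p q n : ℕ} (h : p + q = n) (f : Cochain k A p) (g : Cochain k A q) : Cochain k A n :=
  ((LinearMap.mul' k k).compMultilinearMap (f.domCoprod g)).domDomCongr
    (finSumFinEquiv.trans (finCongr h))

theorem cup_apply {p q n : ℕ} (h : p + q = n) (f : Cochain k A p) (g : Cochain k A q)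
    (a : Fin n → A) :
    cup h f g a = f (fun i => a ⟨i, by omega⟩) * g (fun j => a ⟨p + j, by omega⟩) := by
  subst h
  simp [cup, MultilinearMap.domCoprod]
  rfl

theorem cochainD_apply (n : ℕ) (f : Cochain k A n) (a : Fin (n + 1) → A) :
    cochainD ε n f a = ε (a 0) * (f fun i => a i.succ)
      + ∑ j : Fin n, (-1 : k) ^ ((j : ℕ) + 1) * f (Fin.contractNth j.castSucc (· * ·) a)
      + (-1 : k) ^ (n + 1) * (ε (a (Fin.last n)) * (f fun i => a i.castSucc)) := by
  simp [cochainD, hochD_apply, trivialAction]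

theorem cochainD_cup {p q n : ℕ} (h : p + q = n) (f : Cochain k A p) (g : Cochain k A q) :
    cochainD ε n (cup h f g) = cup (by omega : (p + 1) + q = n + 1) (cochainD ε p f) g
      + (-1 : k) ^ p • cup (by omega : p + (q + 1) = n + 1) f (cochainD ε q g) := by
  subst h
  ext a
  simp only [add_apply, smul_apply, cup_apply, cochainD_apply,
    Fin.sum_univ_add, smul_eq_mul]
  have e1 : ∀ j : Fin p,
      f (fun i => Fin.contractNth (Fin.castAdd q j).castSucc (· * ·) a ⟨i, by omega⟩) =
        f (Fin.contractNth j.castSucc (· * ·) fun i : Fin (p + 1) => a ⟨i, by omega⟩) ∧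
      g (fun i => Fin.contractNth (Fin.castAdd q j).castSucc (· * ·) a ⟨p + i, by omega⟩) =
        g (fun i => a ⟨p + 1 + i, by omega⟩) := by
    intro j
    constructor
    · congr 1
    · congr 1
      ext i
      simp only [Fin.contractNth, Fin.val_castSucc, Fin.val_castAdd]
      rw [if_neg (by omega), if_neg (by omega)]
      congr 1
      ext
      simp
      omega
  have e2 : ∀ j : Fin q,
      f (fun i => Fin.contractNth (Fin.natAdd p j).castSucc (· * ·) a ⟨i, by omega⟩) =
        f (fun i => a ⟨i, by omega⟩) ∧
      g (fun i => Fin.contractNth (Fin.natAdd p j).castSucc (· * ·) a ⟨p + i, by omega⟩) =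
        g (Fin.contractNth j.castSucc (· * ·) fun i : Fin (q + 1) => a ⟨p + i, by omega⟩) := by
    intro j
    constructor
    · congr 1
      ext i
      simp only [Fin.contractNth, Fin.val_castSucc, Fin.val_natAdd]
      rw [if_pos (by omega)]
      rfl
    · congr 1
      ext i
      simp only [Fin.contractNth, Fin.val_castSucc, Fin.val_natAdd, add_lt_add_iff_left,
        add_right_inj]
      rfl
  simp only [(e1 _).1, (e1 _).2, (e2 _).1, (e2 _).2]
  simp only [add_mul, mul_add, Finset.sum_mul, Finset.mul_sum, Fin.val_castAdd, Fin.val_natAdd]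
  have hs : ∀ (i : ℕ) (u v : k), (-1 : k) ^ (p + i + 1) * (u * v) =
      (-1) ^ p * (u * ((-1) ^ (i + 1) * v)) := by intros; ring
  have h0 : a 0 = a ⟨0, by omega⟩ := rfl
  have hl : a (Fin.last (p + q)) = a ⟨p + q, by omega⟩ := rfl
  simp only [hs, mul_assoc, h0, hl, Fin.val_zero, Fin.val_succ, Fin.val_last, Fin.val_castSucc,
    Fin.succ_mk, Fin.castSucc_mk]
  have g1 : (fun i : Fin q => a ⟨p + i + 1, by omega⟩) =
      fun i : Fin q => a ⟨p + 1 + i, by omega⟩ := by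
    ext i; congr 2; omega
  have g2 : (fun i : Fin q => a ⟨p + (i + 1), by omega⟩) =
      fun i : Fin q => a ⟨p + 1 + i, by omega⟩ := by
    ext i; congr 2; omega
  have hp : a ⟨p + 0, by omega⟩ = a ⟨p, by omega⟩ := rfl
  rw [g1, g2, hp]
  ring

theorem cup_mem_ker {p q n : ℕ} (h : p + q = n) {f : Cochain k A p} {g : Cochain k A q}
    (hf : f ∈ LinearMap.ker (cochainD ε p)) (hg : g ∈ LinearMap.ker (cochainD ε q)) :
    cup h f g ∈ LinearMap.ker (cochainD ε n) := by
  rw [LinearMap.mem_ker] at *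
  ext a
  simp [cochainD_cup, hf, hg, cup_apply]

theorem cup_mem_left {p q n : ℕ} (h : p + q = n) {f : Cochain k A p} {g : Cochain k A q}
    (hf : f ∈ coboundaries (cochainD ε) p) (hg : g ∈ LinearMap.ker (cochainD ε q)) :
    cup h f g ∈ coboundaries (cochainD ε) n := by
  rw [LinearMap.mem_ker] at hg
  cases p with
  | zero =>
    obtain rfl : f = 0 := hf
    convert Submodule.zero_mem _
    ext a
    simp [cup_apply]
  | succ p =>
    obtain ⟨f', rfl⟩ := hf
    obtain rfl : p + q + 1 = n := by omega
    refine ⟨cup rfl f' g, ?_⟩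
    rw [cochainD_cup, hg]
    ext a
    simp [cup_apply]

theorem cup_mem_right {p q n : ℕ} (h : p + q = n) {f : Cochain k A p} {g : Cochain k A q}
    (hf : f ∈ LinearMap.ker (cochainD ε p)) (hg : g ∈ coboundaries (cochainD ε) q) :
    cup h f g ∈ coboundaries (cochainD ε) n := by
  rw [LinearMap.mem_ker] at hf
  cases q with
  | zero =>
    obtain rfl : g = 0 := hg
    convert Submodule.zero_mem _
    ext a
    simp [cup_apply]
  | succ q =>
    obtain ⟨g', rfl⟩ := hg
    obtain rfl : p + q + 1 = n := by omega
    refine ⟨(-1 : k) ^ p • cup rfl f g', ?_⟩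
    rw [map_smul, cochainD_cup, hf]
    ext a
    simp only [smul_apply, add_apply, cup_apply, smul_eq_mul, zero_apply, zero_mul, zero_add]
    rw [← mul_assoc, ← mul_pow]
    simp

/-- The cup product on cocycles, with values in cohomology. -/
def cupCocycle {p q n : ℕ} (h : p + q = n) :
    ↥(LinearMap.ker (cochainD ε p)) →ₗ[k] ↥(LinearMap.ker (cochainD ε q)) →ₗ[k] HH ε n :=
  LinearMap.mk₂ k
    (fun f g => Cohomology.mk (cochainD ε) n ⟨cup h f.1 g.1, cup_mem_ker ε h f.2 g.2⟩)
    (fun f f' g => by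
      rw [← map_add]; congr 1; ext a; simp [cup_apply, add_mul])
    (fun c f g => by
      rw [← map_smul]; congr 1; ext a; simp [cup_apply, mul_assoc])
    (fun f g g' => by
      rw [← map_add]; congr 1; ext a; simp [cup_apply, mul_add])
    (fun c f g => by
      rw [← map_smul]; congr 1; ext a; simp [cup_apply, mul_left_comm])

/-- The cup product `H^p(A, k) × H^q(A, k) → H^n(A, k)`, `n = p + q`. -/
def cupHH {p q n : ℕ} (h : p + q = n) : HH ε p →ₗ[k] HH ε q →ₗ[k] HH ε n :=
  Submodule.liftQ _
    (Submodule.liftQ _ (cupCocycle ε h)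
      (fun f hf => by
        ext g
        exact (Submodule.Quotient.mk_eq_zero _).2 (cup_mem_left ε h hf g.2))).flip
    (fun g hg => by
      apply LinearMap.ext
      intro f
      induction f using Submodule.Quotient.induction_on with
      | _ f => exact (Submodule.Quotient.mk_eq_zero _).2 (cup_mem_right ε h f.2 hg)) |>.flip

theorem cupHH_mk {p q n : ℕ} (h : p + q = n) (f : LinearMap.ker (cochainD ε p))
    (g : LinearMap.ker (cochainD ε q)) :
    cupHH ε h (Cohomology.mk _ p f) (Cohomology.mk _ q g) =
      Cohomology.mk (cochainD ε) n ⟨cup h f.1 g.1, cup_mem_ker ε h f.2 g.2⟩ := rfl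


variable (σ : A ≃ₐ[k] A) (𝒜 : ℤ → Submodule k A)

/-- `(t · f)(a₁, …, aₙ) = f (t⁻¹ a₁, …, t⁻¹ aₙ)` -/
def cochainT (n : ℕ) : Cochain k A n ≃ₗ[k] Cochain k A n where
  toFun f := f.compLinearMap fun _ => σ.symm.toLinearMap
  map_add' f g := by ext; simp
  map_smul' c f := by ext; simp
  invFun f := f.compLinearMap fun _ => σ.toLinearMap
  left_inv f := by ext; simp
  right_inv f := by ext; simp

theorem cochainT_comm (hσ : ∀ a, ε (σ a) = ε a) (n : ℕ) :
    cochainD ε n ∘ₗ (cochainT σ n : Cochain k A n →ₗ[k] Cochain k A n) =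
      (cochainT σ (n + 1) : Cochain k A (n + 1) →ₗ[k] Cochain k A (n + 1)) ∘ₗ cochainD ε n := by
  have hσ' : ∀ a, ε (σ.symm a) = ε a := fun a => by rw [← hσ (σ.symm a), σ.apply_symm_apply]
  ext f a
  simp only [LinearMap.comp_apply, LinearEquiv.coe_coe, cochainD_apply, cochainT,
    LinearEquiv.coe_mk, LinearMap.coe_mk, AddHom.coe_mk, MultilinearMap.compLinearMap_apply,
    AlgEquiv.toLinearMap_apply, hσ']
  congr 2
  refine Finset.sum_congr rfl fun j _ => ?_
  congr 2
  ext i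
  simp only [Fin.contractNth]
  split_ifs <;> simp

/-- Cochains of internal degree `g`: those which vanish on tensors of internal degree `s` unless
`s + g = 0`, as `k` sits in internal degree `0`. -/
def cochainGr (n : ℕ) (g : ℤ) : Submodule k (Cochain k A n) where
  carrier := {f | ∀ (e : Fin n → ℤ) (a : Fin n → A), (∀ i, a i ∈ 𝒜 (e i)) →
    (∑ i, e i) + g ≠ 0 → f a = 0}
  zero_mem' := fun _ _ _ _ => rfl
  add_mem' := fun {f f'} hf hf' e a ha h => by simp [hf e a ha h, hf' e a ha h]
  smul_mem' := fun c f hf e a ha h => by simp [hf e a ha h]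

/-- The action of the generator of the group on `H^n(A, k)`. -/
def hhT (hσ : ∀ a, ε (σ a) = ε a) (n : ℕ) : HH ε n ≃ₗ[k] HH ε n :=
  Cohomology.mapEquiv (cochainD ε) (cochainT σ) (cochainT_comm ε σ hσ) n

/-- The internal grading of `H^n(A, k)`. -/
def hhGr (n : ℕ) (g : ℤ) : Submodule k (HH ε n) :=
  Cohomology.grading (cochainD ε) (cochainGr 𝒜) n g

/-- The unit of `H^•(A, k)`. -/
def hhOne : HH ε 0 :=
  Cohomology.mk (cochainD ε) 0 ⟨MultilinearMap.constOfIsEmpty k _ 1, by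
    rw [LinearMap.mem_ker]; ext a; simp [cochainD_apply]⟩

/-- The opposite of the cup product: `smile f g = g ∪ f`. -/
def smile {p q n : ℕ} (h : p + q = n) : HH ε p →ₗ[k] HH ε q →ₗ[k] HH ε n :=
  (cupHH ε (show q + p = n by omega)).flip

end Trivial

section YD
variable {V W : Type*} [AddCommGroup V] [Module k V] [AddCommGroup W] [Module k W]

/-- A Yetter-Drinfeld module over the group algebra of `ℤ`: a `ℤ`-graded vector space with an action
of `ℤ` (given by the automorphism `t` by which the generator acts) that preserves the degree, as the
group is abelian. -/
structure IsYetterDrinfeld (t : V ≃ₗ[k] V) (gr : ℤ → Submodule k V) : Prop where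
  internal : DirectSum.IsInternal gr
  map_gr : ∀ n, (gr n).map (t : V →ₗ[k] V) = gr n

theorem IsYetterDrinfeld.bijective {t : V ≃ₗ[k] V} {gr : ℤ → Submodule k V}
    (hV : IsYetterDrinfeld t gr) : Function.Bijective (DirectSum.coeLinearMap gr) :=
  hV.internal

/-- The braiding `V ⊗ W → W ⊗ V`, `v ⊗ w ↦ (tⁿ w) ⊗ v` for `v` of degree `n`, where `t` acts on `W`
as `s`. -/
def IsYetterDrinfeld.braiding {t : V ≃ₗ[k] V} {gr : ℤ → Submodule k V}
    (hV : IsYetterDrinfeld t gr) (s : W ≃ₗ[k] W) : V ⊗[k] W →ₗ[k] W ⊗[k] V :=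
  TensorProduct.lift
    ((DirectSum.toModule k ℤ (W →ₗ[k] W ⊗[k] V) fun n =>
        LinearMap.lcomp k (W ⊗[k] V) ((s ^ n : W ≃ₗ[k] W) : W →ₗ[k] W) ∘ₗ
          (TensorProduct.mk k W V).flip ∘ₗ (gr n).subtype) ∘ₗ
      ((LinearEquiv.ofBijective (DirectSum.coeLinearMap gr) hV.bijective).symm :
        V →ₗ[k] DirectSum ℤ fun n => gr n))

theorem IsYetterDrinfeld.braiding_tmul {t : V ≃ₗ[k] V} {gr : ℤ → Submodule k V}
    (hV : IsYetterDrinfeld t gr) (s : W ≃ₗ[k] W) {n : ℤ} {v : V} (hv : v ∈ gr n) (w : W) :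
    hV.braiding s (v ⊗ₜ[k] w) = (s ^ n) w ⊗ₜ[k] v := by
  have : (LinearEquiv.ofBijective (DirectSum.coeLinearMap gr) hV.bijective).symm v =
      DirectSum.lof k ℤ (fun n => gr n) n ⟨v, hv⟩ := by
    rw [LinearEquiv.symm_apply_eq]
    simp
  simp [braiding, this]

/-- The grading of a tensor product. -/
def tensorGr (grV : ℤ → Submodule k V) (grW : ℤ → Submodule k W) (n : ℤ) :
    Submodule k (V ⊗[k] W) :=
  Submodule.span k {z | ∃ i j, i + j = n ∧ ∃ v ∈ grV i, ∃ w ∈ grW j, z = v ⊗ₜ[k] w}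

end YD

section Bimonoid
variable {A : Type*} [Ring A] [Algebra k A]

/-- The product `(μ ⊗ μ) ∘ (id ⊗ c ⊗ id)` of `A ⊗ A`. -/
def braidedMul (c : A ⊗[k] A →ₗ[k] A ⊗[k] A) : (A ⊗[k] A) ⊗[k] (A ⊗[k] A) →ₗ[k] A ⊗[k] A :=
  TensorProduct.map (LinearMap.mul' k A) (LinearMap.mul' k A) ∘ₗ
    ((TensorProduct.assoc k A A (A ⊗[k] A)).symm : A ⊗[k] (A ⊗[k] (A ⊗[k] A)) →ₗ[k] _) ∘ₗ
    LinearMap.lTensor A ((TensorProduct.assoc k A A A : (A ⊗[k] A) ⊗[k] A →ₗ[k] _) ∘ₗ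
      LinearMap.rTensor A c ∘ₗ
      ((TensorProduct.assoc k A A A).symm : A ⊗[k] (A ⊗[k] A) →ₗ[k] _)) ∘ₗ
    (TensorProduct.assoc k A A (A ⊗[k] A) : (A ⊗[k] A) ⊗[k] (A ⊗[k] A) →ₗ[k] _)

/-- An algebra `A` with a grading `𝒜`, an action of the generator by `σ`, a counit `ε` and a coproduct
`Δ` is a bimonoid in the braided category of Yetter-Drinfeld modules over the group algebra of `ℤ`. -/
structure IsBimonoidYD (σ : A ≃ₐ[k] A) (𝒜 : ℤ → Submodule k A) (ε : A →ₐ[k] k)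
    (Δ : A →ₗ[k] A ⊗[k] A) : Prop where
  yd : IsYetterDrinfeld σ.toLinearEquiv 𝒜
  one_mem : (1 : A) ∈ 𝒜 0
  mul_mem : ∀ {i j : ℤ} {a b : A}, a ∈ 𝒜 i → b ∈ 𝒜 j → a * b ∈ 𝒜 (i + j)
  counit_t : ∀ a, ε (σ a) = ε a
  counit_gr : ∀ {i : ℤ} {a : A}, a ∈ 𝒜 i → i ≠ 0 → ε a = 0
  comul_t : ∀ a, Δ (σ a) = TensorProduct.map σ.toLinearMap σ.toLinearMap (Δ a)
  comul_gr : ∀ {i : ℤ} {a : A}, a ∈ 𝒜 i → Δ a ∈ tensorGr 𝒜 𝒜 i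
  coassoc : ∀ a, TensorProduct.assoc k A A A (LinearMap.rTensor A Δ (Δ a)) =
    LinearMap.lTensor A Δ (Δ a)
  counit_left : ∀ a, TensorProduct.lid k A (LinearMap.rTensor A ε.toLinearMap (Δ a)) = a
  counit_right : ∀ a, TensorProduct.rid k A (LinearMap.lTensor A ε.toLinearMap (Δ a)) = a
  comul_one : Δ 1 = 1 ⊗ₜ[k] 1
  comul_mul : ∀ a b, Δ (a * b) =
    braidedMul (yd.braiding σ.toLinearEquiv) (Δ a ⊗ₜ[k] Δ b)

end Bimonoid

section GradedAlgebra
variable {H : ℕ → Type*} [∀ n, AddCommGroup (H n)] [∀ n, Module k (H n)]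

/-- A family `H 0, H 1, …` of Yetter-Drinfeld modules over the group algebra of `ℤ` with a product and
a unit is a graded algebra in Yetter-Drinfeld modules which is commutative with respect to the graded
braiding `f ⊗ g ↦ (-1)^(p q) c (f ⊗ g)`, for `f ∈ H p` and `g ∈ H q`. -/
structure IsGradedBraidedCommAlgebra (t : ∀ n, H n ≃ₗ[k] H n) (gr : ∀ n, ℤ → Submodule k (H n))
    (one : H 0) (mul : ∀ {p q n : ℕ}, p + q = n → (H p →ₗ[k] H q →ₗ[k] H n)) : Prop where
  yd : ∀ n, IsYetterDrinfeld (t n) (gr n)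
  one_t : t 0 one = one
  one_gr : one ∈ gr 0 0
  mul_t : ∀ {p q n : ℕ} (h : p + q = n) (a : H p) (b : H q),
    t n (mul h a b) = mul h (t p a) (t q b)
  mul_gr : ∀ {p q n : ℕ} (h : p + q = n) {i j : ℤ} {a : H p} {b : H q},
    a ∈ gr p i → b ∈ gr q j → mul h a b ∈ gr n (i + j)
  one_mul : ∀ {n : ℕ} (a : H n), mul (zero_add n) one a = a
  mul_one : ∀ {n : ℕ} (a : H n), mul (add_zero n) a one = a
  mul_assoc : ∀ {p q r l m n : ℕ} (hl : p + q = l) (hm : q + r = m) (hln : l + r = n)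
    (hmn : p + m = n) (a : H p) (b : H q) (c : H r),
    mul hln (mul hl a b) c = mul hmn a (mul hm b c)
  mul_comm : ∀ {p q n : ℕ} (h : p + q = n) (h' : q + p = n) (z : H p ⊗[k] H q),
    TensorProduct.lift (mul h) z =
      (-1 : k) ^ (p * q) • TensorProduct.lift (mul h') ((yd p).braiding (t q) z)

end GradedAlgebra

section Bimodules
variable (k) (A : Type*) [Ring A] [Algebra k A]

/-- The enveloping algebra `A ⊗ Aᵒᵖ`. -/
abbrev Env : Type _ := A ⊗[k] Aᵐᵒᵖ

/-- The bar bimodule `A ⊗ A^{⊗ n} ⊗ A`, written as `(A ⊗ Aᵒᵖ) ⊗ A^{⊗ n}`. -/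
abbrev Bar (n : ℕ) : Type _ := Env k A ⊗[k] PiTensorProduct k (fun _ : Fin n => A)

variable {k A}

/-- The action of `A ⊗ Aᵒᵖ` on the trivial bimodule `k`. -/
def Env.ε (ε : A →ₐ[k] k) : Env k A →ₐ[k] k :=
  (Algebra.TensorProduct.lmul' k).comp
    (Algebra.TensorProduct.map ε (ε.fromOpposite fun _ _ => Commute.all _ _))

theorem Env.ε_tmul (ε : A →ₐ[k] k) (a : A) (b : Aᵐᵒᵖ) :
    Env.ε ε (a ⊗ₜ b) = ε a * ε b.unop := by
  simp [Env.ε]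

/-- The automorphism `σ ⊗ σ` of `A ⊗ Aᵒᵖ`. -/
def Env.map (σ : A ≃ₐ[k] A) : Env k A →ₐ[k] Env k A :=
  Algebra.TensorProduct.map σ.toAlgHom (AlgHom.op σ.toAlgHom)

variable (k A)

/-- `(a₁, …, aₙ) ↦ 1 ⊗ a₁ ⊗ ⋯ ⊗ aₙ ⊗ 1` -/
def barUniversal (n : ℕ) : MultilinearMap k (fun _ : Fin n => A) (Bar k A n) :=
  ((TensorProduct.mk k (Env k A) (PiTensorProduct k fun _ : Fin n => A)) 1).compMultilinearMap
    (PiTensorProduct.tprod k)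

/-- The left action of `A` on the bar bimodule. -/
def barLeft (n : ℕ) : A →ₗ[k] Bar k A n →ₗ[k] Bar k A n :=
  (Algebra.lsmul k k (Bar k A n)).toLinearMap ∘ₗ
    (Algebra.TensorProduct.includeLeft : A →ₐ[k] Env k A).toLinearMap

/-- The right action of `A` on the bar bimodule. -/
def barRight (n : ℕ) : A →ₗ[k] Bar k A n →ₗ[k] Bar k A n :=
  (Algebra.lsmul k k (Bar k A n)).toLinearMap ∘ₗ
    (Algebra.TensorProduct.includeRight : Aᵐᵒᵖ →ₐ[k] Env k A).toLinearMap ∘ₗ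
    (MulOpposite.opLinearEquiv k : A ≃ₗ[k] Aᵐᵒᵖ).toLinearMap

/-- The differential of the bar complex, the bimodule map which sends `1 ⊗ a₁ ⊗ ⋯ ⊗ a_{n+1} ⊗ 1` to
`a₁ ⊗ a₂ ⊗ ⋯ ⊗ 1 + ∑ⱼ (-1)^j 1 ⊗ ⋯ ⊗ a_j a_{j+1} ⊗ ⋯ ⊗ 1 + (-1)^(n+1) 1 ⊗ ⋯ ⊗ aₙ ⊗ a_{n+1}`. -/
def barD (n : ℕ) : Bar k A (n + 1) →ₗ[Env k A] Bar k A n :=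
  TensorProduct.AlgebraTensorModule.lift
    (LinearMap.toSpanSingleton (Env k A) _
      (PiTensorProduct.lift (hochD (A := A) (M := Bar k A n) (barLeft k A n) (barRight k A n) n
        (barUniversal k A n))))

/-- The augmentation `A ⊗ A → A` of the bar complex. -/
def barAug : Bar k A 0 →ₗ[k] A :=
  (TensorProduct.rid k A).toLinearMap ∘ₗ
    TensorProduct.map ((AlgHom.mulLeftRight k A).toLinearMap.flip 1)
      (PiTensorProduct.isEmptyEquiv (Fin 0)).toLinearMap

end Bimodules

/-- Data for a sequence of free bimodules `Pₙ = A ⊗ Vₙ ⊗ A`, where `Vₙ` has a finite homogeneous basis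
`vᵢ` of cardinality `rank n`: the internal degrees of the basis and the values of the action of the
group generator, of the differential and of the augmentation `P₀ → A` on the elements
`1 ⊗ vᵢ ⊗ 1`. -/
structure BimoduleComplex (k A : Type*) [Field k] [Ring A] [Algebra k A] where
  rank : ℕ → ℕ
  deg : ∀ n, Fin (rank n) → ℤ
  t : ∀ n, Fin (rank n) → (Fin (rank n) → Env k A)
  d : ∀ n, Fin (rank (n + 1)) → (Fin (rank n) → Env k A)
  aug : Fin (rank 0) → A

namespace BimoduleComplex
variable {A : Type*} [Ring A] [Algebra k A] (R : BimoduleComplex k A)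

/-- The free bimodule `Pₙ = A ⊗ Vₙ ⊗ A`, as the free `A ⊗ Aᵒᵖ`-module of rank `dim Vₙ`; the `i`-th
coordinate of `a ⊗ vᵢ ⊗ b` is `a ⊗ b`. -/
abbrev P (n : ℕ) : Type _ := Fin (R.rank n) → Env k A

/-- The bimodule map `P_{n+1} → Pₙ` with the given values on generators. -/
def dMap (n : ℕ) : R.P (n + 1) →ₗ[Env k A] R.P n :=
  Fintype.linearCombination (Env k A) (R.d n)

/-- The bimodule map `P₀ → A` with the given values on generators. -/
def augMap : R.P 0 →ₗ[k] A :=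
  ∑ i, (AlgHom.mulLeftRight k A).toLinearMap.flip (R.aug i) ∘ₗ LinearMap.proj i

/-- The map `Pₙ → Pₙ`, `a ⊗ vᵢ ⊗ b ↦ σ(a) · t(1 ⊗ vᵢ ⊗ 1) · σ(b)`. -/
def tMap (σ : A ≃ₐ[k] A) (n : ℕ) : R.P n →ₗ[k] R.P n :=
  (Fintype.linearCombination (Env k A) (R.t n)).restrictScalars k ∘ₗ
    LinearMap.pi fun i => (Env.map σ).toLinearMap ∘ₗ LinearMap.proj i

/-- The internal grading of `A ⊗ Vₙ ⊗ A` as a tensor product of graded spaces. -/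
def gr (𝒜 : ℤ → Submodule k A) (n : ℕ) (s : ℤ) : Submodule k (R.P n) :=
  Submodule.span k {m | ∃ i p q, p + R.deg n i + q = s ∧ ∃ a ∈ 𝒜 p, ∃ b ∈ 𝒜 q,
    m = Pi.single i (a ⊗ₜ[k] MulOpposite.op b)}

/-- The given data define a complex `P• → A` of bimodules in Yetter-Drinfeld modules (with `τ` as the
action of the group generator) which is a projective resolution of `A` as an `A`-bimodule. -/
structure IsResolutionYD (σ : A ≃ₐ[k] A) (𝒜 : ℤ → Submodule k A)
    (τ : ∀ n, R.P n ≃ₗ[k] R.P n) : Prop where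
  t_eq : ∀ n m, τ n m = R.tMap σ n m
  yd : ∀ n, IsYetterDrinfeld (τ n) (R.gr 𝒜 n)
  t_smul : ∀ n (z : Env k A) (m : R.P n), τ n (z • m) = Env.map σ z • τ n m
  gr_smul : ∀ n {p q s : ℤ} {a b : A} {m : R.P n}, a ∈ 𝒜 p → b ∈ 𝒜 q → m ∈ R.gr 𝒜 n s →
    (a ⊗ₜ[k] MulOpposite.op b : Env k A) • m ∈ R.gr 𝒜 n (p + s + q)
  d_t : ∀ n m, R.dMap n (τ (n + 1) m) = τ n (R.dMap n m)
  d_gr : ∀ n {s : ℤ} {m : R.P (n + 1)}, m ∈ R.gr 𝒜 (n + 1) s → R.dMap n m ∈ R.gr 𝒜 n s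
  aug_t : ∀ m, R.augMap (τ 0 m) = σ (R.augMap m)
  aug_gr : ∀ {s : ℤ} {m : R.P 0}, m ∈ R.gr 𝒜 0 s → R.augMap m ∈ 𝒜 s
  projective : ∀ n, Module.Projective (Env k A) (R.P n)
  aug_surjective : Function.Surjective R.augMap
  exact_zero : Function.Exact (R.dMap 0) R.augMap
  exact_succ : ∀ n, Function.Exact (R.dMap (n + 1)) (R.dMap n)

variable (ε : A →ₐ[k] k)

/-- The resolution is minimal: the differentials vanish after applying `k ⊗_A - ⊗_A k`. -/
def IsMinimal : Prop :=
  ∀ n (m : R.P (n + 1)) (i : Fin (R.rank n)), Env.ε ε (R.dMap n m i) = 0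

/-- The subspace of `Hom_k(Pₙ, k)` of all bimodule maps, where `k` is a bimodule through `ε`. -/
def homSubmodule (n : ℕ) : Submodule k (R.P n →ₗ[k] k) where
  carrier := {f | ∀ (z : Env k A) (m : R.P n), f (z • m) = Env.ε ε z * f m}
  zero_mem' := fun _ _ => by simp
  add_mem' := fun {f g} hf hg z m => by simp [hf z m, hg z m, mul_add]
  smul_mem' := fun c f hf z m => by simp [hf z m, mul_left_comm]

/-- The space `Hom_{AA}(Pₙ, k)` of bimodule maps from `Pₙ` to the trivial bimodule `k`. -/
def Hom (n : ℕ) : Type _ := ↥(R.homSubmodule ε n)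

instance (n : ℕ) : AddCommGroup (R.Hom ε n) :=
  inferInstanceAs (AddCommGroup ↥(R.homSubmodule ε n))

instance (n : ℕ) : Module k (R.Hom ε n) := inferInstanceAs (Module k ↥(R.homSubmodule ε n))

/-- The inclusion of `Hom_{AA}(Pₙ, k)` in `Hom_k(Pₙ, k)`. -/
def Hom.val (n : ℕ) : R.Hom ε n →ₗ[k] R.P n →ₗ[k] k := (R.homSubmodule ε n).subtype

/-- The differential of the complex `Hom_{AA}(P•, k)`. -/
def homD (n : ℕ) : R.Hom ε n →ₗ[k] R.Hom ε (n + 1) :=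
  LinearMap.restrict (LinearMap.lcomp k k ((R.dMap n).restrictScalars k)) fun f hf z m => by
    simp [hf z (R.dMap n m)]

/-- The bimodule maps of internal degree `g`: those which vanish on internal degree `s` unless
`s + g = 0`. -/
def homGr (𝒜 : ℤ → Submodule k A) (n : ℕ) (g : ℤ) : Submodule k (R.Hom ε n) where
  carrier := {f | ∀ (s : ℤ) (m : R.P n), m ∈ R.gr 𝒜 n s → s + g ≠ 0 → Hom.val R ε n f m = 0}
  zero_mem' := fun _ _ _ _ => rfl
  add_mem' := fun {f f'} hf hf' s m hm h => by
    rw [map_add, LinearMap.add_apply, hf s m hm h, hf' s m hm h, add_zero]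
  smul_mem' := fun c f hf s m hm h => by
    rw [map_smul, LinearMap.smul_apply, hf s m hm h, smul_zero]

variable {R ε}
variable {σ : A ≃ₐ[k] A} {𝒜 : ℤ → Submodule k A} {τ : ∀ n, R.P n ≃ₗ[k] R.P n}

theorem Env.ε_map (hσ : ∀ a, ε (σ a) = ε a) (z : Env k A) :
    Env.ε ε (Env.map σ z) = Env.ε ε z := by
  induction z using TensorProduct.induction_on with
  | zero => simp
  | add x y hx hy => simp [hx, hy]
  | tmul a b => simp [Env.map, Env.ε_tmul, hσ]

theorem Env.map_symm (σ : A ≃ₐ[k] A) (z : Env k A) : Env.map σ (Env.map σ.symm z) = z := by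
  induction z using TensorProduct.induction_on with
  | zero => simp
  | add x y hx hy => simp [hx, hy]
  | tmul a b => simp [Env.map]

/-- The action of the group generator on `Hom_{AA}(Pₙ, k)`, `(t · f)(v) = f (t⁻¹ v)`. -/
def homT (hR : R.IsResolutionYD σ 𝒜 τ) (hσ : ∀ a, ε (σ a) = ε a) (n : ℕ) :
    R.Hom ε n ≃ₗ[k] R.Hom ε n where
  toFun f := ⟨f.1 ∘ₗ (τ n).symm.toLinearMap, fun z m => by
    have h : (τ n).symm (z • m) = Env.map σ.symm z • (τ n).symm m := by
      rw [LinearEquiv.symm_apply_eq, hR.t_smul, Env.map_symm, LinearEquiv.apply_symm_apply]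
    have h' := Env.ε_map hσ (Env.map σ.symm z)
    rw [Env.map_symm] at h'
    simp only [LinearMap.comp_apply, LinearEquiv.coe_coe, h, f.2 _ _, h']⟩
  map_add' f g := rfl
  map_smul' c f := rfl
  invFun f := ⟨f.1 ∘ₗ (τ n).toLinearMap, fun z m => by
    simp only [LinearMap.comp_apply, LinearEquiv.coe_coe, hR.t_smul, f.2 _ _, Env.ε_map hσ]⟩
  left_inv f := Subtype.ext (LinearMap.ext fun m => congrArg f.1 ((τ n).symm_apply_apply m))
  right_inv f := Subtype.ext (LinearMap.ext fun m => congrArg f.1 ((τ n).apply_symm_apply m))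

theorem homT_comm (hR : R.IsResolutionYD σ 𝒜 τ) (hσ : ∀ a, ε (σ a) = ε a) (n : ℕ) :
    R.homD ε n ∘ₗ (homT hR hσ n : R.Hom ε n →ₗ[k] R.Hom ε n) =
      (homT hR hσ (n + 1) : R.Hom ε (n + 1) →ₗ[k] R.Hom ε (n + 1)) ∘ₗ R.homD ε n := by
  apply LinearMap.ext
  intro f
  apply Subtype.ext
  apply LinearMap.ext
  intro m
  obtain ⟨m, rfl⟩ := (τ (n + 1)).surjective m
  change f.1 ((τ n).symm (R.dMap n (τ (n + 1) m))) =
    f.1 (R.dMap n ((τ (n + 1)).symm (τ (n + 1) m)))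
  rw [hR.d_t, LinearEquiv.symm_apply_apply, LinearEquiv.symm_apply_apply]

variable (R) in
/-- `φ` is a comparison map from `P•` to the bar resolution: a morphism of complexes of bimodules over
the identity of `A`. -/
structure IsComparison (φ : ∀ n, R.P n →ₗ[Env k A] Bar k A n) : Prop where
  comm : ∀ n m, barD k A n (φ (n + 1) m) = φ n (R.dMap n m)
  aug : ∀ m, barAug k A (φ 0 m) = R.augMap m

end BimoduleComplex

section Pull
variable {A : Type*} [Ring A] [Algebra k A] (ε : A →ₐ[k] k)

/-- The bimodule map `A ⊗ A^{⊗ n} ⊗ A → k` which corresponds to a cochain `f`,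
`a ⊗ w ⊗ b ↦ ε(a) f(w) ε(b)`. -/
def barEval (n : ℕ) : Cochain k A n →ₗ[k] Bar k A n →ₗ[k] k where
  toFun f := LinearMap.mul' k k ∘ₗ
    TensorProduct.map (Env.ε ε).toLinearMap (PiTensorProduct.lift f)
  map_add' f g := by ext; simp [mul_add]
  map_smul' c f := by ext; simp [mul_left_comm]

theorem barEval_tmul_tprod {n : ℕ} (f : Cochain k A n) (z : Env k A) (a : Fin n → A) :
    barEval ε n f (z ⊗ₜ PiTensorProduct.tprod k a) = Env.ε ε z * f a := by
  simp [barEval]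

theorem barEval_smul {n : ℕ} (f : Cochain k A n) (z : Env k A) (w : Bar k A n) :
    barEval ε n f (z • w) = Env.ε ε z * barEval ε n f w := by
  induction w using TensorProduct.induction_on with
  | zero => simp
  | add x y hx hy => rw [smul_add, map_add, hx, hy, map_add, mul_add]
  | tmul x y => simp [barEval, TensorProduct.smul_tmul', mul_assoc]

theorem barEval_barD {n : ℕ} (f : Cochain k A n) (w : Bar k A (n + 1)) :
    barEval ε n f (barD k A n w) = barEval ε (n + 1) (cochainD ε n f) w := by
  induction w using TensorProduct.induction_on with
  | zero => simp
  | add x y hx hy => rw [map_add, map_add, hx, hy, map_add]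
  | tmul z y =>
    induction y using PiTensorProduct.induction_on with
    | add x y hx hy => rw [TensorProduct.tmul_add, map_add, map_add, hx, hy, map_add]
    | smul_tprod c a =>
      rw [TensorProduct.tmul_smul, LinearMap.map_smul_of_tower, map_smul, map_smul,
        barEval_tmul_tprod]
      simp only [barD, TensorProduct.AlgebraTensorModule.lift_tmul,
        LinearMap.toSpanSingleton_apply, LinearMap.smul_apply, PiTensorProduct.lift.tprod,
        barEval_smul, hochD_apply, cochainD_apply]
      congr 2
      have hu : ∀ b : Fin n → A, barEval ε n f (barUniversal k A n b) = f b := fun b => by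
        change barEval ε n f (1 ⊗ₜ[k] PiTensorProduct.tprod k b) = f b
        rw [barEval_tmul_tprod, map_one, one_mul]
      have hl : ∀ (b : A) (w : Bar k A n), barEval ε n f (barLeft k A n b w) =
          ε b * barEval ε n f w := fun b w => by
        change barEval ε n f ((b ⊗ₜ[k] (1 : Aᵐᵒᵖ) : Env k A) • w) = _
        rw [barEval_smul, Env.ε_tmul, MulOpposite.unop_one, map_one, mul_one]
      have hr : ∀ (b : A) (w : Bar k A n), barEval ε n f (barRight k A n b w) =
          ε b * barEval ε n f w := fun b w => by
        change barEval ε n f (((1 : A) ⊗ₜ[k] MulOpposite.op b : Env k A) • w) = _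
        rw [barEval_smul, Env.ε_tmul, MulOpposite.unop_op, map_one, one_mul]
      simp only [map_add, map_sum, map_smul, hl, hr, hu, smul_eq_mul]

variable (R : BimoduleComplex k A)

/-- Composition of bimodule maps from the bar complex to `k` with `φ`. -/
def pullback (φ : ∀ n, R.P n →ₗ[Env k A] Bar k A n) (n : ℕ) : Cochain k A n →ₗ[k] R.Hom ε n :=
  LinearMap.codRestrict (R.homSubmodule ε n)
    (LinearMap.lcomp k k ((φ n).restrictScalars k) ∘ₗ barEval ε n) fun f z m => by
      simp [barEval_smul]

variable {ε R}

theorem pullback_comm {φ : ∀ n, R.P n →ₗ[Env k A] Bar k A n} (hφ : R.IsComparison φ) (n : ℕ) :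
    R.homD ε n ∘ₗ pullback ε R φ n = pullback ε R φ (n + 1) ∘ₗ cochainD ε n := by
  apply LinearMap.ext
  intro f
  apply Subtype.ext
  apply LinearMap.ext
  intro m
  change barEval ε n f (φ n (R.dMap n m)) = barEval ε (n + 1) (cochainD ε n f) (φ (n + 1) m)
  rw [← hφ.comm, barEval_barD]

/-- The map from `H^n(A, k)` to the cohomology of `Hom_{AA}(P•, k)` induced by a comparison map. -/
def comparison {φ : ∀ n, R.P n →ₗ[Env k A] Bar k A n} (hφ : R.IsComparison φ) (n : ℕ) :
    HH ε n →ₗ[k] Cohomology (X := fun n => R.Hom ε n) (R.homD ε) n :=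
  Cohomology.map (X := fun n => Cochain k A n) (Y := fun n => R.Hom ε n) (cochainD ε) (R.homD ε) (pullback ε R φ) (pullback_comm hφ) n

variable {σ : A ≃ₐ[k] A} {𝒜 : ℤ → Submodule k A} {τ : ∀ n, R.P n ≃ₗ[k] R.P n}

/-- The complex `Hom_{AA}(P•, k)` of Yetter-Drinfeld modules computes `H^•(A, k)` with its
Yetter-Drinfeld structure, through the comparison map `φ`. -/
structure ComputesHH (hσ : ∀ a, ε (σ a) = ε a) (hR : R.IsResolutionYD σ 𝒜 τ)
    {φ : ∀ n, R.P n →ₗ[Env k A] Bar k A n} (hφ : R.IsComparison φ) : Prop where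
  hom_yd : ∀ n, IsYetterDrinfeld (V := R.Hom ε n) (BimoduleComplex.homT hR hσ n) (R.homGr ε 𝒜 n)
  bijective : ∀ n, Function.Bijective (comparison (ε := ε) hφ n)
  map_t : ∀ n x, comparison (ε := ε) hφ n (hhT ε σ hσ n x) =
    Cohomology.mapEquiv (X := fun n => R.Hom ε n) (R.homD ε) (BimoduleComplex.homT hR hσ)
      (BimoduleComplex.homT_comm hR hσ) n (comparison hφ n x)
  map_gr : ∀ n g, (hhGr ε 𝒜 n g).map (comparison (ε := ε) hφ n) =
    Cohomology.grading (X := fun n => R.Hom ε n) (R.homD ε) (R.homGr ε 𝒜) n g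

end Pull

section Planes
variable (k)

/-- The relation `y x - x y + x² / 2 = 0`. -/
inductive JordanRel : FreeAlgebra k (Fin 2) → FreeAlgebra k (Fin 2) → Prop
  | rel : JordanRel
      (FreeAlgebra.ι k 1 * FreeAlgebra.ι k 0 - FreeAlgebra.ι k 0 * FreeAlgebra.ι k 1
        + (2⁻¹ : k) • (FreeAlgebra.ι k 0 * FreeAlgebra.ι k 0)) 0

/-- The Jordan plane `k⟨x, y⟩ / (y x - x y + x² / 2)`, meant for `k` of characteristic different
from `2`. -/
def JordanPlane : Type _ := RingQuot (JordanRel k)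

instance : Ring (JordanPlane k) := inferInstanceAs (Ring (RingQuot (JordanRel k)))
instance : Algebra k (JordanPlane k) := inferInstanceAs (Algebra k (RingQuot (JordanRel k)))

/-- The relations `x² = 0` and `y² x - x y² - x y x = 0`. -/
inductive SuperJordanRel : FreeAlgebra k (Fin 2) → FreeAlgebra k (Fin 2) → Prop
  | sq : SuperJordanRel (FreeAlgebra.ι k 0 * FreeAlgebra.ι k 0) 0
  | rel : SuperJordanRel
      (FreeAlgebra.ι k 1 * FreeAlgebra.ι k 1 * FreeAlgebra.ι k 0
        - FreeAlgebra.ι k 0 * FreeAlgebra.ι k 1 * FreeAlgebra.ι k 1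
        - FreeAlgebra.ι k 0 * FreeAlgebra.ι k 1 * FreeAlgebra.ι k 0) 0

/-- The super Jordan plane `k⟨x, y⟩ / (x², y² x - x y² - x y x)`. -/
def SuperJordanPlane : Type _ := RingQuot (SuperJordanRel k)

instance : Ring (SuperJordanPlane k) := inferInstanceAs (Ring (RingQuot (SuperJordanRel k)))
instance : Algebra k (SuperJordanPlane k) :=
  inferInstanceAs (Algebra k (RingQuot (SuperJordanRel k)))

variable {k}

/-- The span of all words of length `n` in `x` and `y`. -/
def wordGr {A : Type*} [Ring A] [Algebra k A] (x y : A) (n : ℤ) : Submodule k A :=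
  Submodule.span k {a | ∃ w : List A, (∀ v ∈ w, v = x ∨ v = y) ∧ (w.length : ℤ) = n ∧ a = w.prod}

/-- The element `a ⊗ vᵢ ⊗ b` of `A ⊗ V ⊗ A`. -/
def el {A : Type*} [Ring A] [Algebra k A] {r : ℕ} (a : A) (i : Fin r) (b : A) : Fin r → Env k A :=
  Pi.single i (a ⊗ₜ[k] MulOpposite.op b)

namespace JordanPlane
variable (k)

/-- The quotient map from the free algebra. -/
def mk : FreeAlgebra k (Fin 2) →ₐ[k] JordanPlane k := RingQuot.mkAlgHom k (JordanRel k)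

/-- The generator `x`. -/
def x : JordanPlane k := mk k (FreeAlgebra.ι k 0)

/-- The generator `y`. -/
def y : JordanPlane k := mk k (FreeAlgebra.ι k 1)

theorem rel : y k * x k - x k * y k + (2⁻¹ : k) • (x k * x k) = 0 := by
  have : mk k _ = mk k _ := RingQuot.mkAlgHom_rel k (JordanRel.rel (k := k))
  simpa [x, y] using this

variable {k}

/-- The universal property of the algebra. -/
def lift {B : Type*} [Ring B] [Algebra k B] (u v : B)
    (h : v * u - u * v + (2⁻¹ : k) • (u * u) = 0) : JordanPlane k →ₐ[k] B :=
  RingQuot.liftAlgHom k ⟨FreeAlgebra.lift k ![u, v], by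
    rintro _ _ ⟨⟩
    simpa using h⟩

@[simp] theorem lift_x {B : Type*} [Ring B] [Algebra k B] (u v : B)
    (h : v * u - u * v + (2⁻¹ : k) • (u * u) = 0) : lift u v h (x k) = u :=
  (RingQuot.liftAlgHom_mkAlgHom_apply k _ _ _).trans (by simp)

@[simp] theorem lift_y {B : Type*} [Ring B] [Algebra k B] (u v : B)
    (h : v * u - u * v + (2⁻¹ : k) • (u * u) = 0) : lift u v h (y k) = v :=
  (RingQuot.liftAlgHom_mkAlgHom_apply k _ _ _).trans (by simp)

theorem hom_ext {B : Type*} [Ring B] [Algebra k B] {f g : JordanPlane k →ₐ[k] B}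
    (hx : f (x k) = g (x k)) (hy : f (y k) = g (y k)) : f = g := by
  apply RingQuot.ringQuot_ext'
  apply FreeAlgebra.hom_ext
  ext i
  fin_cases i
  · exact hx
  · exact hy

variable (k)

/-- The counit, which sends `x` and `y` to `0`. -/
def ε : JordanPlane k →ₐ[k] k := lift 0 0 (by simp)

/-- The action of the generator of the group: `x ↦ x`, `y ↦ x + y`. -/
def t : JordanPlane k ≃ₐ[k] JordanPlane k :=
  AlgEquiv.ofAlgHom
    (lift (x k) (x k + y k) (by rw [← rel k]; noncomm_ring))
    (lift (x k) (y k - x k) (by rw [← rel k]; noncomm_ring))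
    (hom_ext (by simp) (by simp))
    (hom_ext (by simp) (by simp))

theorem ε_t (a : JordanPlane k) : ε k (t k a) = ε k a := by
  have : (ε k).comp (t k).toAlgHom = ε k := hom_ext (by simp [t, ε]) (by simp [t, ε])
  exact DFunLike.congr_fun this a

/-- The internal grading, with `x` and `y` of degree `1`. -/
def gr : ℤ → Submodule k (JordanPlane k) := wordGr (x k) (y k)

/-- The dimensions of the spaces `Vₙ`. -/
def rank : ℕ → ℕ
  | 0 => 1
  | 1 => 2
  | 2 => 1
  | _ + 3 => 0

/-- The resolution `0 → A ⊗ V₂ ⊗ A → A ⊗ V₁ ⊗ A → A ⊗ A → A` with `V₁` spanned by `x, y` and `V₂`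
spanned by the relation `y x - x y + x² / 2`. -/
def resolution : BimoduleComplex k (JordanPlane k) where
  rank := rank
  deg
    | 0 => ![0]
    | 1 => ![1, 1]
    | 2 => ![2]
    | _ + 3 => fun _ => 0
  t
    | 0 => (![el 1 0 1] : Fin 1 → Fin 1 → Env k (JordanPlane k))
    | 1 => (![el 1 0 1, el 1 0 1 + el 1 1 1] : Fin 2 → Fin 2 → Env k (JordanPlane k))
    | 2 => (![el 1 0 1] : Fin 1 → Fin 1 → Env k (JordanPlane k))
    | _ + 3 => fun _ => 0
  d
    | 0 => (![el (x k) 0 1 - el 1 0 (x k), el (y k) 0 1 - el 1 0 (y k)] :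
        Fin 2 → Fin 1 → Env k (JordanPlane k))
    | 1 => (![el (y k) 0 1 + el 1 1 (x k) - el (x k) 1 1 - el 1 0 (y k)
        + (2⁻¹ : k) • el (x k) 0 1 + (2⁻¹ : k) • el 1 0 (x k)] :
        Fin 1 → Fin 2 → Env k (JordanPlane k))
    | _ + 2 => fun _ => 0
  aug := ![1]

end JordanPlane

namespace SuperJordanPlane
variable (k)

/-- The quotient map from the free algebra. -/
def mk : FreeAlgebra k (Fin 2) →ₐ[k] SuperJordanPlane k := RingQuot.mkAlgHom k (SuperJordanRel k)

/-- The generator `x`. -/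
def x : SuperJordanPlane k := mk k (FreeAlgebra.ι k 0)

/-- The generator `y`. -/
def y : SuperJordanPlane k := mk k (FreeAlgebra.ι k 1)

theorem sq : x k * x k = 0 := by
  have : mk k _ = mk k _ := RingQuot.mkAlgHom_rel k (SuperJordanRel.sq (k := k))
  simpa [x] using this

theorem rel : y k * y k * x k - x k * y k * y k - x k * y k * x k = 0 := by
  have : mk k _ = mk k _ := RingQuot.mkAlgHom_rel k (SuperJordanRel.rel (k := k))
  simpa [x, y] using this

variable {k}

/-- The universal property of the algebra. -/
def lift {B : Type*} [Ring B] [Algebra k B] (u v : B) (h : u * u = 0)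
    (h' : v * v * u - u * v * v - u * v * u = 0) : SuperJordanPlane k →ₐ[k] B :=
  RingQuot.liftAlgHom k ⟨FreeAlgebra.lift k ![u, v], by
    rintro _ _ ⟨⟩
    · simpa using h
    · simpa using h'⟩

@[simp] theorem lift_x {B : Type*} [Ring B] [Algebra k B] (u v : B) (h : u * u = 0)
    (h' : v * v * u - u * v * v - u * v * u = 0) : lift (k := k) u v h h' (x k) = u :=
  (RingQuot.liftAlgHom_mkAlgHom_apply k _ _ _).trans (by simp)

@[simp] theorem lift_y {B : Type*} [Ring B] [Algebra k B] (u v : B) (h : u * u = 0)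
    (h' : v * v * u - u * v * v - u * v * u = 0) : lift (k := k) u v h h' (y k) = v :=
  (RingQuot.liftAlgHom_mkAlgHom_apply k _ _ _).trans (by simp)

theorem hom_ext {B : Type*} [Ring B] [Algebra k B] {f g : SuperJordanPlane k →ₐ[k] B}
    (hx : f (x k) = g (x k)) (hy : f (y k) = g (y k)) : f = g := by
  apply RingQuot.ringQuot_ext'
  apply FreeAlgebra.hom_ext
  ext i
  fin_cases i
  · exact hx
  · exact hy

variable (k)

/-- The counit, which sends `x` and `y` to `0`. -/
def ε : SuperJordanPlane k →ₐ[k] k := lift 0 0 (by simp) (by simp)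

theorem t_rel {B : Type*} [Ring B] (u v : B) (h : u * u = 0)
    (h' : v * v * u - u * v * v - u * v * u = 0) :
    (u - v) * (u - v) * -u - -u * (u - v) * (u - v) - -u * (u - v) * -u = 0 := by
  have : (u - v) * (u - v) * -u - -u * (u - v) * (u - v) - -u * (u - v) * -u =
      -(v * v * u - u * v * v - u * v * u) + v * (u * u) - (u * u) * v - u * (u * u) := by
    noncomm_ring
  rw [this, h, h']
  simp

theorem t_rel' {B : Type*} [Ring B] (u v : B) (h : u * u = 0)
    (h' : v * v * u - u * v * v - u * v * u = 0) :
    (-u - v) * (-u - v) * -u - -u * (-u - v) * (-u - v) - -u * (-u - v) * -u = 0 := by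
  have : (-u - v) * (-u - v) * -u - -u * (-u - v) * (-u - v) - -u * (-u - v) * -u =
      -(v * v * u - u * v * v - u * v * u) - v * (u * u) + (u * u) * v + u * (u * u) := by
    noncomm_ring
  rw [this, h, h']
  simp

/-- The action of the generator of the group: `x ↦ -x`, `y ↦ x - y`. -/
def t : SuperJordanPlane k ≃ₐ[k] SuperJordanPlane k :=
  AlgEquiv.ofAlgHom
    (lift (-x k) (x k - y k) (by simp [sq]) (t_rel _ _ (sq k) (rel k)))
    (lift (-x k) (-x k - y k) (by simp [sq]) (t_rel' _ _ (sq k) (rel k)))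
    (hom_ext (by simp) (by simp))
    (hom_ext (by simp) (by simp))

theorem ε_t (a : SuperJordanPlane k) : ε k (t k a) = ε k a := by
  have : (ε k).comp (t k).toAlgHom = ε k := hom_ext (by simp [t, ε]) (by simp [t, ε])
  exact DFunLike.congr_fun this a

/-- The internal grading, with `x` and `y` of degree `1`. -/
def gr : ℤ → Submodule k (SuperJordanPlane k) := wordGr (x k) (y k)

/-- The dimensions of the spaces `Vₙ`. -/
def rank : ℕ → ℕ
  | 0 => 1
  | _ + 1 => 2

/-- The resolution with `V₀ = k`, `V₁` spanned by `x, y`, and `Vₙ` spanned by `xⁿ` (index `0`) and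
`y² xⁿ⁻¹` (index `1`) for `n ≥ 2`. -/
def resolution : BimoduleComplex k (SuperJordanPlane k) where
  rank := rank
  deg
    | 0 => ![0]
    | 1 => ![1, 1]
    | n + 2 => ![(n : ℤ) + 2, (n : ℤ) + 3]
  t
    | 0 => (![el 1 0 1] : Fin 1 → Fin 1 → Env k (SuperJordanPlane k))
    | 1 => (![-el 1 0 1, el 1 0 1 - el 1 1 1] : Fin 2 → Fin 2 → Env k (SuperJordanPlane k))
    | n + 2 => (![(-1 : k) ^ (n + 2) • el 1 0 1,
        -el 1 0 (y k) + (-1 : k) ^ (n + 1) • el (x k - y k) 0 1 + (-1 : k) ^ (n + 1) • el 1 1 1] :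
        Fin 2 → Fin 2 → Env k (SuperJordanPlane k))
  d
    | 0 => (![el (x k) 0 1 - el 1 0 (x k), el (y k) 0 1 - el 1 0 (y k)] :
        Fin 2 → Fin 1 → Env k (SuperJordanPlane k))
    | 1 => (![el 1 0 (x k) + el (x k) 0 1,
        el (y k * y k) 0 1 + el (y k) 1 (x k) + el 1 1 (y k * x k)
          - el (x k * y k) 1 1 - el (x k) 1 (y k) - el 1 0 (y k * y k)
          - el (x k * y k) 0 1 - el (x k) 1 (x k) - el 1 0 (y k * x k)] :
        Fin 2 → Fin 2 → Env k (SuperJordanPlane k))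
    | n + 2 => (![el (x k) 0 1 + (-1 : k) ^ (n + 3) • el 1 0 (x k),
        el (y k * y k) 0 1 + (-1 : k) ^ (n + 3) • el 1 1 (x k) - el (x k) 1 1
          - el (x k * y k) 0 1 - el 1 0 (y k * y k) - el 1 0 (y k * x k)] :
        Fin 2 → Fin 2 → Env k (SuperJordanPlane k))
  aug := ![1]

end SuperJordanPlane
end Planes
end
end HochYD

/-! Both planes go through the same four arguments. Special to each are only its relations, a normal
form, the exactness beyond `P₁`, and the final computation of products.

Coproduct. In the braided square of `A`, left multiplication by `v ⊗ 1 + 1 ⊗ v`, with `v` of degree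
1, is the operator `primMul`. The operators for `x` and `y` satisfy the defining relations, so `A`
acts on `A ⊗ A`, and `Δ a` has to be the result of applying `a` to `1 ⊗ 1`. The bimonoid axioms and
uniqueness follow by adding one generator at a time on the left (`existsUnique_comul`).

Resolution. The kernel of multiplication is generated by `v ⊗ 1 - 1 ⊗ v` for `v = x, y`, which is
exactness at `P₀`. The relations of `A` hold in the square-zero extension by the cokernel of `d₁`,
so there is a derivation into that cokernel with `x` and `y` going to the classes of the generators;
it gives exactness at `P₁` (`smul_add_smul_eq_zero`). For the Jordan plane only injectivity of `d₁`
is left, a leading term argument (`env_right_regular`) from the regularity of `x`. For the super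
Jordan plane the differentials from `d₁` on are triangular matrices with diagonal `ξ + β`, `-(ξ -
β)`, where `ξ = x ⊗ 1` and `β = ± 1 ⊗ x` commute and have square zero; in `d₁` the second entry has
a further regular factor. A contraction of right multiplication by `x` makes such matrices exact
(`exact_of_square_zero`). Regularity and contraction come from representations on polynomials that
encode the normal forms.

Comparison. `toBar` is built from the contraction of the bar complex, `fromBar` from degree
preserving linear sections of the differentials of `P`. Both composites are homotopic to the
identity. Minimality makes every bimodule map to `k` vanish on boundaries of `P`, so homotopies
leave no trace there, and the induced map in cohomology is bijective (`bijective_comparison`).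
Conjugating `toBar` by `t` gives another comparison map, whence equivariance (`pullback_cochainT`).
Since `toBar` and `fromBar` respect degrees, the gradings correspond (`computesHH`).

Commutativity. A class is determined by its values on the generators of `P`, and the recursion
defining `toBar` computes these values for cup products from the matrices of the differentials
(`barEval_toBar_succ`). For the Jordan plane only products of two classes of degree 1 matter. For
the super Jordan plane the coefficients at `xⁿ` and `y² xⁿ⁻¹` multiply by an explicit rule
(`smile_coeff`), `t` acts on them by signs, and they sit in different internal degrees; the signs
match. -/

namespace HochYD
noncomputable section
variable {k : Type*} [Field k]

/-! ### Graded vector spaces: internal direct sums and graded sections. -/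

section Graded
variable {V W : Type*} [AddCommGroup V] [Module k V] [AddCommGroup W] [Module k W]

/-- Independence holds because `π g` reads off the `g`-th component of a sum of homogeneous
elements. Every internal grading below is obtained from such projections, or by transport from one
that is. -/
theorem isInternal_of_proj (gr : ℤ → Submodule k V) (π : ℤ → V →ₗ[k] V)
    (h1 : ∀ g, ∀ v ∈ gr g, π g v = v) (h0 : ∀ g h, g ≠ h → ∀ v ∈ gr h, π g v = 0)
    (htop : ⨆ g, gr g = ⊤) : DirectSum.IsInternal gr := by
  classical
  constructor
  · rw [injective_iff_map_eq_zero]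
    intro z hz
    have key : ∀ (g : ℤ) (z : DirectSum ℤ fun g => gr g),
        π g (DirectSum.coeLinearMap gr z) = z g := by
      intro g z
      induction z using DirectSum.induction_on with
      | zero => simp
      | add a b ha hb => simp [ha, hb]
      | of h v =>
        rw [DirectSum.coeLinearMap_of]
        by_cases hgh : g = h
        · subst hgh
          simp [h1 g v v.2]
        · rw [h0 g h hgh v v.2, DirectSum.of_eq_of_ne _ _ _ hgh]
          rfl
    ext g
    rw [← key g z]
    change π g (DirectSum.coeAddMonoidHom gr z) = _
    rw [hz, map_zero]
    rfl
  · have := htop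
    rw [Submodule.iSup_eq_range_dfinsupp_lsum] at this
    exact LinearMap.range_eq_top.1 this

theorem induction_of_iSup_eq_top {gr : ℤ → Submodule k V} (h : ⨆ g, gr g = ⊤)
    (S : Submodule k V) (hS : ∀ g, gr g ≤ S) (v : V) : v ∈ S := by
  have : ⨆ g, gr g ≤ S := iSup_le hS
  rw [h] at this
  exact this trivial

/-- Over a field, a section of `f` onto its range exists and extends from the range to all of `W`.
-/
theorem exists_section (f : V →ₗ[k] W) : ∃ s : W →ₗ[k] V, ∀ v, f (s (f v)) = f v := by
  obtain ⟨s, hs⟩ := f.rangeRestrict.exists_rightInverse_of_surjective f.range_rangeRestrict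
  obtain ⟨s', hs'⟩ := LinearMap.exists_extend s
  refine ⟨s', fun v => ?_⟩
  have h1 := LinearMap.congr_fun hs' ⟨f v, v, rfl⟩
  have h2 := congrArg Subtype.val (LinearMap.congr_fun hs ⟨f v, v, rfl⟩)
  simp only [LinearMap.comp_apply, Submodule.subtype_apply] at h1
  rw [h1]
  exact h2

/-- Sections are chosen degree by degree and glued along the direct sum. They pick preimages of
boundaries without changing the degree, which is what makes `fromBar` homogeneous. -/
theorem exists_graded_section {grV : ℤ → Submodule k V} {grW : ℤ → Submodule k W}
    (hV : DirectSum.IsInternal grV) (hW : DirectSum.IsInternal grW) (d : W →ₗ[k] V)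
    (hd : ∀ g, ∀ w ∈ grW g, d w ∈ grV g) :
    ∃ s : V →ₗ[k] W, (∀ g, ∀ v ∈ grV g, s v ∈ grW g) ∧ ∀ w, d (s (d w)) = d w := by
  classical
  choose s hs using fun g => exists_section (d.restrict (hd g))
  have hV' : Function.Bijective (DirectSum.coeLinearMap grV) := hV
  let S : V →ₗ[k] W := (DirectSum.toModule k ℤ W fun g => (grW g).subtype ∘ₗ s g) ∘ₗ
    ((LinearEquiv.ofBijective (DirectSum.coeLinearMap grV) hV').symm :
      V →ₗ[k] DirectSum ℤ fun g => grV g)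
  have hS : ∀ g (v : grV g), S v = s g v := by
    intro g v
    have : (LinearEquiv.ofBijective (DirectSum.coeLinearMap grV) hV').symm v =
        DirectSum.lof k ℤ (fun g => grV g) g v := by
      rw [LinearEquiv.symm_apply_eq]
      simp
    simp [S, this]
  refine ⟨S, fun g v hv => ?_, fun w => ?_⟩
  · rw [hS g ⟨v, hv⟩]
    exact (s g ⟨v, hv⟩).2
  · refine induction_of_iSup_eq_top hW.submodule_iSup_eq_top
      (LinearMap.ker (d ∘ₗ S ∘ₗ d - d)) (fun g w hw => ?_) w |> fun h => by
        simpa [sub_eq_zero] using h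
    have h1 := congrArg Subtype.val (hs g ⟨w, hw⟩)
    have h2 := hS g ⟨d w, hd g w hw⟩
    simp only [LinearMap.mem_ker, LinearMap.sub_apply, LinearMap.comp_apply, sub_eq_zero]
    rw [h2]
    exact h1

end Graded

/-! ### Chain maps out of projective complexes are unique up to homotopy. -/

section Homotopy
variable {E : Type*} [Ring E]

/-- `g` is a bare function so that the lemma covers both differentials and augmentations; the latter
are not linear over `E` here. -/
theorem exists_lift_of_exact {C D D' D'' : Type*} [AddCommGroup C] [Module E C] [AddCommGroup D]
    [Module E D] [AddCommGroup D'] [Module E D'] [AddCommGroup D''] [Module.Projective E C]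
    {f : D →ₗ[E] D'} {g : D' → D''} (h : ∀ x, g x = 0 → ∃ y, f y = x) (e : C →ₗ[E] D')
    (he : ∀ c, g (e c) = 0) : ∃ l : C →ₗ[E] D, ∀ c, f (l c) = e c := by
  have : ∀ c, e c ∈ LinearMap.range f := fun c => h _ (he c)
  obtain ⟨l, hl⟩ := Module.projective_lifting_property f.rangeRestrict (e.codRestrict _ this)
    f.surjective_rangeRestrict
  exact ⟨l, fun c => congrArg Subtype.val (LinearMap.congr_fun hl c)⟩

variable {C D : ℕ → Type*} [∀ n, AddCommGroup (C n)] [∀ n, Module E (C n)]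
  [∀ n, AddCommGroup (D n)] [∀ n, Module E (D n)] {B : Type*} [AddCommGroup B]

/-- Two chain maps from a complex of projective modules to an exact complex which agree after
augmentation are homotopic. -/
theorem exists_homotopy [∀ n, Module.Projective E (C n)]
    (dC : ∀ n, C (n + 1) →ₗ[E] C n) (dD : ∀ n, D (n + 1) →ₗ[E] D n) (aug : D 0 →+ B)
    (hC : ∀ n x, dC n (dC (n + 1) x) = 0)
    (ex0 : ∀ x, aug x = 0 → ∃ y, dD 0 y = x)
    (ex : ∀ n x, dD n x = 0 → ∃ y, dD (n + 1) y = x)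
    (F G : ∀ n, C n →ₗ[E] D n)
    (hF : ∀ n x, dD n (F (n + 1) x) = F n (dC n x))
    (hG : ∀ n x, dD n (G (n + 1) x) = G n (dC n x))
    (haug : ∀ x, aug (F 0 x) = aug (G 0 x)) :
    ∃ h : ∀ n, C n →ₗ[E] D (n + 1), (∀ x, F 0 x - G 0 x = dD 0 (h 0 x)) ∧
      ∀ n x, F (n + 1) x - G (n + 1) x = dD (n + 1) (h (n + 1) x) + h n (dC n x) := by
  -- The invariant says that the next obstruction `F - G - h d` takes values in cycles, so exactness
  -- and projectivity provide the next homotopy.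
  let Inv : ∀ n, (C n →ₗ[E] D (n + 1)) → Prop := fun n h =>
    ∀ x, F n (dC n x) - G n (dC n x) - dD n (h (dC n x)) = 0
  have step : ∀ n (h : {h : C n →ₗ[E] D (n + 1) // Inv n h}),
      ∃ h' : {h : C (n + 1) →ₗ[E] D (n + 2) // Inv (n + 1) h},
        ∀ x, dD (n + 1) (h'.1 x) = (F (n + 1) - G (n + 1) - h.1 ∘ₗ dC n) x := by
    rintro n ⟨h, hh⟩
    obtain ⟨l, hl⟩ := exists_lift_of_exact (f := dD (n + 1)) (g := dD n) (ex n)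
      (F (n + 1) - G (n + 1) - h ∘ₗ dC n) (fun c => by simpa [hF, hG] using hh c)
    refine ⟨⟨l, fun x => ?_⟩, hl⟩
    rw [hl]
    simp [hC]
  obtain ⟨h0, hh0⟩ := exists_lift_of_exact (f := dD 0) (g := aug) ex0 (F 0 - G 0)
    (fun c => by simp [haug])
  choose next hnext using step
  let H : ∀ n, {h : C n →ₗ[E] D (n + 1) // Inv n h} :=
    fun n => Nat.rec ⟨h0, fun x => by rw [hh0]; simp⟩ next n
  refine ⟨fun n => (H n).1, fun x => (hh0 x).symm, fun n x => ?_⟩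
  have := hnext n (H n) x
  change _ = dD (n + 1) ((next n (H n)).1 x) + _
  rw [this]
  simp

end Homotopy
end
end HochYD

namespace HochYD
noncomputable section
variable {k : Type*} [Field k]

/-! ### The bar complex is exact. -/

section BarContraction
variable {A : Type*} [Ring A] [Algebra k A]

instance (n : ℕ) : AddCommGroup (Bar k A n) := TensorProduct.addCommGroup

theorem bar_ext {n : ℕ} {N : Type*} [AddCommGroup N] [Module k N] {f g : Bar k A n →ₗ[k] N}
    (h : ∀ (a b : A) (w : Fin n → A),
      f ((a ⊗ₜ MulOpposite.op b) ⊗ₜ PiTensorProduct.tprod k w) =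
        g ((a ⊗ₜ MulOpposite.op b) ⊗ₜ PiTensorProduct.tprod k w)) : f = g := by
  apply TensorProduct.ext
  apply TensorProduct.ext
  ext a b w
  exact h a b.unop w

theorem bar_hom_ext {n : ℕ} {N : Type*} [AddCommGroup N] [Module (Env k A) N] [Module k N]
    [IsScalarTower k (Env k A) N] {f g : Bar k A n →ₗ[Env k A] N}
    (h : ∀ w : Fin n → A, f (1 ⊗ₜ PiTensorProduct.tprod k w) =
        g (1 ⊗ₜ PiTensorProduct.tprod k w)) : f = g := by
  have : f.restrictScalars k = g.restrictScalars k := bar_ext fun a b w => by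
    have e : ((a ⊗ₜ MulOpposite.op b : Env k A) ⊗ₜ PiTensorProduct.tprod k w : Bar k A n) =
      (a ⊗ₜ MulOpposite.op b : Env k A) • (1 ⊗ₜ PiTensorProduct.tprod k w) := by
        rw [TensorProduct.smul_tmul', smul_eq_mul, mul_one]
    change f _ = g _
    rw [e, map_smul, map_smul, h]
  exact LinearMap.ext fun x => LinearMap.congr_fun this x

theorem bar_smul_tmul {n : ℕ} (z z' : Env k A) (w : PiTensorProduct k fun _ : Fin n => A) :
    z • (z' ⊗ₜ[k] w : Bar k A n) = (z * z') ⊗ₜ[k] w := by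
  rw [TensorProduct.smul_tmul', smul_eq_mul]

theorem barD_tmul {n : ℕ} (z : Env k A) (w : Fin (n + 1) → A) :
    barD k A n (z ⊗ₜ PiTensorProduct.tprod k w) =
      (z * (w 0 ⊗ₜ 1)) ⊗ₜ PiTensorProduct.tprod k (fun i => w i.succ)
      + ∑ j : Fin n, (-1 : k) ^ ((j : ℕ) + 1) •
        z ⊗ₜ PiTensorProduct.tprod k (Fin.contractNth j.castSucc (· * ·) w)
      + (-1 : k) ^ (n + 1) • (z * (1 ⊗ₜ MulOpposite.op (w (Fin.last n)))) ⊗ₜ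
        PiTensorProduct.tprod k (fun i => w i.castSucc) := by
  simp only [barD, TensorProduct.AlgebraTensorModule.lift_tmul,
    LinearMap.toSpanSingleton_apply, LinearMap.smul_apply, PiTensorProduct.lift.tprod, hochD_apply]
  have hu : ∀ v : Fin n → A, barUniversal k A n v = 1 ⊗ₜ[k] PiTensorProduct.tprod k v :=
    fun v => rfl
  have hl : ∀ (a : A) (x : Bar k A n), barLeft k A n a x = (a ⊗ₜ[k] (1 : Aᵐᵒᵖ) : Env k A) • x :=
    fun a x => rfl
  have hr : ∀ (a : A) (x : Bar k A n), barRight k A n a x =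
    ((1 : A) ⊗ₜ[k] MulOpposite.op a : Env k A) • x := fun a x => rfl
  simp only [hu, hl, hr, smul_add, Finset.smul_sum, smul_comm z, bar_smul_tmul, mul_one]

theorem barAug_tmul (z : Env k A) (w : Fin 0 → A) :
    barAug k A (z ⊗ₜ PiTensorProduct.tprod k w) = AlgHom.mulLeftRight k A z 1 := by
  simp [barAug]

variable (k A) in
/-- `a ⊗ w ↦ a ⊗ w` as a map `A ⊗ A^{⊗ n} → A^{⊗ (n + 1)}`. -/
def tensorCons (n : ℕ) : A →ₗ[k] PiTensorProduct k (fun _ : Fin n => A) →ₗ[k]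
    PiTensorProduct k (fun _ : Fin (n + 1) => A) :=
  (PiTensorProduct.lift (R := k) (s := fun _ : Fin n => A)).toLinearMap ∘ₗ
    (PiTensorProduct.tprod k (s := fun _ : Fin (n + 1) => A)).curryLeft

theorem tensorCons_tprod {n : ℕ} (a : A) (w : Fin n → A) :
    tensorCons k A n a (PiTensorProduct.tprod k w) =
      PiTensorProduct.tprod k (Fin.cons a w : Fin (n + 1) → A) := by
  simp [tensorCons]

variable (k A) in
/-- The contraction `a ⊗ w ⊗ b ↦ 1 ⊗ a ⊗ w ⊗ b` of the bar complex. -/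
def barContract (n : ℕ) : Bar k A n →ₗ[k] Bar k A (n + 1) :=
  TensorProduct.lift (TensorProduct.lift (LinearMap.mk₂ k
    (fun (a : A) (b : Aᵐᵒᵖ) => TensorProduct.mk k (Env k A) _ (1 ⊗ₜ b) ∘ₗ tensorCons k A n a)
    (fun a a' b => by ext; simp [TensorProduct.tmul_add])
    (fun c a b => by ext; simp)
    (fun a b b' => by ext; simp [TensorProduct.tmul_add])
    (fun c a b => by ext; simp [TensorProduct.smul_tmul'])))

theorem barContract_tmul {n : ℕ} (a : A) (b : Aᵐᵒᵖ) (w : Fin n → A) :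
    barContract k A n ((a ⊗ₜ b) ⊗ₜ PiTensorProduct.tprod k w) =
      (1 ⊗ₜ b) ⊗ₜ PiTensorProduct.tprod k (Fin.cons a w : Fin (n + 1) → A) := by
  simp [barContract, tensorCons_tprod]

theorem contractNth_zero_cons {α : Type*} (op : α → α → α) {n : ℕ} (a : α) (w : Fin (n + 1) → α) :
    Fin.contractNth (0 : Fin (n + 1)).castSucc op (Fin.cons a w : Fin (n + 2) → α) =
      (Fin.cons (op a (w 0)) fun i : Fin n => w i.succ : Fin (n + 1) → α) := by
  ext i
  refine Fin.cases ?_ (fun i => ?_) i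
  · simp [Fin.contractNth]
  · simp [Fin.contractNth]

theorem contractNth_succ_cons {α : Type*} (op : α → α → α) {n : ℕ} (j : Fin n) (a : α)
    (w : Fin (n + 1) → α) :
    Fin.contractNth j.succ.castSucc op (Fin.cons a w : Fin (n + 2) → α) =
      (Fin.cons a (Fin.contractNth j.castSucc op w) : Fin (n + 1) → α) := by
  ext i
  refine Fin.cases ?_ (fun i => ?_) i
  · simp [Fin.contractNth]
  · simp only [Fin.contractNth, Fin.cons_succ, Fin.val_succ, Fin.val_castSucc,
      add_lt_add_iff_right, add_left_inj, Fin.castSucc_succ]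

theorem sum_contractNth {n : ℕ} (j : Fin n) (e : Fin (n + 1) → ℤ) :
    ∑ i, Fin.contractNth j.castSucc (· + ·) e i = ∑ i, e i := by
  induction n with
  | zero => exact j.elim0
  | succ n ih =>
    rw [← Fin.cons_self_tail e]
    refine Fin.cases ?_ (fun j => ?_) j
    · rw [contractNth_zero_cons]
      simp [Fin.sum_univ_succ, add_assoc]
      rfl
    · rw [contractNth_succ_cons, Fin.sum_univ_succ, Fin.sum_univ_succ (Fin.cons _ _)]
      simp [ih]

theorem barContract_zero (m : Bar k A 0) :
    barD k A 0 (barContract k A 0 m) + (1 ⊗ₜ[k] MulOpposite.op (barAug k A m)) ⊗ₜ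
      PiTensorProduct.tprod k (fun i : Fin 0 => i.elim0) = m := by
  let f : Bar k A 0 →ₗ[k] Bar k A 0 :=
    (barD k A 0).restrictScalars k ∘ₗ barContract k A 0 +
      (TensorProduct.mk k (Env k A) _).flip (PiTensorProduct.tprod k (fun i : Fin 0 => i.elim0)) ∘ₗ
        TensorProduct.mk k A Aᵐᵒᵖ 1 ∘ₗ (MulOpposite.opLinearEquiv k).toLinearMap ∘ₗ barAug k A
  have : f = LinearMap.id := bar_ext fun a b w => by
    obtain rfl : w = (fun i : Fin 0 => i.elim0) := Subsingleton.elim _ _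
    simp only [f, LinearMap.add_apply, LinearMap.comp_apply, LinearMap.restrictScalars_apply,
      barContract_tmul, barD_tmul, barAug_tmul]
    simp
    rw [← MulOpposite.op_mul]
    have : (fun i : Fin 0 => (Fin.cons a (fun i : Fin 0 => i.elim0) : Fin 1 → A) i.castSucc) =
      fun i : Fin 0 => i.elim0 := Subsingleton.elim _ _
    rw [this]
    abel
  exact LinearMap.congr_fun this m

/-- The first face of `1 ⊗ a ⊗ w ⊗ b` gives back the argument. The remaining faces are those of the
argument with a `1` put in front, shifted by one place and hence with opposite sign. -/
theorem barContract_succ {n : ℕ} (m : Bar k A (n + 1)) :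
    barD k A (n + 1) (barContract k A (n + 1) m) + barContract k A n (barD k A n m) = m := by
  let f : Bar k A (n + 1) →ₗ[k] Bar k A (n + 1) :=
    (barD k A (n + 1)).restrictScalars k ∘ₗ barContract k A (n + 1) +
      barContract k A n ∘ₗ (barD k A n).restrictScalars k
  have : f = LinearMap.id := bar_ext fun a b w => by
    simp only [f, LinearMap.add_apply, LinearMap.comp_apply, LinearMap.restrictScalars_apply,
      barContract_tmul, barD_tmul, map_add, map_sum, map_smul, Fin.sum_univ_succ,
      contractNth_zero_cons, contractNth_succ_cons, Algebra.TensorProduct.tmul_mul_tmul,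
      mul_one, one_mul]
    have h1 : (fun i : Fin (n + 1) => (Fin.cons a w : Fin (n + 2) → A) i.castSucc) =
        (Fin.cons a fun i : Fin n => w i.castSucc : Fin (n + 1) → A) := by
      ext i
      refine Fin.cases ?_ (fun i => ?_) i
      · simp
      · rw [← Fin.succ_castSucc]
        simp
    rw [h1, ← Fin.succ_last]
    simp only [Fin.cons_zero, Fin.cons_succ, Fin.val_zero, zero_add, pow_one, neg_smul, one_smul,
      Fin.val_succ, pow_succ (-1 : k) (_ + 1), mul_neg_one, Finset.sum_neg_distrib,
      LinearMap.id_apply]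
    abel
  exact LinearMap.congr_fun this m

theorem barD_barD_zero (m : Bar k A 1) : barAug k A (barD k A 0 m) = 0 := by
  have : barAug k A ∘ₗ (barD k A 0).restrictScalars k = 0 := bar_ext fun a b w => by
    simp [barD_tmul, barAug_tmul, mul_assoc]
  exact LinearMap.congr_fun this m

/-- This comes from the contraction `h` rather than from identities between faces. Free generators
of the bimodule lie in the image of `h`, and two uses of `d h + h d = 1` turn `d d h` into `h d d`,
which vanishes by induction. -/
theorem barD_barD : ∀ {n : ℕ} (m : Bar k A (n + 2)), barD k A n (barD k A (n + 1) m) = 0 := by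
  have gen : ∀ n, (∀ m : Bar k A (n + 1), barD k A n (barD k A (n + 1) (barContract k A (n + 1) m))
      = 0) → ∀ m : Bar k A (n + 2), barD k A n (barD k A (n + 1) m) = 0 := by
    intro n h
    have : barD k A n ∘ₗ barD k A (n + 1) = 0 := bar_hom_ext fun w => by
      have hw : (1 ⊗ₜ PiTensorProduct.tprod k w : Bar k A (n + 2)) = barContract k A (n + 1)
          ((w 0 ⊗ₜ 1) ⊗ₜ PiTensorProduct.tprod k (fun i => w i.succ)) := by
        rw [barContract_tmul]
        congr 2
        exact (Fin.cons_self_tail w).symm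
      rw [hw]
      exact h _
    exact fun m => LinearMap.congr_fun this m
  intro n
  induction n with
  | zero =>
    refine gen 0 fun m => ?_
    have h1 := congrArg (barD k A 0) (barContract_succ m)
    have h2 := barContract_zero (barD k A 0 m)
    rw [barD_barD_zero] at h2
    simp only [MulOpposite.op_zero, TensorProduct.tmul_zero, TensorProduct.zero_tmul,
      add_zero] at h2
    rw [map_add, h2] at h1
    exact add_eq_right.1 h1
  | succ n ih =>
    refine gen (n + 1) fun m => ?_
    have h1 := congrArg (barD k A (n + 1)) (barContract_succ m)
    have h2 := barContract_succ (barD k A (n + 1) m)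
    rw [ih, map_zero, add_zero] at h2
    rw [map_add, h2] at h1
    exact add_eq_right.1 h1

theorem bar_exact_zero (m : Bar k A 0) (h : barAug k A m = 0) : ∃ m', barD k A 0 m' = m :=
  ⟨barContract k A 0 m, by simpa [h] using barContract_zero m⟩

theorem bar_exact_succ (n : ℕ) (m : Bar k A (n + 1)) (h : barD k A n m = 0) :
    ∃ m', barD k A (n + 1) m' = m :=
  ⟨barContract k A (n + 1) m, by simpa [h] using barContract_succ m⟩

instance (n : ℕ) : Module.Projective (Env k A) (Bar k A n) := inferInstance

end BarContraction
end
end HochYD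

namespace HochYD
noncomputable section
variable {k : Type*} [Field k]

/-! ### Maps out of the bar complex, its symmetries and its grading. -/

section BarMaps
variable {A : Type*} [Ring A] [Algebra k A]

/-- The bimodule map from the bar bimodule with given values on `1 ⊗ w ⊗ 1`. -/
def barLift {n : ℕ} {N : Type*} [AddCommGroup N] [Module (Env k A) N] [Module k N]
    [IsScalarTower k (Env k A) N] (g : MultilinearMap k (fun _ : Fin n => A) N) :
    Bar k A n →ₗ[Env k A] N :=
  TensorProduct.AlgebraTensorModule.lift
    (LinearMap.toSpanSingleton (Env k A) _ (PiTensorProduct.lift g))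

theorem barLift_tmul {n : ℕ} {N : Type*} [AddCommGroup N] [Module (Env k A) N] [Module k N]
    [IsScalarTower k (Env k A) N] (g : MultilinearMap k (fun _ : Fin n => A) N) (z : Env k A)
    (w : Fin n → A) : barLift g (z ⊗ₜ PiTensorProduct.tprod k w) = z • g w := by
  simp [barLift]

/-- The action of an automorphism of `A` on the bar bimodule. -/
def barMap (σ : A ≃ₐ[k] A) (n : ℕ) : Bar k A n →ₗ[k] Bar k A n :=
  TensorProduct.map (Env.map σ).toLinearMap (PiTensorProduct.map fun _ => σ.toLinearMap)

theorem barMap_tmul (σ : A ≃ₐ[k] A) {n : ℕ} (z : Env k A) (w : Fin n → A) :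
    barMap σ n (z ⊗ₜ PiTensorProduct.tprod k w) =
      Env.map σ z ⊗ₜ PiTensorProduct.tprod k (fun i => σ (w i)) := by
  simp [barMap]

theorem barMap_smul (σ : A ≃ₐ[k] A) {n : ℕ} (z : Env k A) (m : Bar k A n) :
    barMap σ n (z • m) = Env.map σ z • barMap σ n m := by
  induction m using TensorProduct.induction_on with
  | zero => simp
  | add x y hx hy => rw [smul_add, map_add, hx, hy, map_add, smul_add]
  | tmul x y => simp [barMap, bar_smul_tmul]

theorem Env.map_tmul (σ : A ≃ₐ[k] A) (a : A) (b : Aᵐᵒᵖ) :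
    Env.map σ (a ⊗ₜ b) = σ a ⊗ₜ MulOpposite.op (σ b.unop) := by
  simp [Env.map]

theorem barD_barMap (σ : A ≃ₐ[k] A) {n : ℕ} (m : Bar k A (n + 1)) :
    barD k A n (barMap σ (n + 1) m) = barMap σ n (barD k A n m) := by
  have : (barD k A n).restrictScalars k ∘ₗ barMap σ (n + 1) =
      barMap σ n ∘ₗ (barD k A n).restrictScalars k := bar_ext fun a b w => by
    simp only [LinearMap.comp_apply, LinearMap.restrictScalars_apply, barMap_tmul, barD_tmul,
      map_add, map_sum, map_smul, map_mul, Env.map_tmul, map_one, MulOpposite.unop_op,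
      MulOpposite.unop_one, MulOpposite.op_one]
    congr 2
    refine Finset.sum_congr rfl fun j _ => ?_
    congr 3
    ext i
    simp only [Fin.contractNth]
    split_ifs <;> simp
  exact LinearMap.congr_fun this m

theorem barAug_barMap (σ : A ≃ₐ[k] A) (m : Bar k A 0) :
    barAug k A (barMap σ 0 m) = σ (barAug k A m) := by
  have : barAug k A ∘ₗ barMap σ 0 = σ.toLinearMap ∘ₗ barAug k A := bar_ext fun a b w => by
    simp [barMap_tmul, barAug_tmul, Env.map_tmul]
  exact LinearMap.congr_fun this m

theorem barAug_smul (z : Env k A) (m : Bar k A 0) :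
    barAug k A (z • m) = AlgHom.mulLeftRight k A z (barAug k A m) := by
  have : barAug k A ∘ₗ (Algebra.lsmul k k (Bar k A 0) z) =
      AlgHom.mulLeftRight k A z ∘ₗ barAug k A := bar_ext fun a b w => by
    simp only [LinearMap.comp_apply, Algebra.lsmul_coe, bar_smul_tmul, barAug_tmul, map_mul]
    rfl
  exact LinearMap.congr_fun this m

variable (ε : A →ₐ[k] k)

theorem barEval_cochainT (σ : A ≃ₐ[k] A) (hσ : ∀ a, ε (σ a) = ε a) {n : ℕ} (f : Cochain k A n)
    (m : Bar k A n) :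
    barEval ε n (cochainT σ n f) m = barEval ε n f (barMap σ.symm n m) := by
  have hσ' : ∀ a, ε (σ.symm a) = ε a := fun a => by rw [← hσ (σ.symm a), σ.apply_symm_apply]
  have : barEval ε n (cochainT σ n f) = barEval ε n f ∘ₗ barMap σ.symm n :=
    bar_ext fun a b w => by
      simp only [LinearMap.comp_apply, barMap_tmul, barEval_tmul_tprod, Env.map_tmul, Env.ε_tmul,
        MulOpposite.unop_op, hσ', cochainT]
      rfl
  exact LinearMap.congr_fun this m

/-- The cochain which corresponds to a linear form on the bar bimodule. -/
def toCochain {n : ℕ} (g : Bar k A n →ₗ[k] k) : Cochain k A n :=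
  g.compMultilinearMap (barUniversal k A n)

theorem toCochain_apply {n : ℕ} (g : Bar k A n →ₗ[k] k) (w : Fin n → A) :
    toCochain g w = g (1 ⊗ₜ PiTensorProduct.tprod k w) := rfl

variable {ε}

/-- Together with `barEval_injective` this identifies cochains with bimodule maps from the bar
bimodule to `k`. -/
theorem barEval_toCochain {n : ℕ} {g : Bar k A n →ₗ[k] k}
    (hg : ∀ z m, g (z • m) = Env.ε ε z * g m) : barEval ε n (toCochain g) = g :=
  bar_ext fun a b w => by
    rw [barEval_tmul_tprod, toCochain_apply, ← hg, bar_smul_tmul, mul_one]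

theorem barEval_injective {n : ℕ} {f g : Cochain k A n} (h : barEval ε n f = barEval ε n g) :
    f = g := by
  ext w
  have := LinearMap.congr_fun h (1 ⊗ₜ PiTensorProduct.tprod k w)
  simpa [barEval_tmul_tprod] using this

variable (𝒜 : ℤ → Submodule k A)

/-- The internal grading of the bar bimodule. -/
def barGr (n : ℕ) (s : ℤ) : Submodule k (Bar k A n) :=
  Submodule.span k {m | ∃ (p q : ℤ) (e : Fin n → ℤ), p + ∑ i, e i + q = s ∧ ∃ a ∈ 𝒜 p, ∃ b ∈ 𝒜 q,
    ∃ w : Fin n → A, (∀ i, w i ∈ 𝒜 (e i)) ∧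
      m = (a ⊗ₜ MulOpposite.op b) ⊗ₜ PiTensorProduct.tprod k w}

variable {𝒜}

theorem barContract_mem [SetLike.GradedMonoid 𝒜] {n : ℕ} {s : ℤ} {m : Bar k A n}
    (hm : m ∈ barGr 𝒜 n s) : barContract k A n m ∈ barGr 𝒜 (n + 1) s := by
  induction hm using Submodule.span_induction with
  | zero => simp
  | add x y _ _ hx hy => rw [map_add]; exact add_mem hx hy
  | smul c x _ hx => rw [map_smul]; exact Submodule.smul_mem _ _ hx
  | mem x hx =>
    obtain ⟨p, q, e, hs, a, ha, b, hb, w, hw, rfl⟩ := hx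
    rw [barContract_tmul]
    refine Submodule.subset_span ⟨0, q, Fin.cons p e, ?_, 1, SetLike.one_mem_graded 𝒜, b, hb, _,
      ?_, rfl⟩
    · rw [Fin.sum_univ_succ]
      simpa using hs
    · intro i
      refine Fin.cases ?_ (fun i => ?_) i
      · simpa using ha
      · simpa using hw i

theorem bar_smul_mem [SetLike.GradedMonoid 𝒜] {n : ℕ} {p q s : ℤ} {a b : A} {m : Bar k A n}
    (ha : a ∈ 𝒜 p) (hb : b ∈ 𝒜 q) (hm : m ∈ barGr 𝒜 n s) :
    (a ⊗ₜ MulOpposite.op b : Env k A) • m ∈ barGr 𝒜 n (p + s + q) := by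
  induction hm using Submodule.span_induction with
  | zero => simp
  | add x y _ _ hx hy => rw [smul_add]; exact add_mem hx hy
  | smul c x _ hx => rw [smul_comm]; exact Submodule.smul_mem _ _ hx
  | mem x hx =>
    obtain ⟨p', q', e, hs, a', ha', b', hb', w, hw, rfl⟩ := hx
    rw [bar_smul_tmul, Algebra.TensorProduct.tmul_mul_tmul, ← MulOpposite.op_mul]
    exact Submodule.subset_span ⟨p + p', q' + q, e, by omega, _, SetLike.mul_mem_graded ha ha', _,
      SetLike.mul_mem_graded hb' hb, w, hw, rfl⟩

/-- The counit kills outer factors of nonzero degree, so only terms whose whole degree lies in the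
middle can contribute. -/
theorem barEval_eq_zero (hε : ∀ {i : ℤ} {a : A}, a ∈ 𝒜 i → i ≠ 0 → ε a = 0) {n : ℕ} {g s : ℤ}
    {f : Cochain k A n} (hf : f ∈ cochainGr 𝒜 n g) {m : Bar k A n} (hm : m ∈ barGr 𝒜 n s)
    (h : s + g ≠ 0) : barEval ε n f m = 0 := by
  induction hm using Submodule.span_induction with
  | zero => simp
  | add x y _ _ hx hy => rw [map_add, hx, hy, add_zero]
  | smul c x _ hx => rw [map_smul, hx, smul_zero]
  | mem x hx =>
    obtain ⟨p, q, e, hs, a, ha, b, hb, w, hw, rfl⟩ := hx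
    rw [barEval_tmul_tprod, Env.ε_tmul, MulOpposite.unop_op]
    by_cases hp : p = 0
    · by_cases hq : q = 0
      · rw [hf e w hw (by omega), mul_zero]
      · rw [hε hb hq, mul_zero, zero_mul]
    · rw [hε ha hp, zero_mul, zero_mul]

end BarMaps

/-! ### Comparison maps between a resolution and the bar complex, in both directions. -/

namespace BimoduleComplex
variable {A : Type*} [Ring A] [Algebra k A] (R : BimoduleComplex k A)

theorem P_hom_ext {n : ℕ} {N : Type*} [AddCommGroup N] [Module (Env k A) N]
    {f g : R.P n →ₗ[Env k A] N} (h : ∀ i, f (Pi.single i 1) = g (Pi.single i 1)) : f = g :=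
  LinearMap.pi_ext' fun i => LinearMap.ext_ring (h i)

theorem dMap_single {n : ℕ} (i : Fin (R.rank (n + 1))) (z : Env k A) :
    R.dMap n (Pi.single i z) = z • R.d n i := by
  simp [dMap, Fintype.linearCombination_apply_single]

theorem P_single_eq {n : ℕ} (i : Fin (R.rank n)) (z : Env k A) :
    (Pi.single i z : R.P n) = z • (Pi.single i 1 : R.P n) := by
  ext j
  by_cases h : j = i
  · subst h
    simp
  · simp [h]

theorem P_eq_sum {n : ℕ} (m : R.P n) : m = ∑ i, m i • (Pi.single i 1 : R.P n) := by
  ext i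
  simp [Finset.sum_apply, Pi.single_apply]

theorem augMap_smul (z : Env k A) (m : R.P 0) :
    R.augMap (z • m) = AlgHom.mulLeftRight k A z (R.augMap m) := by
  simp [augMap]

theorem augMap_single (i : Fin (R.rank 0)) (z : Env k A) :
    R.augMap (Pi.single i z) = AlgHom.mulLeftRight k A z (R.aug i) := by
  simp only [augMap, LinearMap.sum_apply, LinearMap.comp_apply, LinearMap.proj_apply]
  rw [Finset.sum_eq_single i]
  · simp
  · intro j _ hj
    simp [hj]
  · simp

/-- The comparison map to the bar resolution which is built from the contraction of the latter. -/
def toBar : ∀ n, R.P n →ₗ[Env k A] Bar k A n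
  | 0 => Fintype.linearCombination (Env k A) fun i =>
      (R.aug i ⊗ₜ 1 : Env k A) ⊗ₜ PiTensorProduct.tprod k (fun i : Fin 0 => i.elim0)
  | n + 1 => Fintype.linearCombination (Env k A) fun i => barContract k A n (toBar n (R.d n i))

theorem toBar_zero_single (i : Fin (R.rank 0)) : R.toBar 0 (Pi.single i 1) =
    (R.aug i ⊗ₜ 1 : Env k A) ⊗ₜ PiTensorProduct.tprod k (fun i : Fin 0 => i.elim0) := by
  simp [toBar, Fintype.linearCombination_apply_single]

theorem toBar_succ_single {n : ℕ} (i : Fin (R.rank (n + 1))) : R.toBar (n + 1) (Pi.single i 1) =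
    barContract k A n (R.toBar n (R.d n i)) := by
  simp [toBar, Fintype.linearCombination_apply_single]

variable {R}
variable {σ : A ≃ₐ[k] A} {𝒜 : ℤ → Submodule k A} {τ : ∀ n, R.P n ≃ₗ[k] R.P n}

theorem IsResolutionYD.d_d (hR : R.IsResolutionYD σ 𝒜 τ) (n : ℕ) (m : R.P (n + 2)) :
    R.dMap n (R.dMap (n + 1) m) = 0 := (hR.exact_succ n _).2 ⟨m, rfl⟩

theorem IsResolutionYD.aug_d (hR : R.IsResolutionYD σ 𝒜 τ) (m : R.P 1) :
    R.augMap (R.dMap 0 m) = 0 := (hR.exact_zero _).2 ⟨m, rfl⟩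

/-- On cycles the contraction is a section of the differential, and `toBar` of a boundary is a cycle
by the previous degree. Agreement on generators suffices. -/
theorem toBar_isComparison (hR : R.IsResolutionYD σ 𝒜 τ) : R.IsComparison R.toBar := by
  have haug : ∀ m, barAug k A (R.toBar 0 m) = R.augMap m := fun m => by
    rw [R.P_eq_sum m]
    simp only [map_sum, map_smul, barAug_smul, augMap_smul, toBar_zero_single, augMap_single,
      barAug_tmul]
    simp
  refine ⟨fun n => ?_, haug⟩
  induction n with
  | zero =>
    intro m
    have : barD k A 0 ∘ₗ R.toBar 1 = R.toBar 0 ∘ₗ R.dMap 0 := R.P_hom_ext fun i => by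
      rw [LinearMap.comp_apply, LinearMap.comp_apply, toBar_succ_single, dMap_single, one_smul]
      have h := barContract_zero (R.toBar 0 (R.d 0 i))
      have h' := hR.aug_d (Pi.single i 1)
      rw [dMap_single, one_smul] at h'
      simpa [haug, h'] using h
    exact LinearMap.congr_fun this m
  | succ n ih =>
    intro m
    have : barD k A (n + 1) ∘ₗ R.toBar (n + 2) = R.toBar (n + 1) ∘ₗ R.dMap (n + 1) :=
      R.P_hom_ext fun i => by
        rw [LinearMap.comp_apply, LinearMap.comp_apply, toBar_succ_single, dMap_single, one_smul]
        have h := barContract_succ (R.toBar (n + 1) (R.d (n + 1) i))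
        have h' := hR.d_d n (Pi.single i 1)
        rw [dMap_single, one_smul] at h'
        simpa [ih, h'] using h
    exact LinearMap.congr_fun this m

theorem single_mem_gr [SetLike.GradedMonoid 𝒜] (n : ℕ) (i : Fin (R.rank n)) :
    (Pi.single i 1 : R.P n) ∈ R.gr 𝒜 n (R.deg n i) :=
  Submodule.subset_span ⟨i, 0, 0, by omega, 1, SetLike.one_mem_graded 𝒜, 1,
    SetLike.one_mem_graded 𝒜, rfl⟩

/-- Differential and contraction preserve the internal degree, and so does each step of the
recursion that defines `toBar`. -/
theorem toBar_mem [SetLike.GradedMonoid 𝒜] (hR : R.IsResolutionYD σ 𝒜 τ) {n : ℕ} {s : ℤ}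
    {m : R.P n} (hm : m ∈ R.gr 𝒜 n s) : R.toBar n m ∈ barGr 𝒜 n s := by
  have gen : ∀ n, (∀ i, R.toBar n (Pi.single i 1) ∈ barGr 𝒜 n (R.deg n i)) →
      ∀ {s : ℤ} {m : R.P n}, m ∈ R.gr 𝒜 n s → R.toBar n m ∈ barGr 𝒜 n s := by
    intro n h s m hm
    induction hm using Submodule.span_induction with
    | zero => simp
    | add x y _ _ hx hy => rw [map_add]; exact add_mem hx hy
    | smul c x _ hx => rw [LinearMap.map_smul_of_tower]; exact Submodule.smul_mem _ _ hx
    | mem x hx =>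
      obtain ⟨i, p, q, rfl, a, ha, b, hb, rfl⟩ := hx
      rw [P_single_eq, map_smul]
      exact bar_smul_mem ha hb (h i)
  induction n generalizing s with
  | zero =>
    refine gen 0 (fun i => ?_) hm
    rw [toBar_zero_single]
    refine Submodule.subset_span ⟨R.deg 0 i, 0, fun i => i.elim0, by simp, R.aug i, ?_, 1,
      SetLike.one_mem_graded 𝒜, _, fun i => i.elim0, rfl⟩
    simpa [augMap_single] using hR.aug_gr (single_mem_gr 0 i)
  | succ n ih =>
    refine gen (n + 1) (fun i => ?_) hm
    rw [toBar_succ_single]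
    refine barContract_mem (ih ?_)
    simpa [dMap_single] using hR.d_gr n (single_mem_gr (n + 1) i)

/-- The comparison map from the bar resolution built from sections of the differentials. -/
def fromBar (s : ∀ n, R.P n →ₗ[k] R.P (n + 1)) (m₀ : R.P 0) : ∀ n, Bar k A n →ₗ[Env k A] R.P n
  | 0 => barLift (MultilinearMap.constOfIsEmpty k _ m₀)
  | n + 1 => barLift ((s n ∘ₗ (fromBar s m₀ n).restrictScalars k ∘ₗ
      (barD k A n).restrictScalars k).compMultilinearMap (barUniversal k A (n + 1)))

theorem fromBar_succ_tmul (s : ∀ n, R.P n →ₗ[k] R.P (n + 1)) (m₀ : R.P 0) {n : ℕ}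
    (w : Fin (n + 1) → A) : fromBar s m₀ (n + 1) (1 ⊗ₜ PiTensorProduct.tprod k w) =
      s n (fromBar s m₀ n (barD k A n (1 ⊗ₜ PiTensorProduct.tprod k w))) := by
  rw [fromBar, barLift_tmul, one_smul]
  rfl

theorem augMap_fromBar (s : ∀ n, R.P n →ₗ[k] R.P (n + 1)) {m₀ : R.P 0} (h₀ : R.augMap m₀ = 1)
    (x : Bar k A 0) : R.augMap (fromBar s m₀ 0 x) = barAug k A x := by
  have : R.augMap ∘ₗ (fromBar s m₀ 0).restrictScalars k = barAug k A := bar_ext fun a b w => by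
    simp [fromBar, barLift_tmul, augMap_smul, h₀, barAug_tmul]
  exact LinearMap.congr_fun this x

/-- The image of a bar boundary under the previous stage is a cycle, hence a boundary by exactness,
and on boundaries `s` is a section of the differential. -/
theorem dMap_fromBar (hR : R.IsResolutionYD σ 𝒜 τ) {s : ∀ n, R.P n →ₗ[k] R.P (n + 1)} {m₀ : R.P 0}
    (h₀ : R.augMap m₀ = 1) (hs : ∀ n m, R.dMap n (s n (R.dMap n m)) = R.dMap n m) (n : ℕ)
    (x : Bar k A (n + 1)) :
    R.dMap n (fromBar s m₀ (n + 1) x) = fromBar s m₀ n (barD k A n x) := by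
  have gen : ∀ n, (∀ y, ∃ m, R.dMap n m = fromBar s m₀ n (barD k A n y)) → ∀ x,
      R.dMap n (fromBar s m₀ (n + 1) x) = fromBar s m₀ n (barD k A n x) := by
    intro n h x
    have : R.dMap n ∘ₗ fromBar s m₀ (n + 1) = fromBar s m₀ n ∘ₗ barD k A n :=
      bar_hom_ext fun w => by
        obtain ⟨m, hm⟩ := h (1 ⊗ₜ PiTensorProduct.tprod k w)
        rw [LinearMap.comp_apply, fromBar_succ_tmul, ← hm, hs, hm, LinearMap.comp_apply]
    exact LinearMap.congr_fun this x
  induction n with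
  | zero =>
    refine gen 0 (fun y => (hR.exact_zero _).1 ?_) x
    rw [augMap_fromBar s h₀, barD_barD_zero]
  | succ n ih =>
    refine gen (n + 1) (fun y => (hR.exact_succ n _).1 ?_) x
    rw [ih, barD_barD, map_zero]

/-- Every face of `1 ⊗ w ⊗ 1` has the total degree of `w`, since merging two entries adds their
degrees (`sum_contractNth`), and the sections respect degrees. -/
theorem fromBar_mem [SetLike.GradedMonoid 𝒜] (hR : R.IsResolutionYD σ 𝒜 τ)
    {s : ∀ n, R.P n →ₗ[k] R.P (n + 1)} {m₀ : R.P 0} (h₀ : m₀ ∈ R.gr 𝒜 0 0)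
    (hs : ∀ n g, ∀ m ∈ R.gr 𝒜 n g, s n m ∈ R.gr 𝒜 (n + 1) g) {n : ℕ} {e : Fin n → ℤ}
    {w : Fin n → A} (hw : ∀ i, w i ∈ 𝒜 (e i)) :
    fromBar s m₀ n (1 ⊗ₜ PiTensorProduct.tprod k w) ∈ R.gr 𝒜 n (∑ i, e i) := by
  induction n with
  | zero => simpa [fromBar, barLift_tmul] using h₀
  | succ n ih =>
    rw [fromBar_succ_tmul]
    refine hs _ _ _ ?_
    have hz : ∀ (z : Env k A) (v : Fin n → A), (z ⊗ₜ PiTensorProduct.tprod k v : Bar k A n) =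
        z • (1 ⊗ₜ PiTensorProduct.tprod k v) := fun z v => by rw [bar_smul_tmul, mul_one]
    have one := SetLike.one_mem_graded 𝒜
    simp only [barD_tmul, one_mul, map_add, map_sum, LinearMap.map_smul_of_tower]
    refine add_mem (add_mem ?_ ?_) ?_
    · rw [hz, map_smul, Fin.sum_univ_succ]
      simpa using hR.gr_smul n (hw 0) one (ih fun i => hw i.succ)
    · refine Submodule.sum_mem _ fun j _ => Submodule.smul_mem _ _ ?_
      rw [← sum_contractNth j e]
      refine ih fun i => ?_
      simp only [Fin.contractNth]
      split_ifs
      · exact hw _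
      · exact SetLike.mul_mem_graded (hw _) (hw _)
      · exact hw _
    · refine Submodule.smul_mem _ _ ?_
      rw [hz, map_smul, Fin.sum_univ_castSucc]
      simpa using hR.gr_smul n one (hw (Fin.last n)) (ih fun i => hw i.castSucc)

end BimoduleComplex
end
end HochYD

namespace HochYD
noncomputable section
variable {k : Type*} [Field k]

/-! ### Minimal resolutions compute `H^•(A, k)` with its Yetter–Drinfeld structure. -/

namespace BimoduleComplex
variable {A : Type*} [Ring A] [Algebra k A] {R : BimoduleComplex k A} {ε : A →ₐ[k] k}

theorem Hom.smul {n : ℕ} (f : R.Hom ε n) (z : Env k A) (m : R.P n) :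
    f.1 (z • m) = Env.ε ε z * f.1 m := f.2 z m

theorem Hom.apply_eq_sum {n : ℕ} (f : R.Hom ε n) (m : R.P n) :
    f.1 m = ∑ i, Env.ε ε (m i) * f.1 (Pi.single i 1) := by
  conv_lhs => rw [R.P_eq_sum m]
  simp [Hom.smul]

theorem Hom.ext {n : ℕ} {f g : R.Hom ε n}
    (h : ∀ i, f.1 (Pi.single i 1) = g.1 (Pi.single i 1)) : f = g :=
  Subtype.ext (LinearMap.ext fun m => by rw [f.apply_eq_sum, g.apply_eq_sum]; simp [h])

/-- A bimodule map to `k` sees only the coordinates modulo the kernel of the counit, and those of a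
boundary are zero. Since `f` need not be an element of `Hom`, this also applies to composites with
homotopies. -/
theorem IsMinimal.hom_dMap (hmin : R.IsMinimal ε) {n : ℕ} {f : R.P n →ₗ[k] k}
    (hf : ∀ (z : Env k A) m, f (z • m) = Env.ε ε z * f m) (m : R.P (n + 1)) :
    f (R.dMap n m) = 0 := by
  have := Hom.apply_eq_sum (⟨f, hf⟩ : R.Hom ε n) (R.dMap n m)
  simpa [hmin n m] using this

theorem IsMinimal.homD_eq_zero (hmin : R.IsMinimal ε) (n : ℕ) : R.homD ε n = 0 :=
  LinearMap.ext fun f => Subtype.ext (LinearMap.ext fun m => hmin.hom_dMap f.2 m)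

theorem IsMinimal.coboundaries_eq_bot (hmin : R.IsMinimal ε) (n : ℕ) :
    coboundaries (X := fun n => R.Hom ε n) (R.homD ε) n = ⊥ := by
  cases n with
  | zero => rfl
  | succ n => simp [coboundaries, hmin.homD_eq_zero n]

/-- The cohomology of `Hom_{AA}(P•, k)` for a minimal resolution `P•`. -/
def cohomologyVal (hmin : R.IsMinimal ε) (n : ℕ) :
    Cohomology (X := fun n => R.Hom ε n) (R.homD ε) n →ₗ[k] R.Hom ε n :=
  Submodule.liftQ _ (Submodule.subtype _) (by
    rintro ⟨x, hx⟩ h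
    simpa [Submodule.submoduleOf, hmin.coboundaries_eq_bot] using h)

theorem cohomologyVal_injective (hmin : R.IsMinimal ε) (n : ℕ) :
    Function.Injective (cohomologyVal hmin n) := by
  rw [injective_iff_map_eq_zero]
  intro x hx
  obtain ⟨f, rfl⟩ := Submodule.mkQ_surjective _ x
  rw [show f = 0 from Subtype.ext hx, map_zero]

variable {σ : A ≃ₐ[k] A} {𝒜 : ℤ → Submodule k A} {τ : ∀ n, R.P n ≃ₗ[k] R.P n}

open Classical in
variable (R) in
/-- The projection of `Pₙ` onto the part which is generated in degree `-g`. -/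
def genProj (n : ℕ) (g : ℤ) : R.P n →ₗ[Env k A] R.P n :=
  LinearMap.pi fun i => if R.deg n i + g = 0 then LinearMap.proj i else 0

theorem genProj_single (n : ℕ) (g : ℤ) (i : Fin (R.rank n)) (z : Env k A) :
    R.genProj n g (Pi.single i z) = if R.deg n i + g = 0 then Pi.single i z else 0 := by
  ext j
  by_cases h : j = i
  · subst h
    by_cases h' : R.deg n j + g = 0 <;> simp [genProj, h']
  · by_cases h' : R.deg n j + g = 0 <;> by_cases h'' : R.deg n i + g = 0 <;>
      simp [genProj, h, h', h'']

variable (R ε) in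
/-- The homogeneous components of bimodule maps to `k`. -/
def homProj (n : ℕ) (g : ℤ) : R.Hom ε n →ₗ[k] R.Hom ε n :=
  LinearMap.restrict (LinearMap.lcomp k k ((R.genProj n g).restrictScalars k)) fun f hf z m => by
    simp [hf z (R.genProj n g m)]

theorem homProj_single (n : ℕ) (g : ℤ) (f : R.Hom ε n) (i : Fin (R.rank n)) :
    (R.homProj ε n g f).1 (Pi.single i 1) =
      if R.deg n i + g = 0 then f.1 (Pi.single i 1) else 0 := by
  change f.1 (R.genProj n g (Pi.single i 1)) = _
  rw [genProj_single]
  split_ifs <;> simp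

theorem mem_homGr_single [SetLike.GradedMonoid 𝒜] {n : ℕ} {g : ℤ} {f : R.Hom ε n}
    (hf : f ∈ R.homGr ε 𝒜 n g) {i : Fin (R.rank n)} (h : R.deg n i + g ≠ 0) :
    f.1 (Pi.single i 1) = 0 := hf _ _ (single_mem_gr n i) h

/-- On `a ⊗ vᵢ ⊗ b` the value is `ε(a) f(vᵢ) ε(b)`, which is zero unless `a` and `b` have a
component of degree 0. Thus only the degrees of the generators count. -/
theorem mem_homGr_iff [SetLike.GradedMonoid 𝒜]
    (hε : ∀ {i : ℤ} {a : A}, a ∈ 𝒜 i → i ≠ 0 → ε a = 0) {n : ℕ} {g : ℤ} {f : R.Hom ε n} :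
    f ∈ R.homGr ε 𝒜 n g ↔ ∀ i, R.deg n i + g ≠ 0 → f.1 (Pi.single i 1) = 0 := by
  refine ⟨fun hf i => mem_homGr_single hf, fun hf s m hm hs => ?_⟩
  change f.1 m = 0
  induction hm using Submodule.span_induction with
  | zero => simp
  | add x y _ _ hx hy => rw [map_add, hx, hy, add_zero]
  | smul c x _ hx => rw [map_smul, hx, smul_zero]
  | mem x hx =>
    obtain ⟨i, p, q, rfl, a, ha, b, hb, rfl⟩ := hx
    rw [P_single_eq, Hom.smul, Env.ε_tmul, MulOpposite.unop_op]
    by_cases hp : p = 0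
    · by_cases hq : q = 0
      · rw [hf i (by omega), mul_zero]
      · rw [hε hb hq, mul_zero, zero_mul]
    · rw [hε ha hp, zero_mul, zero_mul]

theorem homProj_of_mem [SetLike.GradedMonoid 𝒜] {n : ℕ} {g : ℤ} {f : R.Hom ε n}
    (hf : f ∈ R.homGr ε 𝒜 n g) : R.homProj ε n g f = f :=
  Hom.ext fun i => by
    rw [homProj_single]
    split_ifs with h
    · rfl
    · exact (mem_homGr_single hf h).symm

theorem homProj_of_mem_of_ne [SetLike.GradedMonoid 𝒜] {n : ℕ} {g h : ℤ} (hgh : g ≠ h)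
    {f : R.Hom ε n} (hf : f ∈ R.homGr ε 𝒜 n h) : R.homProj ε n g f = 0 :=
  Hom.ext fun i => by
    rw [homProj_single]
    split_ifs with h
    · exact mem_homGr_single hf (by omega)
    · rfl

theorem homProj_mem [SetLike.GradedMonoid 𝒜]
    (hε : ∀ {i : ℤ} {a : A}, a ∈ 𝒜 i → i ≠ 0 → ε a = 0) (n : ℕ) (g : ℤ) (f : R.Hom ε n) :
    R.homProj ε n g f ∈ R.homGr ε 𝒜 n g :=
  (mem_homGr_iff hε).2 fun i h => by rw [homProj_single, if_neg h]

/-- The sum runs over the set of occurring degrees, so that generators of equal degree are not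
counted repeatedly. Finiteness of the rank is what makes the decomposition a finite sum. -/
theorem sum_homProj (n : ℕ) (f : R.Hom ε n) :
    ∑ g ∈ Finset.univ.image (fun i => -R.deg n i), R.homProj ε n g f = f :=
  Hom.ext fun i => by
    have : (∑ g ∈ Finset.univ.image (fun i => -R.deg n i), R.homProj ε n g f).1 =
        ∑ g ∈ Finset.univ.image (fun i => -R.deg n i), (R.homProj ε n g f).1 :=
      map_sum (R.homSubmodule ε n).subtype _ _
    rw [this, LinearMap.sum_apply, Finset.sum_eq_single (-R.deg n i)]
    · simp [homProj_single]
    · intro g _ hg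
      rw [homProj_single, if_neg (by omega)]
    · intro h
      exact absurd (Finset.mem_image_of_mem _ (Finset.mem_univ i)) h

theorem hom_yd [SetLike.GradedMonoid 𝒜]
    (hε : ∀ {i : ℤ} {a : A}, a ∈ 𝒜 i → i ≠ 0 → ε a = 0) (hσ : ∀ a, ε (σ a) = ε a)
    (hR : R.IsResolutionYD σ 𝒜 τ) (n : ℕ) :
    IsYetterDrinfeld (V := R.Hom ε n) (homT hR hσ n) (R.homGr ε 𝒜 n) where
  internal := by
    refine isInternal_of_proj _ (R.homProj ε n) (fun g v hv => homProj_of_mem hv)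
      (fun g h hgh v hv => homProj_of_mem_of_ne hgh hv) (Submodule.eq_top_iff'.2 fun f => ?_)
    rw [← sum_homProj n f]
    exact Submodule.sum_mem _ fun g _ =>
      Submodule.mem_iSup_of_mem g (homProj_mem hε n g f)
  map_gr g := by
    have h1 : ∀ s m, m ∈ R.gr 𝒜 n s → (τ n).symm m ∈ R.gr 𝒜 n s := fun s m hm => by
      rw [← (hR.yd n).map_gr s] at hm
      obtain ⟨m', hm', rfl⟩ := hm
      simpa using hm'
    have h2 : ∀ s m, m ∈ R.gr 𝒜 n s → τ n m ∈ R.gr 𝒜 n s := fun s m hm => by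
      rw [← (hR.yd n).map_gr s]
      exact ⟨m, hm, rfl⟩
    apply le_antisymm
    · rintro _ ⟨f, hf, rfl⟩ s m hm h
      exact hf s _ (h1 s m hm) h
    · intro f hf
      refine ⟨(homT hR hσ n).symm f, fun s m hm h => hf s _ (h2 s m hm) h, ?_⟩
      exact (homT hR hσ n).apply_symm_apply f

theorem grading_internal (hmin : R.IsMinimal ε) [SetLike.GradedMonoid 𝒜]
    (hε : ∀ {i : ℤ} {a : A}, a ∈ 𝒜 i → i ≠ 0 → ε a = 0) (n : ℕ) :
    DirectSum.IsInternal
      (Cohomology.grading (X := fun n => R.Hom ε n) (R.homD ε) (R.homGr ε 𝒜) n) := by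
  have hcomm : ∀ g n, R.homD ε n ∘ₗ R.homProj ε n g = R.homProj ε (n + 1) g ∘ₗ R.homD ε n :=
    fun g n => by simp [hmin.homD_eq_zero]
  refine isInternal_of_proj _ (fun g => Cohomology.map (X := fun n => R.Hom ε n)
    (Y := fun n => R.Hom ε n) (R.homD ε) (R.homD ε) (fun n => R.homProj ε n g) (hcomm g) n) ?_ ?_ ?_
  · rintro g _ ⟨f, hf, rfl⟩
    exact cohomologyVal_injective hmin n (homProj_of_mem (f := f.1) hf)
  · rintro g h hgh _ ⟨f, hf, rfl⟩
    exact cohomologyVal_injective hmin n (homProj_of_mem_of_ne (f := f.1) hgh hf)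
  · rw [Submodule.eq_top_iff']
    intro x
    obtain ⟨f, rfl⟩ := Submodule.mkQ_surjective _ x
    have hz : ∀ f : R.Hom ε n, f ∈ LinearMap.ker (R.homD ε n) := fun f => by
      rw [hmin.homD_eq_zero]; rfl
    have : f = ∑ g ∈ Finset.univ.image (fun i => -R.deg n i),
        (⟨R.homProj ε n g f.1, hz _⟩ : LinearMap.ker (R.homD ε n)) := by
      apply Subtype.ext
      rw [AddSubmonoidClass.coe_finsetSum]
      exact (sum_homProj n f.1).symm
    rw [this, map_sum]
    exact Submodule.sum_mem _ fun g _ => Submodule.mem_iSup_of_mem g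
      ⟨_, homProj_mem hε n g f.1, rfl⟩

instance (n : ℕ) : Module.Projective (Env k A) (R.P n) := inferInstance

/-- Homotopy of `φ ψ` to the identity gives injectivity, homotopy of `ψ φ` to the identity gives
surjectivity. The preimage `g ∘ ψ` is recorded because its homogeneity is needed for the comparison
of gradings. -/
theorem bijective_comparison (hmin : R.IsMinimal ε) (hR : R.IsResolutionYD σ 𝒜 τ)
    {φ : ∀ n, R.P n →ₗ[Env k A] Bar k A n} (hφ : R.IsComparison φ)
    {ψ : ∀ n, Bar k A n →ₗ[Env k A] R.P n}
    (hψ : ∀ n x, R.dMap n (ψ (n + 1) x) = ψ n (barD k A n x))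
    (hψ₀ : ∀ x, R.augMap (ψ 0 x) = barAug k A x) (n : ℕ) :
    Function.Bijective (comparison (ε := ε) hφ n) ∧
      ∀ g : R.Hom ε n, ∃ h, comparison (ε := ε) hφ n (Cohomology.mk (cochainD ε) n
          ⟨toCochain (g.1 ∘ₗ (ψ n).restrictScalars k), h⟩) =
        Cohomology.mk (X := fun n => R.Hom ε n) (R.homD ε) n
          ⟨g, by rw [hmin.homD_eq_zero]; rfl⟩ := by
  obtain ⟨h, h0, h1⟩ := exists_homotopy (C := fun n => Bar k A n) (D := fun n => Bar k A n)
    (barD k A) (barD k A)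
    (barAug k A).toAddMonoidHom (fun n x => barD_barD x) bar_exact_zero bar_exact_succ
    (fun n => LinearMap.id) (fun n => φ n ∘ₗ ψ n) (fun _ _ => rfl)
    (fun n x => by simp [hφ.comm, hψ]) (fun x => by simp [hφ.aug, hψ₀])
  obtain ⟨h', h0', h1'⟩ := exists_homotopy (C := fun n => R.P n) (D := fun n => R.P n)
    R.dMap R.dMap
    R.augMap.toAddMonoidHom hR.d_d (fun x hx => (hR.exact_zero x).1 hx)
    (fun n x hx => (hR.exact_succ n x).1 hx)
    (fun n => LinearMap.id) (fun n => ψ n ∘ₗ φ n) (fun _ _ => rfl)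
    (fun n x => by simp [hφ.comm, hψ]) (fun x => by simp [hφ.aug, hψ₀])
  have key : ∀ g : R.Hom ε n, ∃ h, comparison (ε := ε) hφ n (Cohomology.mk (cochainD ε) n
          ⟨toCochain (g.1 ∘ₗ (ψ n).restrictScalars k), h⟩) =
        Cohomology.mk (X := fun n => R.Hom ε n) (R.homD ε) n
          ⟨g, by rw [hmin.homD_eq_zero]; rfl⟩ := by
    intro g
    have hg : ∀ (z : Env k A) m, (g.1 ∘ₗ (ψ n).restrictScalars k) (z • m) =
        Env.ε ε z * (g.1 ∘ₗ (ψ n).restrictScalars k) m := fun z m => by simp [Hom.smul]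
    have hc : toCochain (g.1 ∘ₗ (ψ n).restrictScalars k) ∈ LinearMap.ker (cochainD ε n) := by
      rw [LinearMap.mem_ker]
      apply barEval_injective (ε := ε)
      refine LinearMap.ext fun x => ?_
      rw [← barEval_barD, barEval_toCochain hg, map_zero]
      simp only [LinearMap.comp_apply, LinearMap.restrictScalars_apply, ← hψ]
      exact hmin.hom_dMap g.2 _
    refine ⟨hc, cohomologyVal_injective hmin n (Subtype.ext (LinearMap.ext fun m => ?_))⟩
    change barEval ε n (toCochain (g.1 ∘ₗ (ψ n).restrictScalars k)) (φ n m) = g.1 m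
    rw [barEval_toCochain hg]
    change g.1 (ψ n (φ n m)) = g.1 m
    symm
    rw [← sub_eq_zero, ← map_sub]
    cases n with
    | zero =>
      have := h0' m
      simp only [LinearMap.id_apply, LinearMap.comp_apply] at this
      rw [this]
      exact hmin.hom_dMap g.2 _
    | succ n =>
      have := h1' n m
      simp only [LinearMap.id_apply, LinearMap.comp_apply] at this
      rw [this, map_add, hmin.hom_dMap g.2, zero_add]
      -- The term `h' d` of the homotopy also vanishes: `g ∘ h'` is itself a bimodule map to `k`,
      -- evaluated on a boundary.
      exact hmin.hom_dMap (f := g.1 ∘ₗ (h' n).restrictScalars k)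
        (fun z m => by simp [Hom.smul]) m
  refine ⟨⟨?_, fun x => ?_⟩, key⟩
  · rw [injective_iff_map_eq_zero]
    intro x hx
    obtain ⟨⟨f, hf⟩, rfl⟩ := Submodule.mkQ_surjective _ x
    -- By minimality there are no nonzero coboundaries on the side of `P`, so a vanishing class is a
    -- vanishing map.
    have hx' : ∀ m, barEval ε n f (φ n m) = 0 := fun m =>
      LinearMap.congr_fun (congrArg Subtype.val (congrArg (cohomologyVal hmin n) hx)) m
    refine (Submodule.Quotient.mk_eq_zero _).2 ?_
    change f ∈ coboundaries (cochainD ε) n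
    have hb : ∀ y, barEval ε n f (barD k A n y) = 0 := fun y => by
      rw [barEval_barD, LinearMap.mem_ker.1 hf, map_zero]; rfl
    cases n with
    | zero =>
      have : f = 0 := barEval_injective (ε := ε) (LinearMap.ext fun x => by
        have := congrArg (barEval ε 0 f) (h0 x)
        simpa [hx', hb] using this)
      rw [this]
      exact zero_mem _
    | succ n =>
      -- From `1 - φ ψ = d h + h d`, where `f` kills both `φ ψ` and `d h`, there remains `f = (f ∘
      -- h) ∘ d`.
      refine ⟨toCochain (barEval ε (n + 1) f ∘ₗ (h n).restrictScalars k),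
        barEval_injective (ε := ε) (LinearMap.ext fun x => ?_)⟩
      have := congrArg (barEval ε (n + 1) f) (h1 n x)
      rw [← barEval_barD, barEval_toCochain (fun z m => by simp [barEval_smul])]
      simpa [hx', hb] using this.symm
  · obtain ⟨g, rfl⟩ := Submodule.mkQ_surjective _ x
    obtain ⟨_, h⟩ := key g.1
    exact ⟨_, h⟩

/-- In `σ⁻¹ φ t` the two semilinear twists cancel, so it is again a comparison map and is homotopic
to `φ`. A cocycle kills the part `d h` of the difference, minimality the part `h d`. -/
theorem pullback_cochainT (hmin : R.IsMinimal ε) (hσ : ∀ a, ε (σ a) = ε a)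
    (hR : R.IsResolutionYD σ 𝒜 τ)
    {φ : ∀ n, R.P n →ₗ[Env k A] Bar k A n} (hφ : R.IsComparison φ) {n : ℕ} {f : Cochain k A n}
    (hf : cochainD ε n f = 0) (m : R.P n) :
    barEval ε n (cochainT σ n f) (φ n (τ n m)) = barEval ε n f (φ n m) := by
  have hmap : ∀ z, Env.map σ.symm (Env.map σ z) = z := fun z => Env.map_symm σ.symm z
  let φ' : ∀ n, R.P n →ₗ[Env k A] Bar k A n := fun n =>
    { toFun := fun m => barMap σ.symm n (φ n (τ n m))
      map_add' := fun x y => by simp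
      map_smul' := fun z x => by simp [hR.t_smul, barMap_smul, hmap] }
  obtain ⟨h, h0, h1⟩ := exists_homotopy (C := fun n => R.P n) (D := fun n => Bar k A n)
    R.dMap (barD k A) (barAug k A).toAddMonoidHom hR.d_d bar_exact_zero bar_exact_succ
    φ' φ (fun n x => by simp [φ', barD_barMap, hφ.comm, hR.d_t]) hφ.comm
    (fun x => by simp [φ', barAug_barMap, hφ.aug, hR.aug_t])
  have hb : ∀ y, barEval ε n f (barD k A n y) = 0 := fun y => by
    rw [barEval_barD, hf, map_zero]; rfl
  rw [barEval_cochainT ε σ hσ, ← sub_eq_zero, ← map_sub]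
  cases n with
  | zero =>
    have := h0 m
    change barMap σ.symm 0 (φ 0 (τ 0 m)) - _ = _ at this
    rw [this, hb]
  | succ n =>
    have := h1 n m
    change barMap σ.symm _ (φ _ (τ _ m)) - _ = _ at this
    rw [this, map_add, hb, zero_add]
    exact hmin.hom_dMap (f := barEval ε (n + 1) f ∘ₗ (h n).restrictScalars k)
      (fun z m => by simp [barEval_smul]) m

/-- For the gradings, one inclusion uses that `toBar` preserves degrees. The other uses the explicit
preimage through `fromBar`, homogeneous because its sections are chosen graded and `m₀` has degree
0. -/
theorem computesHH (hmin : R.IsMinimal ε) [SetLike.GradedMonoid 𝒜]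
    (hε : ∀ {i : ℤ} {a : A}, a ∈ 𝒜 i → i ≠ 0 → ε a = 0) (hσ : ∀ a, ε (σ a) = ε a)
    (hR : R.IsResolutionYD σ 𝒜 τ) {m₀ : R.P 0} (hm₀ : m₀ ∈ R.gr 𝒜 0 0) (h₀ : R.augMap m₀ = 1) :
    ComputesHH hσ hR (toBar_isComparison hR) := by
  choose s hs hs' using fun n => exists_graded_section (hR.yd n).internal (hR.yd (n + 1)).internal
    ((R.dMap n).restrictScalars k) (fun g w hw => hR.d_gr n hw)
  have hψ := dMap_fromBar hR h₀ hs'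
  have hψ₀ := augMap_fromBar s h₀
  have hbij := bijective_comparison (ε := ε) hmin hR (toBar_isComparison hR) hψ hψ₀
  refine ⟨hom_yd hε hσ hR, fun n => (hbij n).1, fun n x => ?_, fun n g => le_antisymm ?_ ?_⟩
  · obtain ⟨⟨f, hf⟩, rfl⟩ := Submodule.mkQ_surjective _ x
    refine cohomologyVal_injective hmin n (Subtype.ext (LinearMap.ext fun m => ?_))
    obtain ⟨m, rfl⟩ := (τ n).surjective m
    refine (pullback_cochainT hmin hσ hR (toBar_isComparison hR) hf m).trans ?_
    change _ = barEval ε n f (R.toBar n ((τ n).symm (τ n m)))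
    rw [LinearEquiv.symm_apply_apply]
  · rintro _ ⟨_, ⟨⟨f, hf⟩, hfg, rfl⟩, rfl⟩
    exact ⟨⟨pullback ε R R.toBar n f, by rw [hmin.homD_eq_zero]; rfl⟩,
      fun s m hm h => barEval_eq_zero hε (show f ∈ cochainGr 𝒜 n g from hfg) (toBar_mem hR hm) h,
      rfl⟩
  · rintro _ ⟨⟨f, hf⟩, hfg, rfl⟩
    obtain ⟨h, h'⟩ := (hbij n).2 f
    exact ⟨_, ⟨_, fun e w hw he => hfg _ _ (fromBar_mem hR hm₀ hs hw) he, rfl⟩, h'⟩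

end BimoduleComplex
end
end HochYD

namespace HochYD
noncomputable section
variable {k : Type*} [Field k]

theorem isInternal_of_map {V W : Type*} [AddCommGroup V] [Module k V] [AddCommGroup W] [Module k W]
    (e : V ≃ₗ[k] W) {gr : ℤ → Submodule k V} {gr' : ℤ → Submodule k W}
    (h : ∀ g, (gr g).map (e : V →ₗ[k] W) = gr' g) (h' : DirectSum.IsInternal gr') :
    DirectSum.IsInternal gr := by
  classical
  rw [DirectSum.isInternal_submodule_iff_iSupIndep_and_iSup_eq_top] at h' ⊢
  have hg : gr' = (Submodule.orderIsoMapComap e) ∘ gr := funext fun g => (h g).symm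
  rw [hg] at h'
  refine ⟨(iSupIndep_map_orderIso_iff _).1 h'.1, ?_⟩
  apply (Submodule.orderIsoMapComap e).injective
  rw [OrderIso.map_iSup, OrderIso.map_top]
  exact h'.2

/-! ### The algebra structure of `H^•(A, k)`. -/

section HHAlgebra
variable {A : Type*} [Ring A] [Algebra k A] {ε : A →ₐ[k] k} {σ : A ≃ₐ[k] A}
  {𝒜 : ℤ → Submodule k A}

theorem HH_induction {n : ℕ} {p : HH ε n → Prop}
    (h : ∀ f, p (Cohomology.mk (cochainD ε) n f)) (x : HH ε n) : p x := by
  obtain ⟨f, rfl⟩ := Submodule.mkQ_surjective _ x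
  exact h f

theorem mk_eq_mk {n : ℕ} {f g : LinearMap.ker (cochainD ε n)} (h : f.1 = g.1) :
    Cohomology.mk (cochainD ε) n f = Cohomology.mk (cochainD ε) n g := by
  rw [Subtype.ext h]

theorem smile_mk {p q n : ℕ} (h : p + q = n) (f : LinearMap.ker (cochainD ε p))
    (g : LinearMap.ker (cochainD ε q)) :
    smile ε h (Cohomology.mk _ p f) (Cohomology.mk _ q g) =
      Cohomology.mk (cochainD ε) n ⟨cup (by omega) g.1 f.1, cup_mem_ker ε _ g.2 f.2⟩ := rfl

theorem cup_one {n : ℕ} (h : n + 0 = n) (f : Cochain k A n) :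
    cup h f (MultilinearMap.constOfIsEmpty k _ 1) = f := by
  ext a
  simp [cup_apply]

theorem one_cup {n : ℕ} (h : 0 + n = n) (f : Cochain k A n) :
    cup h (MultilinearMap.constOfIsEmpty k _ 1) f = f := by
  ext a
  rw [cup_apply, MultilinearMap.constOfIsEmpty_apply, Function.const_apply, one_mul]
  exact congrArg f (funext fun j => congrArg a (Fin.ext (Nat.zero_add _)))

theorem cup_assoc {p q r l m n : ℕ} (hl : p + q = l) (hm : q + r = m) (hln : l + r = n)
    (hmn : p + m = n) (f : Cochain k A p) (g : Cochain k A q) (h : Cochain k A r) :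
    cup hln (cup hl f g) h = cup hmn f (cup hm g h) := by
  subst hl
  ext a
  simp only [cup_apply, mul_assoc]
  refine congrArg₂ (· * ·) rfl (congrArg₂ (· * ·) rfl ?_)
  exact congrArg h (funext fun j => congrArg a (Fin.ext (Nat.add_assoc _ _ _)))

theorem hhT_mk (hσ : ∀ a, ε (σ a) = ε a) {n : ℕ} (f : LinearMap.ker (cochainD ε n)) :
    hhT ε σ hσ n (Cohomology.mk _ n f) = Cohomology.mk (cochainD ε) n ⟨cochainT σ n f.1, by
      have := LinearMap.congr_fun (cochainT_comm ε σ hσ n) f.1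
      simp only [LinearMap.comp_apply, LinearEquiv.coe_coe, LinearMap.mem_ker.1 f.2,
        map_zero] at this
      exact this⟩ := rfl

theorem cochainT_mem (hA : IsYetterDrinfeld σ.toLinearEquiv 𝒜) {n : ℕ} {g : ℤ} {f : Cochain k A n}
    (hf : f ∈ cochainGr 𝒜 n g) : cochainT σ n f ∈ cochainGr 𝒜 n g := by
  intro e a ha h
  refine hf e (fun i => σ.symm (a i)) (fun i => ?_) h
  have := ha i
  rw [← hA.map_gr] at this
  obtain ⟨b, hb, hb'⟩ := this
  rw [← hb']
  simpa using hb

theorem cochainT_symm_mem (hA : IsYetterDrinfeld σ.toLinearEquiv 𝒜) {n : ℕ} {g : ℤ}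
    {f : Cochain k A n} (hf : f ∈ cochainGr 𝒜 n g) :
    (cochainT σ n).symm f ∈ cochainGr 𝒜 n g := by
  intro e a ha h
  refine hf e (fun i => σ (a i)) (fun i => ?_) h
  rw [← hA.map_gr]
  exact ⟨_, ha i, rfl⟩

theorem hhGr_map_hhT (hA : IsYetterDrinfeld σ.toLinearEquiv 𝒜) (hσ : ∀ a, ε (σ a) = ε a) (n : ℕ)
    (g : ℤ) : (hhGr ε 𝒜 n g).map (hhT ε σ hσ n : HH ε n →ₗ[k] HH ε n) = hhGr ε 𝒜 n g := by
  apply le_antisymm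
  · rintro _ ⟨_, ⟨f, hf, rfl⟩, rfl⟩
    exact ⟨⟨cochainT σ n f.1, _⟩, cochainT_mem hA hf, rfl⟩
  · rintro _ ⟨f, hf, rfl⟩
    have hk : (cochainT σ n).symm f.1 ∈ LinearMap.ker (cochainD ε n) := by
      have := LinearMap.congr_fun (cochainT_comm ε σ hσ n) ((cochainT σ n).symm f.1)
      simp only [LinearMap.comp_apply, LinearEquiv.coe_coe, LinearEquiv.apply_symm_apply,
        LinearMap.mem_ker.1 f.2] at this
      rw [LinearMap.mem_ker]
      exact (cochainT σ (n + 1)).map_eq_zero_iff.1 this.symm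
    refine ⟨_, ⟨⟨_, hk⟩, cochainT_symm_mem hA hf, rfl⟩, ?_⟩
    exact mk_eq_mk ((cochainT σ n).apply_symm_apply f.1)

theorem cup_mem_cochainGr {p q n : ℕ} (h : p + q = n) {i j : ℤ} {f : Cochain k A p}
    {g : Cochain k A q} (hf : f ∈ cochainGr 𝒜 p i) (hg : g ∈ cochainGr 𝒜 q j) :
    cup h f g ∈ cochainGr 𝒜 n (i + j) := by
  subst h
  intro e a ha hne
  rw [cup_apply]
  by_cases h1 : (∑ l : Fin p, e ⟨l, by omega⟩) + i = 0
  · rw [hg (fun l => e ⟨p + l, by omega⟩) _ (fun l => ha _), mul_zero]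
    intro h2
    apply hne
    rw [Fin.sum_univ_add]
    have e1 : ∑ l : Fin p, e (Fin.castAdd q l) = ∑ l : Fin p, e ⟨l, by omega⟩ := rfl
    have e2 : ∑ l : Fin q, e (Fin.natAdd p l) = ∑ l : Fin q, e ⟨p + l, by omega⟩ := rfl
    rw [e1, e2]
    omega
  · rw [hf (fun l => e ⟨l, by omega⟩) _ (fun l => ha _) h1, zero_mul]

/-- All identities except commutativity hold already for cochains. Commutativity is asked only for
homogeneous `a`, where the braiding is an explicit power of `t`. -/
theorem isGradedBraidedCommAlgebra (hσ : ∀ a, ε (σ a) = ε a)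
    (yd : ∀ n, IsYetterDrinfeld (hhT ε σ hσ n) (hhGr ε 𝒜 n))
    (hcomm : ∀ {p q n : ℕ} (h : p + q = n) (h' : q + p = n) {i : ℤ} {a : HH ε p} (b : HH ε q),
      a ∈ hhGr ε 𝒜 p i →
        smile ε h a b = (-1 : k) ^ (p * q) • smile ε h' ((hhT ε σ hσ q ^ i) b) a) :
    IsGradedBraidedCommAlgebra (hhT ε σ hσ) (hhGr ε 𝒜) (hhOne ε) (smile ε) where
  yd := yd
  one_t := mk_eq_mk (by ext; simp [cochainT])
  one_gr := ⟨⟨MultilinearMap.constOfIsEmpty k _ 1, _⟩, fun e a ha h => by simp at h, rfl⟩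
  mul_t h a b := by
    induction a using HH_induction with | _ f
    induction b using HH_induction with | _ g
    rw [smile_mk, hhT_mk, hhT_mk, hhT_mk, smile_mk]
    refine mk_eq_mk ?_
    ext a
    simp [cochainT, cup_apply]
  mul_gr := by
    rintro p q n h i j _ _ ⟨f, hf, rfl⟩ ⟨g, hg, rfl⟩
    rw [smile_mk, add_comm i j]
    exact ⟨_, cup_mem_cochainGr _ hg hf, rfl⟩
  one_mul a := by
    induction a using HH_induction with | _ f
    exact mk_eq_mk (cup_one _ f.1)
  mul_one a := by
    induction a using HH_induction with | _ f
    exact mk_eq_mk (one_cup _ f.1)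
  mul_assoc hl hm hln hmn a b c := by
    induction a using HH_induction with | _ f
    induction b using HH_induction with | _ g
    induction c using HH_induction with | _ h
    simp only [smile_mk]
    exact mk_eq_mk (cup_assoc _ _ _ _ _ _ _).symm
  mul_comm {p q n} h h' z := by
    induction z using TensorProduct.induction_on with
    | zero => simp
    | add x y hx hy => rw [map_add, hx, hy, map_add, map_add, smul_add]
    | tmul a b =>
      -- Both sides are linear in `a`, and homogeneous classes span.
      refine induction_of_iSup_eq_top (yd p).internal.submodule_iSup_eq_top
        (LinearMap.ker (TensorProduct.lift (smile ε h) ∘ₗ (TensorProduct.mk k _ _).flip b -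
          (-1 : k) ^ (p * q) • TensorProduct.lift (smile ε h') ∘ₗ
            (yd p).braiding (hhT ε σ hσ q) ∘ₗ (TensorProduct.mk k _ _).flip b))
        (fun i a ha => ?_) a |> fun h => by simpa [sub_eq_zero] using h
      simp only [LinearMap.mem_ker, LinearMap.sub_apply, LinearMap.comp_apply,
        LinearMap.flip_apply, TensorProduct.mk_apply, LinearMap.smul_apply,
        TensorProduct.lift.tmul, sub_eq_zero]
      rw [(yd p).braiding_tmul _ ha, TensorProduct.lift.tmul]
      exact hcomm h h' b ha

end HHAlgebra

namespace BimoduleComplex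
variable {A : Type*} [Ring A] [Algebra k A] {R : BimoduleComplex k A} {ε : A →ₐ[k] k}
  {σ : A ≃ₐ[k] A} {𝒜 : ℤ → Submodule k A} {τ : ∀ n, R.P n ≃ₗ[k] R.P n}

/-- That homogeneous classes span is not visible on cochains: a multilinear form on an infinite
dimensional `A` need not be a finite sum of homogeneous ones. It is transported from the resolution,
whose terms have finite rank. -/
theorem hh_yd (hmin : R.IsMinimal ε) [SetLike.GradedMonoid 𝒜]
    (hA : IsYetterDrinfeld σ.toLinearEquiv 𝒜)
    (hε : ∀ {i : ℤ} {a : A}, a ∈ 𝒜 i → i ≠ 0 → ε a = 0) (hσ : ∀ a, ε (σ a) = ε a)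
    {hR : R.IsResolutionYD σ 𝒜 τ} {φ : ∀ n, R.P n →ₗ[Env k A] Bar k A n} {hφ : R.IsComparison φ}
    (hc : ComputesHH hσ hR hφ) (n : ℕ) : IsYetterDrinfeld (hhT ε σ hσ n) (hhGr ε 𝒜 n) where
  internal := isInternal_of_map (LinearEquiv.ofBijective _ (hc.bijective n)) (hc.map_gr n)
    (grading_internal hmin hε n)
  map_gr := hhGr_map_hhT hA hσ n

/-- Evaluation of cohomology classes on a minimal resolution. -/
def hhEval (hmin : R.IsMinimal ε) (hR : R.IsResolutionYD σ 𝒜 τ) (n : ℕ) : HH ε n →ₗ[k] R.Hom ε n :=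
  cohomologyVal hmin n ∘ₗ comparison (toBar_isComparison hR) n

variable {hσ : ∀ a, ε (σ a) = ε a} {hR : R.IsResolutionYD σ 𝒜 τ}

theorem hhEval_injective (hmin : R.IsMinimal ε) (hc : ComputesHH hσ hR (toBar_isComparison hR))
    (n : ℕ) : Function.Injective (hhEval hmin hR n) :=
  (cohomologyVal_injective hmin n).comp (hc.bijective n).1

theorem hhEval_surjective (hmin : R.IsMinimal ε) (hc : ComputesHH hσ hR (toBar_isComparison hR))
    (n : ℕ) (f : R.Hom ε n) : ∃ x, hhEval hmin hR n x = f := by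
  obtain ⟨x, hx⟩ := (hc.bijective n).2 (Cohomology.mk (X := fun n => R.Hom ε n) (R.homD ε) n
    ⟨f, by rw [hmin.homD_eq_zero]; rfl⟩)
  exact ⟨x, congrArg (cohomologyVal hmin n) hx⟩

theorem hhEval_ext (hmin : R.IsMinimal ε) (hc : ComputesHH hσ hR (toBar_isComparison hR))
    {n : ℕ} {x y : HH ε n} (h : ∀ i, (hhEval hmin hR n x).1 (Pi.single i 1) =
      (hhEval hmin hR n y).1 (Pi.single i 1)) : x = y :=
  hhEval_injective hmin hc n (Hom.ext h)

/-- This turns the matrix of `t` on the generators of `P` into the action of `t` on classes. -/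
theorem hhEval_hhT (hmin : R.IsMinimal ε) {n : ℕ} (x : HH ε n) (m : R.P n) :
    (hhEval hmin hR n (hhT ε σ hσ n x)).1 (τ n m) = (hhEval hmin hR n x).1 m := by
  induction x using HH_induction with | _ f
  exact pullback_cochainT hmin hσ hR (toBar_isComparison hR) f.2 m

theorem hhEval_eq_zero [SetLike.GradedMonoid 𝒜] (hmin : R.IsMinimal ε)
    (hε : ∀ {i : ℤ} {a : A}, a ∈ 𝒜 i → i ≠ 0 → ε a = 0) {n : ℕ} {g : ℤ} {x : HH ε n}
    (hx : x ∈ hhGr ε 𝒜 n g) {i : Fin (R.rank n)} (h : R.deg n i + g ≠ 0) :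
    (hhEval hmin hR n x).1 (Pi.single i 1) = 0 := by
  obtain ⟨f, hf, rfl⟩ := hx
  exact barEval_eq_zero hε (show f.1 ∈ cochainGr 𝒜 n g from hf)
    (toBar_mem hR (single_mem_gr n i)) h

end BimoduleComplex

/-! ### Evaluating cochains and cup products on the generators of a resolution. -/

section Recursion
variable {A : Type*} [Ring A] [Algebra k A] (ε : A →ₐ[k] k)

/-- `a ⊗ b ↦ a ε(b)` -/
def Env.left : Env k A →ₗ[k] A :=
  (TensorProduct.rid k A).toLinearMap ∘ₗ
    TensorProduct.map LinearMap.id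
      (ε.toLinearMap ∘ₗ (MulOpposite.opLinearEquiv k : A ≃ₗ[k] Aᵐᵒᵖ).symm.toLinearMap)

theorem Env.left_tmul (a : A) (b : Aᵐᵒᵖ) : Env.left ε (a ⊗ₜ b) = ε b.unop • a := by
  simp [Env.left]

/-- The contraction moves the left factor of `z` into the first argument of `f`, while its right
factor survives only through `ε`. The left factor of `m` has to be `1`, as it would otherwise enter
that argument too. -/
theorem barEval_barContract {n : ℕ} (f : Cochain k A (n + 1)) (z : Env k A) {m : Bar k A n}
    (hm : m ∈ Submodule.span k {m : Bar k A n | ∃ (b : Aᵐᵒᵖ) (w : Fin n → A),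
      m = (1 ⊗ₜ b) ⊗ₜ PiTensorProduct.tprod k w}) :
    barEval ε (n + 1) f (barContract k A n (z • m)) =
      barEval ε n (f.curryLeft (Env.left ε z)) m := by
  induction hm using Submodule.span_induction with
  | zero => simp
  | add x y _ _ hx hy => rw [smul_add, map_add, map_add, hx, hy, map_add]
  | smul c x _ hx => rw [smul_comm, map_smul, map_smul, hx, map_smul]
  | mem x hx =>
    obtain ⟨b, w, rfl⟩ := hx
    induction z using TensorProduct.induction_on with
    | zero =>
      have h0 := zero_smul (Env k A) (((1 : A) ⊗ₜ[k] b : Env k A) ⊗ₜ[k]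
        PiTensorProduct.tprod k w : Bar k A n)
      exact (congrArg (fun t => barEval ε (n + 1) f (barContract k A n t)) h0).trans (by simp)
    | add x y hx hy => rw [add_smul, map_add, map_add, hx, hy, map_add, map_add, map_add,
        LinearMap.add_apply]
    | tmul c d =>
      rw [bar_smul_tmul, Algebra.TensorProduct.tmul_mul_tmul, mul_one, barContract_tmul,
        barEval_tmul_tprod, barEval_tmul_tprod, Env.left_tmul, map_smul, Env.ε_tmul, Env.ε_tmul,
        map_one, one_mul, MulOpposite.unop_mul, map_mul, smul_apply,
        MultilinearMap.curryLeft_apply]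
      simp only [smul_eq_mul]
      ring

variable {ε}
open BimoduleComplex

/-- `toBar` sends every generator into the span of terms that begin with `1`: in degree 0 by `haug`,
later because the contraction puts a `1` in front. So one step of the recursion feeds the
coefficients of the differential, with `ε` applied on the right, into the first argument. -/
theorem barEval_toBar_succ (R : BimoduleComplex k A) (haug : ∀ i, R.aug i = 1) {n : ℕ}
    (f : Cochain k A (n + 1)) (i : Fin (R.rank (n + 1))) :
    barEval ε (n + 1) f (R.toBar (n + 1) (Pi.single i 1)) =
      ∑ j, barEval ε n (f.curryLeft (Env.left ε (R.d n i j))) (R.toBar n (Pi.single j 1)) := by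
  rw [toBar_succ_single, R.P_eq_sum (R.d n i), map_sum, map_sum, map_sum]
  refine Finset.sum_congr rfl fun j _ => ?_
  rw [map_smul, barEval_barContract]
  · simp [Finset.sum_apply, Pi.single_apply]
  · cases n with
    | zero =>
      rw [toBar_zero_single, haug]
      exact Submodule.subset_span ⟨1, _, rfl⟩
    | succ n =>
      rw [toBar_succ_single]
      have : LinearMap.range (barContract k A n) ≤
          Submodule.span k {m : Bar k A (n + 1) | ∃ (b : Aᵐᵒᵖ) (w : Fin (n + 1) → A),
            m = (1 ⊗ₜ b) ⊗ₜ PiTensorProduct.tprod k w} := by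
        rintro _ ⟨m, rfl⟩
        induction m using TensorProduct.induction_on with
        | zero => simp
        | add x y hx hy => rw [map_add]; exact add_mem hx hy
        | tmul z w =>
          induction z using TensorProduct.induction_on with
          | zero => simp
          | add x y hx hy => rw [TensorProduct.add_tmul, map_add]; exact add_mem hx hy
          | tmul a b =>
            induction w using PiTensorProduct.induction_on with
            | add x y hx hy => rw [TensorProduct.tmul_add, map_add]; exact add_mem hx hy
            | smul_tprod c w =>
              rw [TensorProduct.tmul_smul, map_smul, barContract_tmul]
              exact Submodule.smul_mem _ _ (Submodule.subset_span ⟨b, _, rfl⟩)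
      exact this ⟨_, rfl⟩

theorem curryLeft_cup {p q n : ℕ} (h : p + 1 + q = n + 1) (f : Cochain k A (p + 1))
    (g : Cochain k A q) (a : A) :
    (cup h f g).curryLeft a = cup (by omega : p + q = n) (f.curryLeft a) g := by
  ext w
  simp only [MultilinearMap.curryLeft_apply, cup_apply]
  congr 2
  · ext i
    refine Fin.cases ?_ (fun i => ?_) i <;> rfl
  · ext i
    have : (⟨p + 1 + i, by omega⟩ : Fin (n + 1)) = Fin.succ ⟨p + i, by omega⟩ := by
      ext; simp; omega
    rw [this, Fin.cons_succ]

theorem zero_cup {n : ℕ} (h : 0 + n = n) (f : Cochain k A 0) (g : Cochain k A n) :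
    cup h f g = f (fun i => i.elim0) • g := by
  ext a
  simp only [cup_apply, smul_apply, smul_eq_mul]
  exact congrArg₂ (· * ·) (congrArg f (Subsingleton.elim _ _))
    (congrArg g (funext fun j => congrArg a (Fin.ext (Nat.zero_add _))))

/-- Fixing the first argument reduces `f` to a scalar, so a product with a cochain of degree 1 needs
only one matrix of the differential. -/
theorem barEval_cup_one (R : BimoduleComplex k A) (haug : ∀ i, R.aug i = 1) {n : ℕ}
    (h : 1 + n = n + 1) (f : Cochain k A 1) (g : Cochain k A n) (i : Fin (R.rank (n + 1))) :
    barEval ε (n + 1) (cup h f g) (R.toBar (n + 1) (Pi.single i 1)) =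
      ∑ j, f ![Env.left ε (R.d n i j)] * barEval ε n g (R.toBar n (Pi.single j 1)) := by
  rw [barEval_toBar_succ R haug]
  refine Finset.sum_congr rfl fun j _ => ?_
  rw [curryLeft_cup, zero_cup, map_smul]
  simp only [LinearMap.smul_apply, smul_eq_mul, MultilinearMap.curryLeft_apply]
  congr 2

theorem barEval_cup_two (R : BimoduleComplex k A) (haug : ∀ i, R.aug i = 1) {n : ℕ}
    (h : 2 + n = n + 2) (f : Cochain k A 2) (g : Cochain k A n) (i : Fin (R.rank (n + 2))) :
    barEval ε (n + 2) (cup h f g) (R.toBar (n + 2) (Pi.single i 1)) =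
      ∑ j, ∑ l, f ![Env.left ε (R.d (n + 1) i j), Env.left ε (R.d n j l)] *
        barEval ε n g (R.toBar n (Pi.single l 1)) := by
  rw [barEval_toBar_succ R haug]
  refine Finset.sum_congr rfl fun j _ => ?_
  rw [curryLeft_cup, barEval_cup_one R haug]
  refine Finset.sum_congr rfl fun l _ => ?_
  rw [MultilinearMap.curryLeft_apply]
  congr 2

/-- The cup product with the unit cochain turns the formula for products into one for a single
cochain. -/
theorem barEval_toBar_one (R : BimoduleComplex k A) (haug : ∀ i, R.aug i = 1)
    (f : Cochain k A 1) (i : Fin (R.rank 1)) :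
    barEval ε 1 f (R.toBar 1 (Pi.single i 1)) = ∑ j, f ![Env.left ε (R.d 0 i j)] := by
  have := barEval_cup_one (ε := ε) R haug (by omega) f (MultilinearMap.constOfIsEmpty k _ 1) i
  rw [cup_one] at this
  rw [this]
  refine Finset.sum_congr rfl fun j _ => ?_
  rw [toBar_zero_single, haug, barEval_tmul_tprod]
  simp [Env.ε_tmul]

theorem barEval_toBar_two (R : BimoduleComplex k A) (haug : ∀ i, R.aug i = 1)
    (f : Cochain k A 2) (i : Fin (R.rank 2)) :
    barEval ε 2 f (R.toBar 2 (Pi.single i 1)) =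
      ∑ j, ∑ l, f ![Env.left ε (R.d 1 i j), Env.left ε (R.d 0 j l)] := by
  have := barEval_cup_two (ε := ε) R haug (by omega) f (MultilinearMap.constOfIsEmpty k _ 1) i
  rw [cup_one] at this
  rw [this]
  refine Finset.sum_congr rfl fun j _ => Finset.sum_congr rfl fun l _ => ?_
  rw [toBar_zero_single, haug, barEval_tmul_tprod]
  simp [Env.ε_tmul]

end Recursion
end
end HochYD

namespace HochYD
noncomputable section
variable {k : Type*} [Field k]

/-! ### The grading by word length. -/

section Words
variable {A : Type*} [Ring A] [Algebra k A] {x y : A}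

theorem word_mem_wordGr {w : List A} (hw : ∀ v ∈ w, v = x ∨ v = y) :
    w.prod ∈ wordGr (k := k) x y w.length :=
  Submodule.subset_span ⟨w, hw, rfl, rfl⟩

theorem left_mem_wordGr : x ∈ wordGr (k := k) x y 1 := by
  simpa using word_mem_wordGr (k := k) (x := x) (y := y) (w := [x]) (by simp)

theorem right_mem_wordGr : y ∈ wordGr (k := k) x y 1 := by
  simpa using word_mem_wordGr (k := k) (x := x) (y := y) (w := [y]) (by simp)

instance : SetLike.GradedMonoid (wordGr (k := k) x y) where
  one_mem := by simpa using word_mem_wordGr (k := k) (x := x) (y := y) (w := []) (by simp)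
  mul_mem i j a b ha hb := by
    refine Submodule.mul_le (M := wordGr (k := k) x y i) (N := wordGr x y j)
      (P := wordGr x y (i + j)) |>.1 ?_ a ha b hb
    rw [wordGr, wordGr, Submodule.span_mul_span, Submodule.span_le]
    rintro _ ⟨_, ⟨w, hw, rfl, rfl⟩, _, ⟨w', hw', rfl, rfl⟩, rfl⟩
    have := word_mem_wordGr (k := k) (x := x) (y := y) (w := w ++ w') (by
      intro v hv
      rcases List.mem_append.1 hv with h | h
      exacts [hw v h, hw' v h])
    simpa using this

theorem iSup_wordGr (hgen : Algebra.adjoin k {x, y} = ⊤) : ⨆ n, wordGr (k := k) x y n = ⊤ := by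
  rw [eq_top_iff, ← Algebra.top_toSubmodule, ← hgen, Algebra.adjoin_eq_span, Submodule.span_le]
  intro a ha
  obtain ⟨w, hw, rfl⟩ := Submonoid.exists_list_of_mem_closure ha
  exact Submodule.mem_iSup_of_mem _ (word_mem_wordGr fun v hv => by simpa using hw v hv)

theorem left_induction (hgen : Algebra.adjoin k {x, y} = ⊤) {S : Submodule k A} (h1 : 1 ∈ S)
    (hx : ∀ a ∈ S, x * a ∈ S) (hy : ∀ a ∈ S, y * a ∈ S) (a : A) : a ∈ S := by
  refine induction_of_iSup_eq_top (iSup_wordGr hgen) S (fun n => Submodule.span_le.2 ?_) a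
  rintro _ ⟨w, hw, -, rfl⟩
  clear n
  induction w with
  | nil => simpa using h1
  | cons v w ih =>
    have h := ih fun u hu => hw u (List.mem_cons_of_mem _ hu)
    rw [List.prod_cons]
    rcases hw v List.mem_cons_self with rfl | rfl
    exacts [hx _ h, hy _ h]

theorem right_induction (hgen : Algebra.adjoin k {x, y} = ⊤) {S : Submodule k A} (h1 : 1 ∈ S)
    (hx : ∀ a ∈ S, a * x ∈ S) (hy : ∀ a ∈ S, a * y ∈ S) (a : A) : a ∈ S := by
  refine induction_of_iSup_eq_top (iSup_wordGr hgen) S (fun n => Submodule.span_le.2 ?_) a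
  rintro _ ⟨w, hw, -, rfl⟩
  clear n
  induction w using List.reverseRecOn with
  | nil => simpa using h1
  | append_singleton w v ih =>
    have h := ih fun u hu => hw u (List.mem_append_left _ hu)
    rw [List.prod_append, List.prod_singleton]
    rcases hw v (by simp) with rfl | rfl
    exacts [hx _ h, hy _ h]

theorem wordGr_le_of_words {n : ℤ} {S : Submodule k A}
    (h : ∀ w : List A, (∀ v ∈ w, v = x ∨ v = y) → (w.length : ℤ) = n → w.prod ∈ S) :
    wordGr (k := k) x y n ≤ S := by
  refine Submodule.span_le.2 ?_
  rintro _ ⟨w, hw, hn, rfl⟩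
  exact h w hw hn

theorem wordGr_eq_zero {n : ℤ} (hn : n < 0) {a : A} (ha : a ∈ wordGr (k := k) x y n) : a = 0 := by
  have : wordGr (k := k) x y n ≤ ⊥ := wordGr_le_of_words fun w _ h => by omega
  exact this ha

theorem map_wordGr {B : Type*} [Ring B] [Algebra k B] (f : A →ₐ[k] B)
    {ℬ : ℤ → Submodule k B} [SetLike.GradedMonoid ℬ] (hx : f x ∈ ℬ 1)
    (hy : f y ∈ ℬ 1) {n : ℤ} {a : A} (ha : a ∈ wordGr (k := k) x y n) : f a ∈ ℬ n := by
  have : wordGr (k := k) x y n ≤ (ℬ n).comap f.toLinearMap := by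
    refine wordGr_le_of_words fun w hw hn => ?_
    subst hn
    clear ha
    rw [Submodule.mem_comap]
    induction w with
    | nil => simpa using SetLike.one_mem_graded ℬ
    | cons v w ih =>
      have h := ih fun u hu => hw u (List.mem_cons_of_mem _ hu)
      have hv : f v ∈ ℬ 1 := by
        rcases hw v List.mem_cons_self with rfl | rfl
        exacts [hx, hy]
      have := SetLike.mul_mem_graded hv h
      simpa [add_comm] using this
  exact this ha

theorem counit_wordGr {ε : A →ₐ[k] k} (hx : ε x = 0) (hy : ε y = 0) {n : ℤ} {a : A}
    (ha : a ∈ wordGr (k := k) x y n) (hn : n ≠ 0) : ε a = 0 := by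
  have : wordGr (k := k) x y n ≤ LinearMap.ker ε.toLinearMap := by
    refine wordGr_le_of_words fun w hw h => ?_
    cases w with
    | nil => simp at h; omega
    | cons v w =>
      rcases hw v List.mem_cons_self with rfl | rfl <;> simp [hx, hy]
  exact this ha

open Polynomial in
theorem grading_hom_apply {G : A →ₐ[k] A[X]} (hx : G x = monomial 1 x) (hy : G y = monomial 1 y)
    {n : ℤ} {a : A} (ha : a ∈ wordGr (k := k) x y n) : G a = monomial n.toNat a := by
  have : wordGr (k := k) x y n ≤
      LinearMap.ker (G.toLinearMap - (monomial n.toNat).restrictScalars k) := by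
    refine wordGr_le_of_words fun w hw hn => ?_
    subst hn
    clear ha
    rw [LinearMap.mem_ker, LinearMap.sub_apply, sub_eq_zero]
    simp only [AlgHom.toLinearMap_apply, LinearMap.restrictScalars_apply, Int.toNat_natCast]
    induction w with
    | nil => simp
    | cons v w ih =>
      have h := ih fun u hu => hw u (List.mem_cons_of_mem _ hu)
      have hv : G v = monomial 1 v := by
        rcases hw v List.mem_cons_self with rfl | rfl
        exacts [hx, hy]
      rw [List.prod_cons, map_mul, hv, h, monomial_mul_monomial, List.length_cons, add_comm]
  have := this ha
  rwa [LinearMap.mem_ker, LinearMap.sub_apply, sub_eq_zero] at this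

-- `G` multiplies a word of length `n` by `Xⁿ`, so its coefficients are the homogeneous components.
-- That `G` exists is the homogeneity of the relations.
open Polynomial in
theorem wordGr_internal (hgen : Algebra.adjoin k {x, y} = ⊤) {G : A →ₐ[k] A[X]}
    (hx : G x = monomial 1 x) (hy : G y = monomial 1 y) :
    DirectSum.IsInternal (wordGr (k := k) x y) := by
  -- Without the test on the sign, `toNat` would send negative degrees to the coefficient of degree
  -- 0.
  refine isInternal_of_proj _ (fun n => if 0 ≤ n then
    (lcoeff A n.toNat).restrictScalars k ∘ₗ G.toLinearMap else 0) (fun n a ha => ?_)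
    (fun n m hnm a ha => ?_) (iSup_wordGr hgen)
  · by_cases hn : 0 ≤ n
    · simp [hn, grading_hom_apply hx hy ha]
    · simp [hn, wordGr_eq_zero (by omega) ha]
  · by_cases hm : m < 0
    · rw [wordGr_eq_zero hm ha, map_zero]
    by_cases hn : 0 ≤ n
    · have : m.toNat ≠ n.toNat := by omega
      simp [hn, grading_hom_apply hx hy ha, coeff_monomial, this]
    · simp [hn]

theorem wordGr_yd (hgen : Algebra.adjoin k {x, y} = ⊤) {G : A →ₐ[k] Polynomial A}
    (hx : G x = Polynomial.monomial 1 x) (hy : G y = Polynomial.monomial 1 y) (σ : A ≃ₐ[k] A)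
    (h1 : σ x ∈ wordGr (k := k) x y 1) (h2 : σ y ∈ wordGr (k := k) x y 1)
    (h3 : σ.symm x ∈ wordGr (k := k) x y 1) (h4 : σ.symm y ∈ wordGr (k := k) x y 1) :
    IsYetterDrinfeld σ.toLinearEquiv (wordGr (k := k) x y) where
  internal := wordGr_internal hgen hx hy
  map_gr n := by
    apply le_antisymm
    · rintro _ ⟨a, ha, rfl⟩
      exact map_wordGr σ.toAlgHom h1 h2 ha
    · intro a ha
      exact ⟨σ.symm a, map_wordGr σ.symm.toAlgHom h3 h4 ha, σ.apply_symm_apply a⟩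

end Words

/-! ### The coproduct with primitive generators. -/

section Bimonoid
variable {A : Type*} [Ring A] [Algebra k A] {𝒜 : ℤ → Submodule k A} {σ : A ≃ₐ[k] A}

theorem braidedMul_tmul (hA : IsYetterDrinfeld σ.toLinearEquiv 𝒜) {n : ℤ} {b : A} (hb : b ∈ 𝒜 n)
    (a c d : A) : braidedMul (hA.braiding σ.toLinearEquiv) ((a ⊗ₜ[k] b) ⊗ₜ[k] (c ⊗ₜ[k] d)) =
      (a * (σ.toLinearEquiv ^ n) c) ⊗ₜ[k] (b * d) := by
  simp [braidedMul, hA.braiding_tmul _ hb]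

variable (σ) in
/-- Left multiplication by `v ⊗ 1 + 1 ⊗ v` in the braided tensor square, for `v` of degree `1`. -/
def primMul : A →ₗ[k] Module.End k (A ⊗[k] A) where
  toFun v := TensorProduct.map (LinearMap.mul k A v) LinearMap.id +
    TensorProduct.map σ.toLinearMap (LinearMap.mul k A v)
  map_add' u v := by
    simp only [map_add, TensorProduct.map_add_left, TensorProduct.map_add_right]
    abel
  map_smul' c v := by
    simp [TensorProduct.map_smul_left, TensorProduct.map_smul_right]

theorem primMul_tmul (v a b : A) :
    primMul σ v (a ⊗ₜ[k] b) = (v * a) ⊗ₜ b + σ a ⊗ₜ (v * b) := by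
  simp [primMul]

/-- An instance of associativity of the braided product. Multiplying `b` of degree `n` by `v` raises
its degree to `1 + n`, and the extra power of `t` in the braiding is the `σ` in `primMul`. -/
theorem primMul_braidedMul (hA : IsYetterDrinfeld σ.toLinearEquiv 𝒜) [SetLike.GradedMonoid 𝒜]
    {v : A} (hv : v ∈ 𝒜 1) (w z : A ⊗[k] A) :
    primMul σ v (braidedMul (hA.braiding σ.toLinearEquiv) (w ⊗ₜ[k] z)) =
      braidedMul (hA.braiding σ.toLinearEquiv) (primMul σ v w ⊗ₜ[k] z) := by
  induction w using TensorProduct.induction_on with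
  | zero => simp
  | add x y hx hy => simp only [TensorProduct.add_tmul, map_add, hx, hy]
  | tmul a b =>
    induction z using TensorProduct.induction_on with
    | zero => simp
    | add x y hx hy => simp only [TensorProduct.tmul_add, map_add, hx, hy]
    | tmul c d =>
      have hb : b ∈ ⨆ n, 𝒜 n := by rw [hA.internal.submodule_iSup_eq_top]; trivial
      induction hb using Submodule.iSup_induction' with
      | zero => simp
      | add x y _ _ hx hy =>
        simp only [TensorProduct.tmul_add, TensorProduct.add_tmul, map_add, hx, hy]
      | mem n b hb =>
        have h1 : (σ.toLinearEquiv ^ (1 + n)) c = σ ((σ.toLinearEquiv ^ n) c) := by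
          rw [zpow_one_add]; rfl
        rw [braidedMul_tmul hA hb, primMul_tmul, primMul_tmul, TensorProduct.add_tmul, map_add,
          braidedMul_tmul hA hb, braidedMul_tmul hA (SetLike.mul_mem_graded hv hb), h1]
        simp [mul_assoc]

theorem braidedMul_prim (hA : IsYetterDrinfeld σ.toLinearEquiv 𝒜) [SetLike.GradedMonoid 𝒜]
    {v : A} (hv : v ∈ 𝒜 1) (z : A ⊗[k] A) :
    braidedMul (hA.braiding σ.toLinearEquiv) ((v ⊗ₜ[k] 1 + 1 ⊗ₜ[k] v) ⊗ₜ[k] z) =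
      primMul σ v z := by
  induction z using TensorProduct.induction_on with
  | zero => simp
  | add x y hx hy => simp only [TensorProduct.tmul_add, map_add, hx, hy]
  | tmul c d =>
    rw [TensorProduct.add_tmul, map_add, braidedMul_tmul hA (SetLike.one_mem_graded 𝒜),
      braidedMul_tmul hA hv, primMul_tmul]
    simp

/-- The hypothesis on `L` says that the operators of left multiplication by the primitive elements
satisfy the relations of `A`. With `Δ a = L a (1 ⊗ 1)`, multiplicativity of `L` becomes
multiplicativity of `Δ`, and the other axioms are checked one generator at a time. -/
theorem existsUnique_comul {x y : A} (hgen : Algebra.adjoin k {x, y} = ⊤)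
    (hA : IsYetterDrinfeld σ.toLinearEquiv (wordGr (k := k) x y)) {ε : A →ₐ[k] k}
    (hx : ε x = 0) (hy : ε y = 0) (hσ : ∀ a, ε (σ a) = ε a)
    (L : A →ₐ[k] Module.End k (A ⊗[k] A)) (hLx : L x = primMul σ x) (hLy : L y = primMul σ y) :
    ∃! Δ : A →ₗ[k] A ⊗[k] A, Δ x = x ⊗ₜ[k] 1 + 1 ⊗ₜ[k] x ∧ Δ y = y ⊗ₜ[k] 1 + 1 ⊗ₜ[k] y ∧
      IsBimonoidYD σ (wordGr (k := k) x y) ε Δ := by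
  have mx : x ∈ wordGr (k := k) x y 1 := left_mem_wordGr
  have my : y ∈ wordGr (k := k) x y 1 := right_mem_wordGr
  -- All of degree 1 is needed, not only `x` and `y`, since `σ` moves the generators within it.
  have hL : ∀ v ∈ wordGr (k := k) x y 1, L v = primMul σ v := by
    intro v hv
    have : wordGr (k := k) x y 1 ≤ LinearMap.ker (L.toLinearMap - primMul σ) := by
      refine wordGr_le_of_words fun w hw hn => ?_
      obtain ⟨u, rfl⟩ := List.length_eq_one_iff.1 (by exact_mod_cast hn)
      rcases hw u (by simp) with rfl | rfl <;> simp [hLx, hLy]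
    have := this hv
    rwa [LinearMap.mem_ker, LinearMap.sub_apply, sub_eq_zero] at this
  have hσg : ∀ n, ∀ a ∈ wordGr (k := k) x y n, σ a ∈ wordGr (k := k) x y n := fun n a ha => by
    rw [← hA.map_gr]
    exact ⟨a, ha, rfl⟩
  let Δ : A →ₗ[k] A ⊗[k] A := LinearMap.flip L.toLinearMap (1 ⊗ₜ 1)
  have Δ1 : Δ 1 = 1 ⊗ₜ 1 := by simp [Δ]
  have Δmul : ∀ v ∈ wordGr (k := k) x y 1, ∀ a, Δ (v * a) = primMul σ v (Δ a) := fun v hv a => by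
    simp [Δ, hL v hv]
  have Δprim : ∀ v ∈ wordGr (k := k) x y 1, Δ v = v ⊗ₜ[k] 1 + 1 ⊗ₜ[k] v := fun v hv => by
    have := Δmul v hv 1
    rwa [mul_one, Δ1, primMul_tmul, map_one, mul_one] at this
  -- `L a` is left multiplication by `Δ a` in the braided square; at `z = Δ b` this is
  -- multiplicativity of `Δ`.
  have LΔ : ∀ a z, L a z = braidedMul (hA.braiding σ.toLinearEquiv) (Δ a ⊗ₜ[k] z) := by
    intro a z
    have step : ∀ v ∈ wordGr (k := k) x y 1, ∀ a,
        L a z = braidedMul (hA.braiding σ.toLinearEquiv) (Δ a ⊗ₜ[k] z) →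
        L (v * a) z = braidedMul (hA.braiding σ.toLinearEquiv) (Δ (v * a) ⊗ₜ[k] z) := by
      intro v hv a h
      rw [map_mul, Module.End.mul_apply, h, hL v hv, Δmul v hv, primMul_braidedMul hA hv]
    refine left_induction hgen (S := LinearMap.eqLocus (LinearMap.flip L.toLinearMap z)
      (braidedMul (hA.braiding σ.toLinearEquiv) ∘ₗ (TensorProduct.mk k _ _).flip z ∘ₗ Δ)) ?_
      (fun a => step x mx a) (fun a => step y my a) a
    change L 1 z = braidedMul _ (Δ 1 ⊗ₜ z)
    rw [Δ1, map_one, Module.End.one_apply]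
    clear step
    induction z using TensorProduct.induction_on with
    | zero => simp
    | add x y hx hy => rw [TensorProduct.tmul_add, map_add, ← hx, ← hy]
    | tmul c d => rw [braidedMul_tmul hA (SetLike.one_mem_graded _)]; simp
  have Δσ : ∀ a, Δ (σ a) = TensorProduct.map σ.toLinearMap σ.toLinearMap (Δ a) := by
    have hT : ∀ v z, primMul σ (σ v) (TensorProduct.map σ.toLinearMap σ.toLinearMap z) =
        TensorProduct.map σ.toLinearMap σ.toLinearMap (primMul σ v z) := by
      intro v z
      induction z using TensorProduct.induction_on with
      | zero => simp
      | add x y hx hy => simp only [map_add, hx, hy]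
      | tmul c d => simp [primMul_tmul]
    have step : ∀ v ∈ wordGr (k := k) x y 1, ∀ a,
        Δ (σ a) = TensorProduct.map σ.toLinearMap σ.toLinearMap (Δ a) →
        Δ (σ (v * a)) = TensorProduct.map σ.toLinearMap σ.toLinearMap (Δ (v * a)) := by
      intro v hv a h
      rw [map_mul, Δmul _ (hσg 1 v hv), h, hT, Δmul v hv]
    refine left_induction hgen (S := LinearMap.eqLocus (Δ ∘ₗ σ.toLinearMap)
      (TensorProduct.map σ.toLinearMap σ.toLinearMap ∘ₗ Δ)) ?_
      (fun a => step x mx a) (fun a => step y my a)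
    simp [LinearMap.mem_eqLocus, Δ1]
  have hε : ∀ v ∈ wordGr (k := k) x y 1, ε v = 0 := fun v hv => counit_wordGr hx hy hv one_ne_zero
  refine ⟨Δ, ⟨Δprim x mx, Δprim y my, ?_⟩, ?_⟩
  · refine ⟨hA, SetLike.one_mem_graded _, fun ha hb => SetLike.mul_mem_graded ha hb, hσ,
      fun ha hi => counit_wordGr hx hy ha hi, Δσ, ?_, ?_, ?_, ?_, Δ1, fun a b => ?_⟩
    · intro i a ha
      have : wordGr (k := k) x y i ≤
          (tensorGr (wordGr (k := k) x y) (wordGr (k := k) x y) i).comap Δ := by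
        refine wordGr_le_of_words fun w hw hn => ?_
        subst hn
        clear ha
        rw [Submodule.mem_comap]
        induction w with
        | nil =>
          rw [List.prod_nil, Δ1]
          exact Submodule.subset_span ⟨0, 0, by simp, 1, SetLike.one_mem_graded _, 1,
            SetLike.one_mem_graded _, rfl⟩
        | cons v w ih =>
          have h := ih fun u hu => hw u (List.mem_cons_of_mem _ hu)
          have hv : v ∈ wordGr (k := k) x y 1 := by
            rcases hw v List.mem_cons_self with rfl | rfl
            exacts [mx, my]
          rw [List.prod_cons, Δmul v hv]
          generalize Δ w.prod = z at h
          induction h using Submodule.span_induction with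
          | zero => simp
          | add x y _ _ hx hy => rw [map_add]; exact add_mem hx hy
          | smul c x _ hx => rw [map_smul]; exact Submodule.smul_mem _ _ hx
          | mem z hz =>
            obtain ⟨i, j, hij, a, ha, b, hb, rfl⟩ := hz
            rw [primMul_tmul]
            refine add_mem (Submodule.subset_span ⟨1 + i, j, ?_, _, SetLike.mul_mem_graded hv ha,
              b, hb, rfl⟩) (Submodule.subset_span ⟨i, 1 + j, ?_, _, hσg i a ha, _,
                SetLike.mul_mem_graded hv hb, rfl⟩) <;>
            · rw [List.length_cons]
              push_cast
              omega
      exact this ha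
    -- `Q v` is left multiplication by `v ⊗ 1 ⊗ 1 + 1 ⊗ v ⊗ 1 + 1 ⊗ 1 ⊗ v` in the braided cube. Both
    -- iterated coproducts carry `primMul σ v` to it, the one on the left factor thanks to `Δσ`.
    · let Q : A → Module.End k (A ⊗[k] (A ⊗[k] A)) := fun v =>
        TensorProduct.map (LinearMap.mul k A v) LinearMap.id +
          TensorProduct.map σ.toLinearMap (primMul σ v)
      have h1 : ∀ v ∈ wordGr (k := k) x y 1, ∀ z, TensorProduct.assoc k A A A
          (LinearMap.rTensor A Δ (primMul σ v z)) =
            Q v (TensorProduct.assoc k A A A (LinearMap.rTensor A Δ z)) := by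
        intro v hv z
        induction z using TensorProduct.induction_on with
        | zero => simp
        | add x y hx hy => simp only [map_add, hx, hy]
        | tmul c d =>
          rw [primMul_tmul, map_add, LinearMap.rTensor_tmul, LinearMap.rTensor_tmul,
            LinearMap.rTensor_tmul, Δmul v hv, Δσ]
          generalize Δ c = e
          induction e using TensorProduct.induction_on with
          | zero => simp
          | add x y hx hy =>
            simp only [map_add, TensorProduct.add_tmul] at hx hy ⊢
            rw [← hx, ← hy]
            abel
          | tmul p q =>
            simp only [primMul_tmul, TensorProduct.add_tmul, map_add, TensorProduct.assoc_tmul,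
              TensorProduct.map_tmul, Q, LinearMap.add_apply, TensorProduct.tmul_add]
            simp [add_assoc]
      have h2 : ∀ v ∈ wordGr (k := k) x y 1, ∀ z, LinearMap.lTensor A Δ (primMul σ v z) =
            Q v (LinearMap.lTensor A Δ z) := by
        intro v hv z
        induction z using TensorProduct.induction_on with
        | zero => simp
        | add x y hx hy => simp only [map_add, hx, hy]
        | tmul c d => simp [primMul_tmul, Δmul v hv, Q]
      have step : ∀ v ∈ wordGr (k := k) x y 1, ∀ a,
          TensorProduct.assoc k A A A (LinearMap.rTensor A Δ (Δ a)) =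
            LinearMap.lTensor A Δ (Δ a) →
          TensorProduct.assoc k A A A (LinearMap.rTensor A Δ (Δ (v * a))) =
            LinearMap.lTensor A Δ (Δ (v * a)) := by
        intro v hv a h
        rw [Δmul v hv, h1 v hv, h2 v hv, h]
      exact left_induction hgen (S := LinearMap.eqLocus
        ((TensorProduct.assoc k A A A).toLinearMap ∘ₗ LinearMap.rTensor A Δ ∘ₗ Δ)
        (LinearMap.lTensor A Δ ∘ₗ Δ)) (by simp [LinearMap.mem_eqLocus, Δ1])
        (fun a => step x mx a) (fun a => step y my a)
    · have h1 : ∀ v ∈ wordGr (k := k) x y 1, ∀ z,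
          TensorProduct.lid k A (LinearMap.rTensor A ε.toLinearMap (primMul σ v z)) =
            v * TensorProduct.lid k A (LinearMap.rTensor A ε.toLinearMap z) := by
        intro v hv z
        induction z using TensorProduct.induction_on with
        | zero => simp
        | add x y hx hy => simp only [map_add, hx, hy, mul_add]
        | tmul c d => simp [primMul_tmul, hε v hv, hσ]
      have step : ∀ v ∈ wordGr (k := k) x y 1, ∀ a,
          TensorProduct.lid k A (LinearMap.rTensor A ε.toLinearMap (Δ a)) = a →
          TensorProduct.lid k A (LinearMap.rTensor A ε.toLinearMap (Δ (v * a))) = v * a := by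
        intro v hv a h
        rw [Δmul v hv, h1 v hv, h]
      exact left_induction hgen (S := LinearMap.eqLocus
        ((TensorProduct.lid k A).toLinearMap ∘ₗ LinearMap.rTensor A ε.toLinearMap ∘ₗ Δ)
        LinearMap.id) (by simp [LinearMap.mem_eqLocus, Δ1])
        (fun a => step x mx a) (fun a => step y my a)
    · have h1 : ∀ v ∈ wordGr (k := k) x y 1, ∀ z,
          TensorProduct.rid k A (LinearMap.lTensor A ε.toLinearMap (primMul σ v z)) =
            v * TensorProduct.rid k A (LinearMap.lTensor A ε.toLinearMap z) := by
        intro v hv z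
        induction z using TensorProduct.induction_on with
        | zero => simp
        | add x y hx hy => simp only [map_add, hx, hy, mul_add]
        | tmul c d => simp [primMul_tmul, hε v hv]
      have step : ∀ v ∈ wordGr (k := k) x y 1, ∀ a,
          TensorProduct.rid k A (LinearMap.lTensor A ε.toLinearMap (Δ a)) = a →
          TensorProduct.rid k A (LinearMap.lTensor A ε.toLinearMap (Δ (v * a))) = v * a := by
        intro v hv a h
        rw [Δmul v hv, h1 v hv, h]
      exact left_induction hgen (S := LinearMap.eqLocus
        ((TensorProduct.rid k A).toLinearMap ∘ₗ LinearMap.lTensor A ε.toLinearMap ∘ₗ Δ)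
        LinearMap.id) (by simp [LinearMap.mem_eqLocus, Δ1])
        (fun a => step x mx a) (fun a => step y my a)
    · rw [← LΔ]
      simp [Δ]
  · rintro Δ' ⟨hx', hy', hB⟩
    -- Uniqueness: multiplicativity and primitivity force `Δ' (v a)` to be `primMul σ v` applied to
    -- `Δ' a`.
    have step : ∀ v ∈ wordGr (k := k) x y 1, Δ' v = v ⊗ₜ[k] 1 + 1 ⊗ₜ[k] v → ∀ a, Δ' a = Δ a →
        Δ' (v * a) = Δ (v * a) := by
      intro v hv h a ha
      rw [hB.comul_mul, h, braidedMul_prim hB.yd hv, ha, Δmul v hv]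
    ext a
    exact left_induction hgen (S := LinearMap.eqLocus Δ' Δ)
      (by rw [LinearMap.mem_eqLocus, Δ1, hB.comul_one])
      (fun a => step x mx hx' a) (fun a => step y my hy' a) a

end Bimonoid
end
end HochYD

namespace HochYD
noncomputable section
variable {k : Type*} [Field k]

/-! ### The grading of `A ⊗ Aᵒᵖ` and a regularity criterion in it. -/

section EnvGrading
open Polynomial
variable {A : Type*} [Ring A] [Algebra k A] {x y : A} {G : A →ₐ[k] A[X]}

variable (G) in
/-- The polynomial whose coefficients are the homogeneous components of an element of `A ⊗ Aᵒᵖ`. -/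
def envGrading : Env k A →ₗ[k] (Env k A)[X] :=
  TensorProduct.lift ((LinearMap.mul k (Env k A)[X]).compl₁₂
    ((mapAlgHom (Algebra.TensorProduct.includeLeft : A →ₐ[k] Env k A)).toLinearMap ∘ₗ
      G.toLinearMap)
    (lsum (fun n => (monomial n).restrictScalars k ∘ₗ
      (Algebra.TensorProduct.includeRight : Aᵐᵒᵖ →ₐ[k] Env k A).toLinearMap ∘ₗ
      (MulOpposite.opLinearEquiv k : A ≃ₗ[k] Aᵐᵒᵖ).toLinearMap) ∘ₗ G.toLinearMap ∘ₗ
      (MulOpposite.opLinearEquiv k : A ≃ₗ[k] Aᵐᵒᵖ).symm.toLinearMap))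

theorem envGrading_tmul (hx : G x = monomial 1 x) (hy : G y = monomial 1 y) {p q : ℤ} {a b : A}
    (ha : a ∈ wordGr (k := k) x y p) (hb : b ∈ wordGr (k := k) x y q) :
    envGrading G (a ⊗ₜ MulOpposite.op b) =
      monomial (p.toNat + q.toNat) (a ⊗ₜ MulOpposite.op b) := by
  simp [envGrading, grading_hom_apply hx hy ha, grading_hom_apply hx hy hb, lsum_apply,
    sum_monomial_index, monomial_mul_monomial]

theorem BimoduleComplex.gr_internal (R : BimoduleComplex k A)
    (hgen : Algebra.adjoin k {x, y} = ⊤) (hx : G x = monomial 1 x) (hy : G y = monomial 1 y)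
    (n : ℕ) : DirectSum.IsInternal (R.gr (wordGr (k := k) x y) n) := by
  -- At the `i`-th generator the component of degree `s` has coefficients of total degree `s - deg
  -- i`; if this is negative there are none.
  let π : ℤ → R.P n →ₗ[k] R.P n := fun s => LinearMap.pi fun i =>
    if 0 ≤ s - R.deg n i then (lcoeff (Env k A) (s - R.deg n i).toNat).restrictScalars k ∘ₗ
      envGrading G ∘ₗ LinearMap.proj i else 0
  have hπ : ∀ (s : ℤ) (i : Fin (R.rank n)) (p q : ℤ) (a b : A), a ∈ wordGr (k := k) x y p →
      b ∈ wordGr (k := k) x y q → π s (Pi.single i (a ⊗ₜ[k] MulOpposite.op b)) =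
        if p + R.deg n i + q = s then Pi.single i (a ⊗ₜ[k] MulOpposite.op b) else 0 := by
    intro s i p q a b ha hb
    by_cases hp : p < 0
    · simp [wordGr_eq_zero hp ha]
    by_cases hq : q < 0
    · simp [wordGr_eq_zero hq hb]
    ext j
    by_cases hj : j = i
    · subst hj
      by_cases hs : 0 ≤ s - R.deg n j
      · have : p.toNat + q.toNat = (s - R.deg n j).toNat ↔ p + R.deg n j + q = s := by omega
        simp only [π, LinearMap.pi_apply, if_pos hs, LinearMap.comp_apply, LinearMap.proj_apply,
          Pi.single_eq_same, envGrading_tmul hx hy ha hb, LinearMap.restrictScalars_apply,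
          lcoeff_apply, coeff_monomial, this]
        split_ifs <;> simp
      · have : ¬ p + R.deg n j + q = s := by omega
        rw [if_neg this]
        simp only [π, LinearMap.pi_apply, if_neg hs, LinearMap.zero_apply, Pi.zero_apply]
    · have h1 : (if p + R.deg n i + q = s then (Pi.single i (a ⊗ₜ[k] MulOpposite.op b) : R.P n)
        else 0) j = 0 := by split_ifs <;> simp [hj]
      rw [h1]
      simp only [π, LinearMap.pi_apply]
      split_ifs <;> simp [hj]
  refine isInternal_of_proj _ π (fun s m hm => ?_) (fun s s' hs m hm => ?_) ?_
  · induction hm using Submodule.span_induction with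
    | zero => simp
    | add x y _ _ hx hy => rw [map_add, hx, hy]
    | smul c x _ hx => rw [map_smul, hx]
    | mem m hm =>
      obtain ⟨i, p, q, h, a, ha, b, hb, rfl⟩ := hm
      rw [hπ s i p q a b ha hb, if_pos h]
  · induction hm using Submodule.span_induction with
    | zero => simp
    | add x y _ _ hx hy => rw [map_add, hx, hy, add_zero]
    | smul c x _ hx => rw [map_smul, hx, smul_zero]
    | mem m hm =>
      obtain ⟨i, p, q, h, a, ha, b, hb, rfl⟩ := hm
      rw [hπ s i p q a b ha hb, if_neg (by omega)]
  · rw [Submodule.eq_top_iff']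
    intro m
    have hm : m = ∑ i, (Pi.single i (m i) : R.P n) := by
      conv_lhs => rw [R.P_eq_sum m]
      exact Finset.sum_congr rfl fun i _ => (R.P_single_eq i _).symm
    rw [hm]
    refine Submodule.sum_mem _ fun i _ => ?_
    generalize m i = z
    induction z using TensorProduct.induction_on with
    | zero => simp
    | add x y hx hy => rw [Pi.single_add]; exact add_mem hx hy
    | tmul a b =>
      obtain ⟨b, rfl⟩ := MulOpposite.op_surjective b
      have hA := iSup_wordGr (k := k) hgen
      have ha : a ∈ ⨆ n, wordGr (k := k) x y n := by rw [hA]; trivial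
      induction ha using Submodule.iSup_induction' with
      | zero => simp
      | add u v _ _ hu hv => rw [TensorProduct.add_tmul, Pi.single_add]; exact add_mem hu hv
      | mem p a ha =>
        have hb : b ∈ ⨆ n, wordGr (k := k) x y n := by rw [hA]; trivial
        induction hb using Submodule.iSup_induction' with
        | zero => simp
        | add u v _ _ hu hv =>
          rw [MulOpposite.op_add, TensorProduct.tmul_add, Pi.single_add]; exact add_mem hu hv
        | mem q b hb =>
          exact Submodule.mem_iSup_of_mem _ (Submodule.subset_span
            ⟨i, p, q, rfl, a, ha, b, hb, rfl⟩)

variable (G) in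
/-- The homomorphism which records the degree of the left tensor factor. -/
def envLeftGrading : Env k A →ₐ[k] (Env k A)[X] :=
  Algebra.TensorProduct.lift
    ((mapAlgHom (Algebra.TensorProduct.includeLeft : A →ₐ[k] Env k A)).comp G)
    (CAlgHom.comp (Algebra.TensorProduct.includeRight : Aᵐᵒᵖ →ₐ[k] Env k A)) (fun a b => by
      change _ * _ = _ * _
      ext n
      simp [CAlgHom])

/-- Setting the variable to 1, that is summing the coefficients, is a left inverse. -/
theorem envLeftGrading_injective (hgen : Algebra.adjoin k {x, y} = ⊤) (hx : G x = monomial 1 x)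
    (hy : G y = monomial 1 y) : Function.Injective (envLeftGrading G) := by
  have : (lsum fun _ => LinearMap.id) ∘ₗ (envLeftGrading G).toLinearMap = LinearMap.id := by
    apply TensorProduct.ext'
    intro a b
    have ha : a ∈ ⨆ n, wordGr (k := k) x y n := by rw [iSup_wordGr hgen]; trivial
    induction ha using Submodule.iSup_induction' with
    | zero => simp
    | add u v _ _ hu hv => rw [TensorProduct.add_tmul, map_add, map_add, hu, hv]
    | mem p a ha =>
      simp [envLeftGrading, grading_hom_apply hx hy ha, CAlgHom, lsum_apply, monomial_mul_C,
        sum_monomial_index]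
  exact Function.LeftInverse.injective (g := lsum fun _ => LinearMap.id)
    (fun z => LinearMap.congr_fun this z)

/-- A leading term argument in the degree of the left factor: `u ⊗ 1` raises it by one and `1 ⊗ v`
keeps it, so the top component of `c` is annihilated by `u ⊗ 1`. Right multiplication by `u ⊗ 1`
stays injective by flatness over the field; `v` is arbitrary. -/
theorem env_right_regular (hgen : Algebra.adjoin k {x, y} = ⊤) (hx : G x = monomial 1 x)
    (hy : G y = monomial 1 y) {u : A} (hu : u ∈ wordGr (k := k) x y 1)
    (hreg : ∀ a, a * u = 0 → a = 0) (v : Aᵐᵒᵖ) {c : Env k A}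
    (hc : c * (u ⊗ₜ 1 + 1 ⊗ₜ v) = 0) : c = 0 := by
  have hinj : ∀ z : Env k A, z * (u ⊗ₜ 1) = 0 → z = 0 := by
    have h1 : Function.Injective (LinearMap.mulRight k u) := by
      rw [injective_iff_map_eq_zero]
      exact hreg
    have h2 := Module.Flat.rTensor_preserves_injective_linearMap (M := Aᵐᵒᵖ) _ h1
    rw [injective_iff_map_eq_zero] at h2
    intro z hz
    refine h2 z ?_
    rw [← hz]
    have : LinearMap.rTensor Aᵐᵒᵖ (LinearMap.mulRight k u) =
        LinearMap.mulRight k (u ⊗ₜ[k] (1 : Aᵐᵒᵖ) : Env k A) :=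
      TensorProduct.ext' fun a b => by simp
    rw [this, LinearMap.mulRight_apply]
  apply envLeftGrading_injective hgen hx hy
  rw [map_zero]
  have h := congrArg (envLeftGrading G) hc
  have hv : envLeftGrading G (1 ⊗ₜ v) = C (1 ⊗ₜ v) := by simp [envLeftGrading, CAlgHom]
  have hu' : envLeftGrading G (u ⊗ₜ 1) = monomial 1 (u ⊗ₜ 1) := by
    simp [envLeftGrading, grading_hom_apply hx hy hu]
  rw [map_mul, map_add, map_zero, hv, hu', mul_add] at h
  by_contra hne
  have h' := congrArg (fun p => p.coeff ((envLeftGrading G c).natDegree + 1)) h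
  simp only [coeff_add, coeff_mul_C, coeff_zero, coeff_mul_monomial] at h'
  rw [coeff_eq_zero_of_natDegree_lt (Nat.lt_succ_self _), zero_mul, add_zero] at h'
  exact hne (leadingCoeff_eq_zero.1 (hinj _ h'))

end EnvGrading

/-! ### Exactness at `P₀` and `P₁` from generators and relations. -/

section LowDegree
variable {A : Type*} [Ring A] [Algebra k A] {x y : A}

/-- Modulo the left ideal `I` one has `a ⊗ 1 = 1 ⊗ a`, by induction on words from `va ⊗ 1 - 1 ⊗ va =
(v ⊗ 1)(a ⊗ 1 - 1 ⊗ a) + (1 ⊗ a)(v ⊗ 1 - 1 ⊗ v)`. So every element is congruent to its product,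
placed on the right. -/
theorem exists_of_mulLeftRight_eq_zero (hgen : Algebra.adjoin k {x, y} = ⊤) {z : Env k A}
    (hz : AlgHom.mulLeftRight k A z 1 = 0) : ∃ a b : Env k A,
      a * (x ⊗ₜ 1 - 1 ⊗ₜ MulOpposite.op x) + b * (y ⊗ₜ 1 - 1 ⊗ₜ MulOpposite.op y) = z := by
  let I : Submodule (Env k A) (Env k A) := Submodule.span _
    {x ⊗ₜ 1 - 1 ⊗ₜ MulOpposite.op x, y ⊗ₜ 1 - 1 ⊗ₜ MulOpposite.op y}
  have h1 : ∀ a : A, (a ⊗ₜ 1 - 1 ⊗ₜ MulOpposite.op a : Env k A) ∈ I := by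
    have step : ∀ v : A, (v ⊗ₜ 1 - 1 ⊗ₜ MulOpposite.op v : Env k A) ∈ I → ∀ a : A,
        (a ⊗ₜ 1 - 1 ⊗ₜ MulOpposite.op a : Env k A) ∈ I →
        ((v * a) ⊗ₜ 1 - 1 ⊗ₜ MulOpposite.op (v * a) : Env k A) ∈ I := by
      intro v hv a ha
      have := add_mem (I.smul_mem (v ⊗ₜ 1) ha) (I.smul_mem (1 ⊗ₜ MulOpposite.op a) hv)
      simpa [mul_sub] using this
    refine left_induction hgen (S := (I.restrictScalars k).comap
      ((Algebra.TensorProduct.includeLeft : A →ₐ[k] Env k A).toLinearMap -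
        (Algebra.TensorProduct.includeRight : Aᵐᵒᵖ →ₐ[k] Env k A).toLinearMap ∘ₗ
          (MulOpposite.opLinearEquiv k : A ≃ₗ[k] Aᵐᵒᵖ).toLinearMap)) ?_
      (step x (Submodule.subset_span (by simp))) (step y (Submodule.subset_span (by simp)))
    simp
  have h2 : ∀ z : Env k A, z - 1 ⊗ₜ MulOpposite.op (AlgHom.mulLeftRight k A z 1) ∈ I := by
    intro z
    induction z using TensorProduct.induction_on with
    | zero => simp
    | add z z' h h' =>
      have := add_mem h h'
      rw [map_add, LinearMap.add_apply, MulOpposite.op_add, TensorProduct.tmul_add]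
      convert this using 1
      abel
    | tmul a b =>
      have := I.smul_mem (1 ⊗ₜ b) (h1 a)
      simpa [mul_sub] using this
  have h3 := h2 z
  rw [hz, MulOpposite.op_zero, TensorProduct.tmul_zero, sub_zero] at h3
  obtain ⟨a, b, h⟩ := Submodule.mem_span_pair.1 h3
  exact ⟨a, b, h⟩

variable {N : Type*} [AddCommGroup N] [Module k N] [Module (Env k A) N]
  [IsScalarTower k (Env k A) N]

/-- The action of `(u, e)` in the square-zero extension of `A` by the bimodule `N` on the extension. -/
def derOp (u : A) (e : N) : Module.End k (A × N) :=
  LinearMap.prod (LinearMap.mulLeft k u ∘ₗ LinearMap.fst k A N)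
    ((LinearMap.toSpanSingleton (Env k A) N e).restrictScalars k ∘ₗ
      (Algebra.TensorProduct.includeRight : Aᵐᵒᵖ →ₐ[k] Env k A).toLinearMap ∘ₗ
      (MulOpposite.opLinearEquiv k : A ≃ₗ[k] Aᵐᵒᵖ).toLinearMap ∘ₗ LinearMap.fst k A N +
      Algebra.lsmul k k N (u ⊗ₜ[k] (1 : Aᵐᵒᵖ) : Env k A) ∘ₗ LinearMap.snd k A N)

theorem derOp_apply (u : A) (e : N) (b : A) (n : N) : derOp (k := k) u e (b, n) =
    (u * b, ((1 : A) ⊗ₜ[k] MulOpposite.op b : Env k A) • e +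
      (u ⊗ₜ[k] (1 : Aᵐᵒᵖ) : Env k A) • n) := rfl

/-- Composition of these operators is the product of the square-zero extension, whose second
component is the Leibniz rule. A derivation on generators can thus be given by operators that
satisfy the relations of `A`, without a ring structure on `A × N`. -/
theorem derOp_mul (u v : A) (e f : N) : derOp (k := k) u e * derOp v f =
    derOp (u * v) (((1 : A) ⊗ₜ[k] MulOpposite.op v : Env k A) • e +
      (u ⊗ₜ[k] (1 : Aᵐᵒᵖ) : Env k A) • f) := by
  refine LinearMap.ext fun ⟨b, n⟩ => ?_
  simp only [Module.End.mul_apply, derOp_apply, smul_add, smul_smul, mul_assoc,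
    Algebra.TensorProduct.tmul_mul_tmul, one_mul, mul_one, MulOpposite.op_mul, add_assoc]

theorem derOp_add (u v : A) (e f : N) : derOp (k := k) u e + derOp v f =
    derOp (u + v) (e + f) := by
  refine LinearMap.ext fun ⟨b, n⟩ => ?_
  simp only [LinearMap.add_apply, derOp_apply, Prod.mk_add_mk, add_mul, smul_add,
    TensorProduct.add_tmul, add_smul]
  congr 1
  abel

theorem derOp_sub (u v : A) (e f : N) : derOp (k := k) u e - derOp v f =
    derOp (u - v) (e - f) := by
  rw [sub_eq_iff_eq_add, derOp_add, sub_add_cancel, sub_add_cancel]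

theorem derOp_smul (c : k) (u : A) (e : N) : c • derOp (k := k) u e = derOp (c • u) (c • e) := by
  refine LinearMap.ext fun ⟨b, n⟩ => ?_
  simp only [LinearMap.smul_apply, derOp_apply, Prod.smul_mk, smul_add, smul_mul_assoc,
    ← TensorProduct.smul_tmul', smul_assoc]
  rw [smul_comm c _ e]

theorem derOp_zero : derOp (k := k) (0 : A) (0 : N) = 0 := by
  refine LinearMap.ext fun ⟨b, n⟩ => ?_
  rw [derOp_apply, TensorProduct.zero_tmul, smul_zero, zero_mul, zero_add]
  exact congrArg (Prod.mk 0) (zero_smul (Env k A) n)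

/-- A derivation from `A` to the bimodule `N` with `x ↦ e` and `y ↦ f`, given here through the action of
`A` on the square-zero extension, recovers `a • e + b • f` from
`a (x ⊗ 1 - 1 ⊗ x) + b (y ⊗ 1 - 1 ⊗ y)`. -/
theorem smul_add_smul_eq_zero (hgen : Algebra.adjoin k {x, y} = ⊤) {e f : N}
    (T : A →ₐ[k] Module.End k (A × N)) (hx : T x = derOp x e) (hy : T y = derOp y f)
    {a b : Env k A} (h : a * (x ⊗ₜ 1 - 1 ⊗ₜ MulOpposite.op x) +
      b * (y ⊗ₜ 1 - 1 ⊗ₜ MulOpposite.op y) = 0) : a • e + b • f = 0 := by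
  -- The derivation is read off by letting `T a` act on the unit `(1, 0)` of the extension.
  let D : A →ₗ[k] N := LinearMap.snd k A N ∘ₗ T.toLinearMap.flip (1, 0)
  have hT : ∀ a, T a = derOp a (D a) := by
    intro a
    have h1 : ∃ d, T a = derOp a d := by
      refine left_induction hgen (S :=
        { carrier := {a | ∃ d, T a = derOp a d}
          zero_mem' := ⟨0, by rw [map_zero, derOp_zero]⟩
          add_mem' := fun {a b} ⟨d, hd⟩ ⟨d', hd'⟩ => ⟨d + d', by rw [map_add, hd, hd', derOp_add]⟩
          smul_mem' := fun c a ⟨d, hd⟩ => ⟨c • d, by rw [map_smul, hd, derOp_smul]⟩ }) ?_ ?_ ?_ a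
      · refine ⟨0, ?_⟩
        rw [map_one]
        refine LinearMap.ext fun ⟨b, n⟩ => ?_
        rw [derOp_apply, smul_zero, one_mul, zero_add, ← Algebra.TensorProduct.one_def, one_smul,
          Module.End.one_apply]
      · rintro a ⟨d, hd⟩
        exact ⟨_, by rw [map_mul, hd, hx, derOp_mul]⟩
      · rintro a ⟨d, hd⟩
        exact ⟨_, by rw [map_mul, hd, hy, derOp_mul]⟩
    obtain ⟨d, hd⟩ := h1
    have : D a = d := by
      change (T a (1, 0)).2 = d
      rw [hd, derOp_apply, smul_zero, MulOpposite.op_one, ← Algebra.TensorProduct.one_def,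
        one_smul, add_zero]
    rw [hd, this]
  have hDmul : ∀ a v, D (a * v) = ((1 : A) ⊗ₜ[k] MulOpposite.op v : Env k A) • D a +
      (a ⊗ₜ[k] (1 : Aᵐᵒᵖ) : Env k A) • D v := by
    intro a v
    have h1 : (T (a * v) (1, 0)).2 = _ := rfl
    change (T (a * v) (1, 0)).2 = _
    rw [map_mul, hT, hT, derOp_mul, derOp_apply, smul_zero, MulOpposite.op_one,
      ← Algebra.TensorProduct.one_def, one_smul, add_zero]
  -- `ρ (a ⊗ b) = D(a) b`; by the Leibniz rule it sends `z (v ⊗ 1 - 1 ⊗ v)` to `z D(v)`.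
  let ρ : Env k A →ₗ[k] N := TensorProduct.lift ((Algebra.lsmul k k N).toLinearMap.flip.compl₁₂ D
    ((Algebra.TensorProduct.includeRight : Aᵐᵒᵖ →ₐ[k] Env k A).toLinearMap))
  have hρ : ∀ (a : A) (b : Aᵐᵒᵖ), ρ (a ⊗ₜ b) = ((1 : A) ⊗ₜ[k] b : Env k A) • D a :=
    fun a b => rfl
  have key : ∀ (v : A) (z : Env k A), ρ (z * (v ⊗ₜ 1 - 1 ⊗ₜ MulOpposite.op v)) = z • D v := by
    intro v z
    induction z using TensorProduct.induction_on with
    | zero => rw [zero_mul, map_zero]; exact (zero_smul (Env k A) (D v)).symm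
    | add z z' h h' => rw [add_mul, map_add, h, h', add_smul]
    | tmul a b =>
      rw [mul_sub, Algebra.TensorProduct.tmul_mul_tmul, Algebra.TensorProduct.tmul_mul_tmul,
        map_sub, hρ, hρ, hDmul, mul_one, mul_one, smul_add, smul_smul, smul_smul,
        Algebra.TensorProduct.tmul_mul_tmul, Algebra.TensorProduct.tmul_mul_tmul, one_mul, one_mul,
        mul_one, add_sub_cancel_left]
  have hDx : D x = e := by
    change (T x (1, 0)).2 = e
    rw [hx, derOp_apply, smul_zero, MulOpposite.op_one, ← Algebra.TensorProduct.one_def,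
      one_smul, add_zero]
  have hDy : D y = f := by
    change (T y (1, 0)).2 = f
    rw [hy, derOp_apply, smul_zero, MulOpposite.op_one, ← Algebra.TensorProduct.one_def,
      one_smul, add_zero]
  have := congrArg ρ h
  rwa [map_add, key, key, map_zero, hDx, hDy] at this

end LowDegree

/-! ### Reducing the axioms of a resolution to its generators. -/

namespace BimoduleComplex
variable {A : Type*} [Ring A] [Algebra k A] {R : BimoduleComplex k A} {σ : A ≃ₐ[k] A}
  {𝒜 : ℤ → Submodule k A}

theorem tMap_smul (n : ℕ) (z : Env k A) (m : R.P n) :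
    R.tMap σ n (z • m) = Env.map σ z • R.tMap σ n m := by
  simp only [tMap, LinearMap.comp_apply, LinearMap.restrictScalars_apply, ← map_smul]
  congr 1
  ext i
  simp

theorem tMap_single (n : ℕ) (i : Fin (R.rank n)) : R.tMap σ n (Pi.single i 1) = R.t n i := by
  have : (LinearMap.pi fun i => (Env.map σ).toLinearMap ∘ₗ LinearMap.proj i :
      R.P n →ₗ[k] R.P n) (Pi.single i 1) = Pi.single i 1 := by
    ext j
    by_cases h : j = i
    · subst h
      simp
    · simp [h]
  simp only [tMap, LinearMap.comp_apply, LinearMap.restrictScalars_apply, this]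
  simp [Fintype.linearCombination_apply_single]

theorem gr_induction {n : ℕ} {N : Type*} [AddCommGroup N] [Module k N] {gr : ℤ → Submodule k N}
    (f : R.P n →ₗ[k] N) (h : ∀ i p q a b, a ∈ 𝒜 p → b ∈ 𝒜 q →
      f (Pi.single i (a ⊗ₜ MulOpposite.op b)) ∈ gr (p + R.deg n i + q)) {s : ℤ} {m : R.P n}
    (hm : m ∈ R.gr 𝒜 n s) : f m ∈ gr s := by
  have : R.gr 𝒜 n s ≤ (gr s).comap f := by
    refine Submodule.span_le.2 ?_
    rintro _ ⟨i, p, q, rfl, a, ha, b, hb, rfl⟩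
    exact h i p q a b ha hb
  exact this hm

theorem smul_mem_gr [SetLike.GradedMonoid 𝒜] {n : ℕ} {p q s : ℤ} {a b : A} {m : R.P n}
    (ha : a ∈ 𝒜 p) (hb : b ∈ 𝒜 q) (hm : m ∈ R.gr 𝒜 n s) :
    (a ⊗ₜ[k] MulOpposite.op b : Env k A) • m ∈ R.gr 𝒜 n (p + s + q) := by
  induction hm using Submodule.span_induction with
  | zero => simp
  | add x y _ _ hx hy => rw [smul_add]; exact add_mem hx hy
  | smul c x _ hx =>
    have : (a ⊗ₜ[k] MulOpposite.op b : Env k A) • c • x =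
        c • (a ⊗ₜ[k] MulOpposite.op b : Env k A) • x := by
      ext i
      exact (LinearMap.mulLeft k (a ⊗ₜ[k] MulOpposite.op b : Env k A)).map_smul c (x i)
    rw [this]
    exact Submodule.smul_mem _ _ hx
  | mem x hx =>
    obtain ⟨i, p', q', hs, a', ha', b', hb', rfl⟩ := hx
    rw [P_single_eq, smul_smul, ← P_single_eq, Algebra.TensorProduct.tmul_mul_tmul,
      ← MulOpposite.op_mul]
    exact Submodule.subset_span ⟨i, p + p', q' + q, by omega, _, SetLike.mul_mem_graded ha ha', _,
      SetLike.mul_mem_graded hb' hb, rfl⟩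

theorem isResolutionYD_of [SetLike.GradedMonoid 𝒜] (hA : IsYetterDrinfeld σ.toLinearEquiv 𝒜)
    (hint : ∀ n, DirectSum.IsInternal (R.gr 𝒜 n))
    (hbij : ∀ n, Function.Bijective (R.tMap σ n))
    (t_gr : ∀ n i, R.t n i ∈ R.gr 𝒜 n (R.deg n i))
    (d_gr : ∀ n i, R.d n i ∈ R.gr 𝒜 n (R.deg (n + 1) i))
    (d_t : ∀ n i, R.dMap n (R.t (n + 1) i) = R.tMap σ n (R.d n i))
    (aug_gr : ∀ i, R.aug i ∈ 𝒜 (R.deg 0 i))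
    (aug_t : ∀ i, R.augMap (R.t 0 i) = σ (R.aug i))
    (aug_surjective : Function.Surjective R.augMap)
    (exact_zero : Function.Exact (R.dMap 0) R.augMap)
    (exact_succ : ∀ n, Function.Exact (R.dMap (n + 1)) (R.dMap n)) :
    R.IsResolutionYD σ 𝒜 (fun n => LinearEquiv.ofBijective (R.tMap σ n) (hbij n)) where
  t_eq n m := rfl
  yd n := by
    have hσ : ∀ p a, a ∈ 𝒜 p → σ a ∈ 𝒜 p := fun p a ha => by
      rw [← hA.map_gr]
      exact ⟨a, ha, rfl⟩
    have ht : ∀ g, ∀ m ∈ R.gr 𝒜 n g, R.tMap σ n m ∈ R.gr 𝒜 n g := fun g m hm =>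
      gr_induction (gr := R.gr 𝒜 n) _ (fun i p q a b ha hb => by
        rw [P_single_eq, tMap_smul, Env.map_tmul, tMap_single]
        exact smul_mem_gr (hσ p a ha) (hσ q b hb) (t_gr n i)) hm
    refine ⟨hint n, fun g => le_antisymm ?_ fun m hm => ?_⟩
    · rintro _ ⟨m, hm, rfl⟩
      exact ht g m hm
    -- A degree preserving section of a bijection is its inverse, so the inverse of `t` preserves
    -- degrees as well.
    · obtain ⟨s, hs, hs'⟩ := exists_graded_section (hint n) (hint n) (R.tMap σ n) ht
      obtain ⟨m', rfl⟩ := (hbij n).2 m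
      exact ⟨_, hs g _ hm, hs' m'⟩
  t_smul n z m := tMap_smul n z m
  gr_smul n _ _ _ _ _ _ ha hb hm := smul_mem_gr ha hb hm
  d_t n m := by
    change R.dMap n (R.tMap σ (n + 1) m) = R.tMap σ n (R.dMap n m)
    rw [R.P_eq_sum m]
    simp only [map_sum, tMap_smul, map_smul, tMap_single, d_t, dMap_single, one_smul]
  d_gr n _ _ hm := gr_induction (gr := R.gr 𝒜 n) ((R.dMap n).restrictScalars k)
    (fun i p q a b ha hb => by
      rw [LinearMap.restrictScalars_apply, dMap_single]
      exact smul_mem_gr ha hb (d_gr n i)) hm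
  aug_t m := by
    change R.augMap (R.tMap σ 0 m) = σ (R.augMap m)
    rw [R.P_eq_sum m]
    simp only [map_sum, tMap_smul, tMap_single, augMap_smul, aug_t, augMap_single]
    refine Finset.sum_congr rfl fun i _ => ?_
    generalize m i = z
    induction z using TensorProduct.induction_on with
    | zero => simp
    | add x y hx hy => simp only [map_add, LinearMap.add_apply, hx, hy]
    | tmul a b => simp [Env.map_tmul]
  aug_gr hm := gr_induction (gr := 𝒜) R.augMap
    (fun i p q a b ha hb => by
      rw [augMap_single, AlgHom.mulLeftRight_apply]
      exact SetLike.mul_mem_graded (SetLike.mul_mem_graded ha (aug_gr i)) hb) hm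
  projective n := inferInstance
  aug_surjective := aug_surjective
  exact_zero := exact_zero
  exact_succ := exact_succ

end BimoduleComplex
end
end HochYD

namespace HochYD
noncomputable section
variable {k : Type*} [Field k]

/-! ### Calculations in free bimodules and criteria for matrices. -/

section El
variable {A : Type*} [Ring A] [Algebra k A] {r : ℕ} (i : Fin r)

theorem el_zero_left (b : A) : el (k := k) 0 i b = 0 := by simp [el]

theorem el_zero_right (a : A) : el (k := k) a i 0 = 0 := by simp [el]

theorem el_add_left (a a' b : A) : el (k := k) (a + a') i b = el a i b + el a' i b := by
  rw [el, TensorProduct.add_tmul]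
  exact (LinearMap.single k (fun _ => Env k A) i).map_add _ _

theorem el_add_right (a b b' : A) : el (k := k) a i (b + b') = el a i b + el a i b' := by
  rw [el, MulOpposite.op_add, TensorProduct.tmul_add]
  exact (LinearMap.single k (fun _ => Env k A) i).map_add _ _

theorem el_neg_left (a b : A) : el (k := k) (-a) i b = -el a i b := by
  rw [el, TensorProduct.neg_tmul]
  exact (LinearMap.single k (fun _ => Env k A) i).map_neg _

theorem el_neg_right (a b : A) : el (k := k) a i (-b) = -el a i b := by
  rw [el, MulOpposite.op_neg, TensorProduct.tmul_neg]
  exact (LinearMap.single k (fun _ => Env k A) i).map_neg _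

theorem el_sub_left (a a' b : A) : el (k := k) (a - a') i b = el a i b - el a' i b := by
  rw [el, TensorProduct.sub_tmul]
  exact (LinearMap.single k (fun _ => Env k A) i).map_sub _ _

theorem el_sub_right (a b b' : A) : el (k := k) a i (b - b') = el a i b - el a i b' := by
  rw [el, MulOpposite.op_sub, TensorProduct.tmul_sub]
  exact (LinearMap.single k (fun _ => Env k A) i).map_sub _ _

theorem el_smul_left (c : k) (a b : A) : el (k := k) (c • a) i b = c • el a i b := by
  rw [el, ← TensorProduct.smul_tmul']
  exact (LinearMap.single k (fun _ => Env k A) i).map_smul _ _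

theorem el_smul_right (c : k) (a b : A) : el (k := k) a i (c • b) = c • el a i b := by
  rw [el, MulOpposite.op_smul, TensorProduct.tmul_smul]
  exact (LinearMap.single k (fun _ => Env k A) i).map_smul _ _

theorem tmul_smul_el (a a' b b' : A) :
    ((a ⊗ₜ[k] MulOpposite.op b : Env k A) • el a' i b' : Fin r → Env k A) =
      el (a * a') i (b' * b) := by
  ext j
  by_cases h : j = i
  · subst h
    simp [el]
  · simp [el, h]

theorem tmul_one_smul_el (a a' b : A) :
    ((a ⊗ₜ[k] (1 : Aᵐᵒᵖ) : Env k A) • el a' i b : Fin r → Env k A) = el (a * a') i b := by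
  have := tmul_smul_el (k := k) i a a' 1 b
  rwa [mul_one] at this

theorem smul_el_one (z : Env k A) : (z • el 1 i 1 : Fin r → Env k A) = Pi.single i z := by
  ext j
  by_cases h : j = i
  · subst h
    simp [el, ← Algebra.TensorProduct.one_def]
  · simp [el, h]

theorem el_apply_self (a b : A) : el (k := k) a i b i = a ⊗ₜ MulOpposite.op b := by
  simp [el]

theorem el_one_apply_self : el (k := k) (1 : A) i 1 i = 1 := el_apply_self i 1 1

theorem el_apply_of_ne {i j : Fin r} (h : i ≠ j) (a b : A) : el (k := k) a i b j = 0 := by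
  simp [el, h.symm]

end El

section Triangular
variable {E : Type*} [Ring E]

theorem linearCombination_bijective_one {v : Fin 1 → Fin 1 → E} (h : v 0 0 = 1) :
    Function.Bijective (Fintype.linearCombination E v) := by
  have : ∀ m, Fintype.linearCombination E v m = m := fun m => by
    ext i
    simp [Fintype.linearCombination_apply, Fin.fin_one_eq_zero i, h]
  exact ⟨fun m m' hm => by rwa [this, this] at hm, fun m => ⟨m, this m⟩⟩

/-- Rows are images of generators, so the matrix acts on row vectors from the right. With unit
diagonal, `m 1` and then `m 0` can be solved for. The actions of `t` in rank 2 have this shape. -/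
theorem linearCombination_bijective_two {v : Fin 2 → Fin 2 → E} {a b : Eˣ} (h₀ : v 0 0 = a)
    (h : v 0 1 = 0) (h₁ : v 1 1 = b) : Function.Bijective (Fintype.linearCombination E v) := by
  have h0 : ∀ m, Fintype.linearCombination E v m 0 = m 0 * a + m 1 * v 1 0 := fun m => by
    simp [Fintype.linearCombination_apply, h₀]
  have h1 : ∀ m, Fintype.linearCombination E v m 1 = m 1 * b := fun m => by
    simp [Fintype.linearCombination_apply, h, h₁]
  constructor
  · rw [injective_iff_map_eq_zero]
    intro m hm
    have e1 : m 1 = 0 := by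
      have := h1 m
      rwa [hm, Pi.zero_apply, eq_comm, Units.mul_left_eq_zero] at this
    have e0 : m 0 = 0 := by
      have := h0 m
      rwa [hm, Pi.zero_apply, e1, zero_mul, add_zero, eq_comm, Units.mul_left_eq_zero] at this
    ext i
    fin_cases i
    exacts [e0, e1]
  · intro m
    refine ⟨![(m 0 - m 1 * ↑b⁻¹ * v 1 0) * ↑a⁻¹, m 1 * ↑b⁻¹], ?_⟩
    ext i
    fin_cases i
    · exact (h0 _).trans (by simp)
    · exact (h1 _).trans (by simp)

end Triangular

theorem Env.map_bijective {A : Type*} [Ring A] [Algebra k A] (σ : A ≃ₐ[k] A) :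
    Function.Bijective (Env.map (k := k) σ) :=
  ⟨Function.LeftInverse.injective (g := Env.map σ.symm) fun z =>
    BimoduleComplex.Env.map_symm σ.symm z,
    fun z => ⟨Env.map σ.symm z, BimoduleComplex.Env.map_symm σ z⟩⟩

section Free
variable {A : Type*} [Ring A] [Algebra k A] {r s : ℕ} {σ : A ≃ₐ[k] A} {𝒜 : ℤ → Submodule k A}

theorem linearCombination_el (v : Fin r → Fin s → Env k A) (a : A) (i : Fin r) (b : A) :
    Fintype.linearCombination (Env k A) v (el a i b) =
      (a ⊗ₜ[k] MulOpposite.op b : Env k A) • v i :=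
  Fintype.linearCombination_apply_single _ _ _ _

/-- The `σ`-semilinear map of free bimodules with given values on generators. -/
def freeMap (σ : A ≃ₐ[k] A) (v : Fin r → Fin s → Env k A) :
    (Fin r → Env k A) →ₗ[k] (Fin s → Env k A) :=
  (Fintype.linearCombination (Env k A) v).restrictScalars k ∘ₗ
    LinearMap.pi fun i => (Env.map σ).toLinearMap ∘ₗ LinearMap.proj i

theorem freeMap_el (v : Fin r → Fin s → Env k A) (a : A) (i : Fin r) (b : A) :
    freeMap σ v (el a i b) = (σ a ⊗ₜ[k] MulOpposite.op (σ b) : Env k A) • v i := by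
  rw [← linearCombination_el]
  refine congrArg (Fintype.linearCombination (Env k A) v) (funext fun j => ?_)
  change Env.map σ (el a i b j) = _
  by_cases h : i = j
  · subst h
    rw [el_apply_self, el_apply_self, Env.map_tmul, MulOpposite.unop_op]
  · rw [el_apply_of_ne h, el_apply_of_ne h, map_zero]

/-- The grading of a free bimodule whose generators have given degrees. -/
def freeGr (deg : Fin r → ℤ) (𝒜 : ℤ → Submodule k A) (s : ℤ) : Submodule k (Fin r → Env k A) :=
  Submodule.span k {m | ∃ i p q, p + deg i + q = s ∧ ∃ a ∈ 𝒜 p, ∃ b ∈ 𝒜 q,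
    m = Pi.single i (a ⊗ₜ[k] MulOpposite.op b)}

theorem el_mem_freeGr {deg : Fin r → ℤ} {p q s : ℤ} {a b : A} (ha : a ∈ 𝒜 p) (hb : b ∈ 𝒜 q)
    (i : Fin r) (h : p + deg i + q = s) : el a i b ∈ freeGr deg 𝒜 s :=
  Submodule.subset_span ⟨i, p, q, h, a, ha, b, hb, rfl⟩

theorem eq_sum_smul_el (m : Fin 2 → Env k A) : m = m 0 • el 1 0 1 + m 1 • el 1 1 1 := by
  rw [smul_el_one, smul_el_one]
  ext i
  fin_cases i <;> simp

variable {x y : A}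

variable (x y) in
/-- The images `v ⊗ 1 - 1 ⊗ v` of the generators `v = x, y` of `A ⊗ V₁ ⊗ A`. -/
def commutatorMatrix : Fin 2 → Fin 1 → Env k A :=
  ![el x 0 1 - el 1 0 x, el y 0 1 - el 1 0 y]

theorem commutatorMatrix_apply (m : Fin 2 → Env k A) :
    Fintype.linearCombination (Env k A) (commutatorMatrix (k := k) x y) m 0 =
      m 0 * (x ⊗ₜ 1 - 1 ⊗ₜ MulOpposite.op x) + m 1 * (y ⊗ₜ 1 - 1 ⊗ₜ MulOpposite.op y) := by
  simp [Fintype.linearCombination_apply, commutatorMatrix, el_apply_self]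

theorem exact_commutatorMatrix (hgen : Algebra.adjoin k {x, y} = ⊤) :
    Function.Exact (Fintype.linearCombination (Env k A) (commutatorMatrix (k := k) x y))
      fun m => AlgHom.mulLeftRight k A (m 0) 1 := by
  intro m
  constructor
  · intro h
    obtain ⟨a, b, h⟩ := exists_of_mulLeftRight_eq_zero hgen h
    refine ⟨![a, b], ?_⟩
    ext i
    rw [Fin.fin_one_eq_zero i, commutatorMatrix_apply]
    exact h
  · rintro ⟨m, rfl⟩
    dsimp only
    rw [commutatorMatrix_apply, map_add, map_mul, map_mul]
    simp

/-- The module is the cokernel of `v`, and `hT` asks for a derivation into it with `x` and `y` going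
to the classes of the two generators. It exists when the rows of `v` are obtained by differentiating
the relations of `A`. Such a derivation carries a cycle `m` to the class of `m`, which must
therefore be zero. -/
theorem exact_linearCombination_commutatorMatrix (hgen : Algebra.adjoin k {x, y} = ⊤)
    (v : Fin r → Fin 2 → Env k A)
    (h : ∀ i, v i 0 * (x ⊗ₜ 1 - 1 ⊗ₜ MulOpposite.op x) +
      v i 1 * (y ⊗ₜ 1 - 1 ⊗ₜ MulOpposite.op y) = 0)
    (hT : ∀ q : (Fin 2 → Env k A) →ₗ[Env k A]
        (Fin 2 → Env k A) ⧸ LinearMap.range (Fintype.linearCombination (Env k A) v),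
      (∀ i, q (v i) = 0) → ∃ T : A →ₐ[k] Module.End k (A ×
        ((Fin 2 → Env k A) ⧸ LinearMap.range (Fintype.linearCombination (Env k A) v))),
        T x = derOp x (q (el 1 0 1)) ∧ T y = derOp y (q (el 1 1 1))) :
    Function.Exact (Fintype.linearCombination (Env k A) v)
      (Fintype.linearCombination (Env k A) (commutatorMatrix (k := k) x y)) := by
  intro m
  constructor
  · intro hm
    obtain ⟨T, hx, hy⟩ := hT (Submodule.mkQ _) fun i =>
      (Submodule.Quotient.mk_eq_zero _).2 ⟨Pi.single i 1, by
        rw [Fintype.linearCombination_apply_single, one_smul]⟩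
    have h0 := congrFun hm 0
    rw [commutatorMatrix_apply] at h0
    have h1 := smul_add_smul_eq_zero hgen T hx hy h0
    rw [← map_smul, ← map_smul, ← map_add, ← eq_sum_smul_el] at h1
    exact (Submodule.Quotient.mk_eq_zero _).1 h1
  · rintro ⟨m, rfl⟩
    rw [Fintype.linearCombination_apply (Env k A) v, map_sum]
    refine Finset.sum_eq_zero fun i _ => ?_
    rw [map_smul]
    refine (congrArg (m i • ·) (?_ : _ = (0 : Fin 1 → Env k A))).trans (smul_zero _)
    ext j
    rw [Fin.fin_one_eq_zero j, commutatorMatrix_apply, h]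
    rfl

end Free

namespace BimoduleComplex
variable {A : Type*} [Ring A] [Algebra k A] {R : BimoduleComplex k A} {σ : A ≃ₐ[k] A}
  {𝒜 : ℤ → Submodule k A}

theorem isMinimal_of {ε : A →ₐ[k] k} (h : ∀ n j i, Env.ε ε (R.d n j i) = 0) : R.IsMinimal ε := by
  intro n m i
  rw [dMap, Fintype.linearCombination_apply, Finset.sum_apply, map_sum]
  exact Finset.sum_eq_zero fun j _ => by rw [Pi.smul_apply, smul_eq_mul, map_mul, h, mul_zero]

theorem tMap_bijective_of {n : ℕ}
    (h : Function.Bijective (Fintype.linearCombination (Env k A) (R.t n))) :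
    Function.Bijective (R.tMap σ n) := by
  refine h.comp (f := fun (m : R.P n) i => Env.map σ (m i)) ⟨fun m m' hm => ?_, fun m => ?_⟩
  · exact funext fun i => (Env.map_bijective σ).1 (congrFun hm i)
  · choose m' hm' using fun i => (Env.map_bijective σ).2 (m i)
    exact ⟨m', funext hm'⟩

end BimoduleComplex
end
end HochYD

namespace HochYD
noncomputable section
variable {k : Type*} [Field k]

/-! ### The Jordan plane: coproduct, normal form and regularity of `x`. -/

namespace JordanPlane

theorem adjoin_eq_top : Algebra.adjoin k {x k, y k} = ⊤ := by
  let S := Algebra.adjoin k {x k, y k}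
  let f : JordanPlane k →ₐ[k] S := lift ⟨x k, Algebra.subset_adjoin (by simp)⟩
    ⟨y k, Algebra.subset_adjoin (by simp)⟩ (Subtype.ext (rel k))
  have hf : S.val.comp f = AlgHom.id k _ := hom_ext (by simp [f]) (by simp [f])
  rw [Algebra.eq_top_iff]
  intro a
  rw [← AlgHom.id_apply (R := k) a, ← hf]
  exact (f a).2

theorem ε_x : ε k (x k) = 0 := by simp [ε]

theorem ε_y : ε k (y k) = 0 := by simp [ε]

theorem t_x : t k (x k) = x k := by simp [t]

theorem t_y : t k (y k) = x k + y k := by simp [t]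

theorem t_symm_x : (t k).symm (x k) = x k := by rw [AlgEquiv.symm_apply_eq, t_x]

theorem t_symm_y : (t k).symm (y k) = y k - x k := by
  rw [AlgEquiv.symm_apply_eq, map_sub, t_x, t_y, add_sub_cancel_left]

theorem y_mul_x : y k * x k = x k * y k - (2⁻¹ : k) • (x k * x k) := by
  rw [eq_sub_iff_add_eq, ← sub_eq_zero, add_sub_right_comm, rel]

theorem x_mem : x k ∈ gr k 1 := left_mem_wordGr

theorem y_mem : y k ∈ gr k 1 := right_mem_wordGr

instance : SetLike.GradedMonoid (gr k) := inferInstanceAs (SetLike.GradedMonoid (wordGr (k := k) (x k) (y k)))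

variable (k) in
/-- The grading of the Jordan plane as a coaction of the polynomial bialgebra. -/
def coaction : JordanPlane k →ₐ[k] Polynomial (JordanPlane k) :=
  lift (Polynomial.monomial 1 (x k)) (Polynomial.monomial 1 (y k)) (by
    rw [Polynomial.monomial_mul_monomial, Polynomial.monomial_mul_monomial,
      Polynomial.monomial_mul_monomial, Polynomial.smul_monomial, ← map_sub, ← map_add, rel,
      map_zero])

theorem coaction_x : coaction k (x k) = Polynomial.monomial 1 (x k) := by simp [coaction]

theorem coaction_y : coaction k (y k) = Polynomial.monomial 1 (y k) := by simp [coaction]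

theorem yd : IsYetterDrinfeld (t k).toLinearEquiv (gr k) :=
  wordGr_yd adjoin_eq_top coaction_x coaction_y _
    (by rw [t_x]; exact x_mem) (by rw [t_y]; exact add_mem x_mem y_mem)
    (by rw [t_symm_x]; exact x_mem) (by rw [t_symm_y]; exact sub_mem y_mem x_mem)

theorem counit_gr {i : ℤ} {a : JordanPlane k} (ha : a ∈ gr k i) (hi : i ≠ 0) : ε k a = 0 :=
  counit_wordGr ε_x ε_y ha hi

/-- The mixed term of the commutator is `-x t(a) ⊗ x b`, because `t y = x + y`. The square of `x`
contributes this term twice with coefficient `1/2`, which is where the characteristic enters. -/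
theorem primMul_rel (h2 : (2 : k) ≠ 0) :
    primMul (t k) (y k) * primMul (t k) (x k) - primMul (t k) (x k) * primMul (t k) (y k) +
      (2⁻¹ : k) • (primMul (t k) (x k) * primMul (t k) (x k)) = 0 := by
  refine TensorProduct.ext' fun a b => ?_
  have h : ∀ c, y k * (x k * c) = x k * (y k * c) - (2⁻¹ : k) • (x k * (x k * c)) := fun c => by
    rw [← mul_assoc, y_mul_x, sub_mul, smul_mul_assoc, mul_assoc, mul_assoc]
  simp only [LinearMap.add_apply, LinearMap.sub_apply, LinearMap.smul_apply, Module.End.mul_apply,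
    primMul_tmul, map_add, map_mul, t_x, t_y, h, add_mul, TensorProduct.add_tmul,
    TensorProduct.sub_tmul, TensorProduct.tmul_sub, ← TensorProduct.smul_tmul',
    TensorProduct.tmul_smul, LinearMap.zero_apply]
  match_scalars <;> field_simp <;> ring

theorem existsUnique_comul (h2 : (2 : k) ≠ 0) :
    ∃! Δ : JordanPlane k →ₗ[k] JordanPlane k ⊗[k] JordanPlane k,
      Δ (x k) = x k ⊗ₜ[k] 1 + 1 ⊗ₜ[k] x k ∧ Δ (y k) = y k ⊗ₜ[k] 1 + 1 ⊗ₜ[k] y k ∧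
        IsBimonoidYD (t k) (gr k) (ε k) Δ :=
  HochYD.existsUnique_comul adjoin_eq_top yd ε_x ε_y (ε_t k)
    (lift (primMul (t k) (x k)) (primMul (t k) (y k)) (primMul_rel h2)) (by simp) (by simp)

section Regular
open Polynomial

/-- This is the rule modelled by `polyRight`: there the outer variable is `x`, the inner one `y`,
and the term with `n / 2` becomes `1/2 x²` times the derivative. -/
theorem x_pow_mul_y (n : ℕ) : x k ^ n * y k = y k * x k ^ n + (n * 2⁻¹ : k) • x k ^ (n + 1) := by
  have h : x k * y k = y k * x k + (2⁻¹ : k) • (x k * x k) := by rw [y_mul_x]; abel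
  induction n with
  | zero => simp
  | succ n ih =>
    rw [pow_succ, mul_assoc, h, mul_add, ← mul_assoc, ih, add_mul, mul_smul_comm, smul_mul_assoc,
      mul_assoc, ← pow_succ, ← pow_succ, ← mul_assoc, ← pow_succ, ← pow_succ, add_assoc, ← add_smul]
    congr 2
    push_cast
    ring

variable (k) in
/-- Right multiplication by `y` in terms of the basis `yⁱ xʲ`. -/
def polyRight : Module.End k k[X][X] :=
  LinearMap.mulLeft k (C X) +
    LinearMap.mulLeft k (C (C 2⁻¹) * X ^ 2) ∘ₗ derivative.restrictScalars k

variable (k) in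
/-- The right regular representation in terms of the basis `yⁱ xʲ`. -/
def polyRep : JordanPlane k →ₐ[k] (Module.End k k[X][X])ᵐᵒᵖ :=
  -- Right multiplications compose in the opposite order, hence the opposite algebra.
  lift (MulOpposite.op (LinearMap.mulLeft k X)) (MulOpposite.op (polyRight k)) (by
    apply MulOpposite.unop_injective
    refine LinearMap.ext fun p => ?_
    have hs : ∀ q : k[X][X], (2⁻¹ : k) • q = C (C 2⁻¹) * q := fun q => by
      rw [← smul_eq_C_mul, ← algebraMap_smul k[X] (2⁻¹ : k) q]; rfl
    simp only [MulOpposite.unop_add, MulOpposite.unop_sub, MulOpposite.unop_smul,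
      MulOpposite.unop_mul, MulOpposite.unop_op, MulOpposite.unop_zero, LinearMap.add_apply,
      LinearMap.sub_apply, LinearMap.smul_apply, Module.End.mul_apply, LinearMap.mulLeft_apply,
      polyRight, LinearMap.comp_apply, LinearMap.restrictScalars_apply, derivative_mul,
      derivative_X, LinearMap.zero_apply, hs]
    ring)

variable (k) in
/-- The linear map `yⁱ xʲ ↦ yⁱ xʲ` from polynomials to the Jordan plane. -/
def ofPoly : k[X][X] →ₗ[k] JordanPlane k :=
  lsum fun n => LinearMap.mulRight k (x k ^ n) ∘ₗ (aeval (y k)).toLinearMap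

theorem ofPoly_monomial (n : ℕ) (c : k[X]) :
    ofPoly k (monomial n c) = aeval (y k) c * x k ^ n := by
  simp [ofPoly, lsum_apply, sum_monomial_index]

theorem ofPoly_X_mul (p : k[X][X]) : ofPoly k (X * p) = ofPoly k p * x k := by
  induction p using Polynomial.induction_on' with
  | add p q hp hq => rw [mul_add, map_add, hp, hq, map_add, add_mul]
  | monomial n c => rw [X_mul_monomial, ofPoly_monomial, ofPoly_monomial, pow_succ, mul_assoc]

theorem ofPoly_polyRight (p : k[X][X]) : ofPoly k (polyRight k p) = ofPoly k p * y k := by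
  induction p using Polynomial.induction_on' with
  | add p q hp hq => rw [map_add, map_add, hp, hq, map_add, add_mul]
  | monomial n c =>
    have h1 : polyRight k (monomial n c) = monomial n (X * c) +
        (n * 2⁻¹ : k) • monomial (n + 1) c := by
      rw [polyRight, LinearMap.add_apply, LinearMap.comp_apply, LinearMap.restrictScalars_apply,
        LinearMap.mulLeft_apply, LinearMap.mulLeft_apply, C_mul_monomial, derivative_monomial,
        ← monomial_one_right_eq_X_pow, C_mul_monomial, monomial_mul_monomial, smul_monomial]
      rcases n with _ | n
      · simp
      · rw [show 2 + (n + 1 - 1) = n + 1 + 1 by omega]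
        congr 2
        rw [smul_eq_C_mul]
        push_cast
        simp
        ring
    have hc : aeval (y k) c * y k = y k * aeval (y k) c := by
      simpa using congrArg (aeval (y k)) (mul_comm c X)
    rw [h1, map_add, map_smul, ofPoly_monomial, ofPoly_monomial, ofPoly_monomial, mul_assoc,
      x_pow_mul_y, mul_add, mul_smul_comm, map_mul, aeval_X, ← mul_assoc (aeval (y k) c), hc]

variable (k) in
/-- The coordinates of an element with respect to the basis `yⁱ xʲ`. -/
def toPoly : JordanPlane k →ₗ[k] k[X][X] :=
  LinearMap.applyₗ (1 : k[X][X]) ∘ₗ (MulOpposite.opLinearEquiv k).symm.toLinearMap ∘ₗ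
    (polyRep k).toLinearMap

theorem toPoly_one : toPoly k 1 = 1 := by
  simp [toPoly]

theorem toPoly_mul_x (a : JordanPlane k) : toPoly k (a * x k) = X * toPoly k a := by
  simp [toPoly, polyRep]

theorem toPoly_mul_y (a : JordanPlane k) : toPoly k (a * y k) = polyRight k (toPoly k a) := by
  simp [toPoly, polyRep]

/-- Only injectivity of `toPoly` is needed, since it transfers regularity from polynomials. -/
theorem ofPoly_toPoly (a : JordanPlane k) : ofPoly k (toPoly k a) = a := by
  refine right_induction adjoin_eq_top
    (S := LinearMap.eqLocus (ofPoly k ∘ₗ toPoly k) LinearMap.id) ?_ (fun a ha => ?_)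
    (fun a ha => ?_) a
  · change ofPoly k (toPoly k 1) = 1
    rw [toPoly_one, ← monomial_zero_one, ofPoly_monomial, map_one, one_mul, pow_zero]
  · change ofPoly k (toPoly k (a * x k)) = a * x k
    rw [toPoly_mul_x, ofPoly_X_mul, show ofPoly k (toPoly k a) = a from ha]
  · change ofPoly k (toPoly k (a * y k)) = a * y k
    rw [toPoly_mul_y, ofPoly_polyRight, show ofPoly k (toPoly k a) = a from ha]

theorem mul_x_eq_zero {a : JordanPlane k} (h : a * x k = 0) : a = 0 := by
  have h1 : X * toPoly k a = 0 := by rw [← toPoly_mul_x, h, map_zero]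
  rw [← ofPoly_toPoly a, (mul_eq_zero.1 h1).resolve_left X_ne_zero, map_zero]

end Regular

end JordanPlane
end
end HochYD

namespace HochYD
noncomputable section
variable {k : Type*} [Field k]

/-! ### The resolution of the Jordan plane. -/

namespace JordanPlane

variable (k) in
/-- The differential `A ⊗ V₂ ⊗ A → A ⊗ V₁ ⊗ A` on generators. -/
def relMatrix : Fin 1 → Fin 2 → Env k (JordanPlane k) :=
  ![el (y k) 0 1 + el 1 1 (x k) - el (x k) 1 1 - el 1 0 (y k)
    + (2⁻¹ : k) • el (x k) 0 1 + (2⁻¹ : k) • el 1 0 (x k)]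

theorem smul_el (c : k) (a b : JordanPlane k) (i : Fin 2) :
    c • (el a i b : Fin 2 → Env k (JordanPlane k)) = el (c • a) i b :=
  (el_smul_left i c a b).symm

theorem isMinimal : (resolution k).IsMinimal (ε k) := by
  refine BimoduleComplex.isMinimal_of fun n => ?_
  match n with
  | 0 =>
    change ∀ (j : Fin 2) (i : Fin 1), _
    simp [Fin.forall_fin_two, resolution, el, Env.ε_tmul, ε_x, ε_y]
  | 1 =>
    change ∀ (j : Fin 1) (i : Fin 2), _
    simp [Fin.forall_fin_two, resolution, el, Env.ε_tmul, ε_x, ε_y]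
  | n + 2 => exact fun j => j.elim0

theorem augMap_apply (m : Fin 1 → Env k (JordanPlane k)) :
    (resolution k).augMap m = AlgHom.mulLeftRight k _ (m 0) 1 := by
  exact LinearMap.congr_fun (Fin.sum_univ_one fun i : Fin 1 =>
    (AlgHom.mulLeftRight k (JordanPlane k)).toLinearMap.flip ((![1] : Fin 1 → _) i) ∘ₗ
      LinearMap.proj (φ := fun _ : Fin 1 => Env k (JordanPlane k)) i) m

/-- The entries of `relMatrix` are what the Leibniz rule gives on the relation. So the operators
`derOp` satisfy the relation as soon as the row is zero in the cokernel. -/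
theorem exact_relMatrix : Function.Exact
    (Fintype.linearCombination (Env k (JordanPlane k)) (relMatrix k))
    (Fintype.linearCombination (Env k (JordanPlane k)) (commutatorMatrix (k := k) (x k) (y k))) := by
  refine exact_linearCombination_commutatorMatrix adjoin_eq_top _ ?_ fun q hq =>
    ⟨lift _ _ ?_, lift_x _ _ _, lift_y _ _ _⟩
  · rw [Fin.forall_fin_one]
    simp only [relMatrix, smul_el]
    simp only [Pi.add_apply, Pi.sub_apply, el_apply_self,
      el_apply_of_ne (show (0 : Fin 2) ≠ 1 by decide),
      el_apply_of_ne (show (1 : Fin 2) ≠ 0 by decide), Matrix.cons_val_zero]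
    simp [mul_sub, add_mul, sub_mul, y_mul_x, TensorProduct.sub_tmul, TensorProduct.tmul_sub,
      ← MulOpposite.op_mul]
    simp only [← TensorProduct.smul_tmul']
    abel
  · have h0 : _ = _ := hq 0
    rw [derOp_mul, derOp_mul, derOp_mul, derOp_smul, derOp_sub, derOp_add, rel, ← derOp_zero]
    congr 1
    rw [← h0]
    simp only [← map_smul, ← map_add, ← map_sub]
    rw [← LinearMap.map_smul_of_tower q (2⁻¹ : k), ← map_add]
    congr 1
    simp only [relMatrix, Matrix.cons_val_zero, smul_el, smul_add, tmul_smul_el, tmul_one_smul_el, one_mul, mul_one]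
    abel

/-- The coordinate at `y` of `d₁` is `-m (x ⊗ 1 - 1 ⊗ x)`, and right multiplication by this factor
is injective since `x` is right regular. -/
theorem linearCombination_relMatrix_injective :
    Function.Injective (Fintype.linearCombination (Env k (JordanPlane k)) (relMatrix k)) := by
  rw [injective_iff_map_eq_zero]
  intro m hm
  have h1 : Fintype.linearCombination (Env k (JordanPlane k)) (relMatrix k) m 1 =
      -(m 0 * (x k ⊗ₜ 1 + 1 ⊗ₜ (-MulOpposite.op (x k)))) := by
    rw [TensorProduct.tmul_neg, ← sub_eq_add_neg, eq_neg_iff_add_eq_zero]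
    simp [Fintype.linearCombination_apply, relMatrix, el, mul_sub]
  rw [hm] at h1
  have := env_right_regular adjoin_eq_top coaction_x coaction_y x_mem (fun a => mul_x_eq_zero) _
    (neg_eq_zero.1 h1.symm)
  ext i
  rw [Fin.fin_one_eq_zero i, this]
  rfl

theorem exact_zero : Function.Exact ((resolution k).dMap 0) (resolution k).augMap := fun m =>
  (iff_of_eq (congrArg (· = 0) (augMap_apply m))).trans
    (exact_commutatorMatrix adjoin_eq_top m)

theorem exact_succ (n : ℕ) :
    Function.Exact ((resolution k).dMap (n + 1)) ((resolution k).dMap n) := by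
  match n with
  | 0 => exact exact_relMatrix
  | 1 =>
    intro m
    refine ⟨fun h => ⟨0, (map_zero _).trans ?_⟩, ?_⟩
    · exact (linearCombination_relMatrix_injective (h.trans (map_zero _).symm)).symm
    · rintro ⟨m, rfl⟩
      rw [show m = 0 from funext fun i => Fin.elim0 (show Fin 0 from i), map_zero, map_zero]
  | n + 2 =>
    intro m
    have hm : m = 0 := funext fun i => Fin.elim0 (show Fin 0 from i)
    exact ⟨fun _ => ⟨0, (map_zero _).trans hm.symm⟩, fun _ => hm ▸ map_zero _⟩

theorem tMap_bijective (n : ℕ) : Function.Bijective ((resolution k).tMap (t k) n) := by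
  refine BimoduleComplex.tMap_bijective_of ?_
  match n with
  | 0 => exact linearCombination_bijective_one (v := ![el 1 0 1]) (el_one_apply_self (0 : Fin 1))
  | 1 =>
    refine linearCombination_bijective_two (v := ![el 1 0 1, el 1 0 1 + el 1 1 1])
      (a := 1) (b := 1) (el_one_apply_self (0 : Fin 2)) (el_apply_of_ne (i := (0 : Fin 2)) (j := 1) (by decide) 1 1) ?_
    simp [el, ← Algebra.TensorProduct.one_def]
  | 2 => exact linearCombination_bijective_one (v := ![el 1 0 1]) (el_one_apply_self (0 : Fin 1))
  | n + 3 => exact ⟨fun a b _ => funext fun i => i.elim0, fun a => ⟨0, funext fun i => i.elim0⟩⟩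

theorem d_t (n : ℕ) (i : Fin ((resolution k).rank (n + 1))) :
    (resolution k).dMap n ((resolution k).t (n + 1) i) =
      (resolution k).tMap (t k) n ((resolution k).d n i) := by
  revert i
  match n with
  | 0 =>
    have : ∀ i : Fin 2, Fintype.linearCombination (Env k (JordanPlane k))
        (commutatorMatrix (k := k) (x k) (y k)) ((![el 1 0 1, el 1 0 1 + el 1 1 1] : Fin 2 → _) i) =
        freeMap (t k) ![el 1 0 1] (commutatorMatrix (x k) (y k) i) := by
      rw [Fin.forall_fin_two]
      simp only [commutatorMatrix, Matrix.cons_val_zero, Matrix.cons_val_one, map_add, map_sub,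
        linearCombination_el, freeMap_el, tmul_smul_el, smul_sub, t_x, t_y, map_one, one_mul,
        mul_one, el_add_left, el_add_right]
      exact ⟨trivial, by abel⟩
    exact this
  | 1 =>
    have : ∀ i : Fin 1, Fintype.linearCombination (Env k (JordanPlane k))
        (relMatrix k) ((![el 1 0 1] : Fin 1 → _) i) =
        freeMap (t k) ![el 1 0 1, el 1 0 1 + el 1 1 1] (relMatrix k i) := by
      rw [Fin.forall_fin_one]
      simp only [relMatrix, smul_el, Matrix.cons_val_zero, Matrix.cons_val_one, map_add, map_sub,
        map_smul, linearCombination_el, freeMap_el, tmul_smul_el, smul_sub, smul_add, smul_el, t_x, t_y, map_one,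
        one_mul, mul_one, el_add_left, el_add_right]
      abel
    exact this
  | n + 2 => exact fun i => i.elim0

theorem t_gr (n : ℕ) (i : Fin ((resolution k).rank n)) :
    (resolution k).t n i ∈ (resolution k).gr (gr k) n ((resolution k).deg n i) := by
  have h1 : (1 : JordanPlane k) ∈ gr k 0 := SetLike.GradedOne.one_mem
  revert i
  match n with
  | 0 =>
    have : ∀ i : Fin 1, (![el 1 0 1] : Fin 1 → _) i ∈ freeGr ![0] (gr k) (![0] i) := by
      rw [Fin.forall_fin_one]
      exact el_mem_freeGr h1 h1 _ (by simp)
    exact this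
  | 1 =>
    have : ∀ i : Fin 2, (![el 1 0 1, el 1 0 1 + el 1 1 1] : Fin 2 → _) i ∈
        freeGr ![1, 1] (gr k) (![1, 1] i) := by
      rw [Fin.forall_fin_two]
      exact ⟨el_mem_freeGr h1 h1 _ (by simp),
        add_mem (el_mem_freeGr h1 h1 _ (by simp)) (el_mem_freeGr h1 h1 _ (by simp))⟩
    exact this
  | 2 =>
    have : ∀ i : Fin 1, (![el 1 0 1] : Fin 1 → _) i ∈ freeGr ![2] (gr k) (![2] i) := by
      rw [Fin.forall_fin_one]
      exact el_mem_freeGr h1 h1 _ (by simp)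
    exact this
  | n + 3 => exact fun i => i.elim0

theorem d_gr (n : ℕ) (i : Fin ((resolution k).rank (n + 1))) :
    (resolution k).d n i ∈ (resolution k).gr (gr k) n ((resolution k).deg (n + 1) i) := by
  have h1 : (1 : JordanPlane k) ∈ gr k 0 := SetLike.GradedOne.one_mem
  revert i
  match n with
  | 0 =>
    have : ∀ i : Fin 2, commutatorMatrix (x k) (y k) i ∈ freeGr ![0] (gr k) (![1, 1] i) := by
      rw [Fin.forall_fin_two]
      exact ⟨sub_mem (el_mem_freeGr x_mem h1 _ (by simp)) (el_mem_freeGr h1 x_mem _ (by simp)),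
        sub_mem (el_mem_freeGr y_mem h1 _ (by simp)) (el_mem_freeGr h1 y_mem _ (by simp))⟩
    exact this
  | 1 =>
    have : ∀ i : Fin 1, relMatrix k i ∈ freeGr ![1, 1] (gr k) (![2] i) := by
      rw [Fin.forall_fin_one]
      have hx : ∀ i, el (x k) i 1 ∈ freeGr ![1, 1] (gr k) 2 := fun i =>
        el_mem_freeGr x_mem h1 i (by fin_cases i <;> rfl)
      have hy : ∀ i, el (y k) i 1 ∈ freeGr ![1, 1] (gr k) 2 := fun i =>
        el_mem_freeGr y_mem h1 i (by fin_cases i <;> rfl)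
      have hx' : ∀ i, el 1 i (x k) ∈ freeGr ![1, 1] (gr k) 2 := fun i =>
        el_mem_freeGr h1 x_mem i (by fin_cases i <;> rfl)
      have hy' : ∀ i, el 1 i (y k) ∈ freeGr ![1, 1] (gr k) 2 := fun i =>
        el_mem_freeGr h1 y_mem i (by fin_cases i <;> rfl)
      exact add_mem (add_mem (sub_mem (sub_mem (add_mem (hy _) (hx' _)) (hx _)) (hy' _))
        (Submodule.smul_mem _ _ (hx _))) (Submodule.smul_mem _ _ (hx' _))
    exact this
  | n + 2 => exact fun i => i.elim0

theorem isResolutionYD : (resolution k).IsResolutionYD (t k) (gr k)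
    fun n => LinearEquiv.ofBijective ((resolution k).tMap (t k) n) (tMap_bijective n) := by
  have h1 : (1 : JordanPlane k) ∈ gr k 0 := SetLike.GradedOne.one_mem
  refine BimoduleComplex.isResolutionYD_of yd
    ((resolution k).gr_internal adjoin_eq_top coaction_x coaction_y) _ t_gr d_gr d_t ?_ ?_ ?_
    exact_zero exact_succ
  · change ∀ i : Fin 1, (![1] : Fin 1 → _) i ∈ gr k (![0] i)
    rw [Fin.forall_fin_one]
    exact h1
  · change ∀ i : Fin 1, (resolution k).augMap
      ((![el 1 0 1] : Fin 1 → Fin 1 → Env k (JordanPlane k)) i) =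
      t k ((![1] : Fin 1 → _) i)
    rw [Fin.forall_fin_one]
    exact (augMap_apply _).trans (by simp [el_apply_self])
  · intro a
    exact ⟨(el a 0 1 : Fin 1 → _), (augMap_apply _).trans (by simp [el_apply_self])⟩

theorem computesHH : HochYD.ComputesHH (ε_t k) isResolutionYD
    (BimoduleComplex.toBar_isComparison (isResolutionYD (k := k))) :=
  BimoduleComplex.computesHH isMinimal counit_gr (ε_t k) isResolutionYD
    (m₀ := (el 1 0 1 : Fin 1 → _))
    (el_mem_freeGr (deg := ![0]) SetLike.GradedOne.one_mem SetLike.GradedOne.one_mem _ (by simp))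
    ((augMap_apply _).trans (by simp [el_apply_self]))

end JordanPlane
end
end HochYD

namespace HochYD
noncomputable section
variable {k : Type*} [Field k]

/-! ### Products with classes of degree 0, and braided commutativity for the Jordan plane. -/

section LowDegreeCochains
variable {A : Type*} [Ring A] [Algebra k A] {ε : A →ₐ[k] k} {σ : A ≃ₐ[k] A}
  {𝒜 : ℤ → Submodule k A}

/-- A `1`-cochain as a linear map. -/
def Cochain.lin (f : Cochain k A 1) : A →ₗ[k] k where
  toFun a := f ![a]
  map_add' a b := congrArg (fun g : Cochain k A 0 => g ![]) (f.curryLeft.map_add a b)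
  map_smul' c a := congrArg (fun g : Cochain k A 0 => g ![]) (f.curryLeft.map_smul c a)

theorem HH_zero_eq_smul (a : HH ε 0) : ∃ c : k, a = c • hhOne ε := by
  induction a using HH_induction with | _ f
  refine ⟨f.1 ![], mk_eq_mk ?_⟩
  ext w
  have : f.1 w = f.1 ![] := congrArg f.1 (Subsingleton.elim _ _)
  simp [this]

theorem hhGr_zero_eq_zero {i : ℤ} (hi : i ≠ 0) {a : HH ε 0} (ha : a ∈ hhGr ε 𝒜 0 i) : a = 0 := by
  obtain ⟨f, hf, rfl⟩ := ha
  refine (mk_eq_mk (g := 0) ?_).trans (map_zero _)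
  ext w
  exact hf ![] w (fun i => i.elim0) (by simpa)

theorem smile_one {n : ℕ} (h : n + 0 = n) (a : HH ε n) : smile ε h a (hhOne ε) = a := by
  induction a using HH_induction with | _ f
  exact mk_eq_mk (one_cup _ f.1)

theorem one_smile {n : ℕ} (h : 0 + n = n) (a : HH ε n) : smile ε h (hhOne ε) a = a := by
  induction a using HH_induction with | _ f
  exact mk_eq_mk (cup_one _ f.1)

theorem hhT_hhOne (hσ : ∀ a, ε (σ a) = ε a) : hhT ε σ hσ 0 (hhOne ε) = hhOne ε :=
  mk_eq_mk (by ext; simp [cochainT])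

theorem hhT_zero (hσ : ∀ a, ε (σ a) = ε a) : hhT ε σ hσ 0 = 1 := by
  ext a
  obtain ⟨c, rfl⟩ := HH_zero_eq_smul a
  rw [map_smul, hhT_hhOne]
  rfl

/-- Braided commutativity holds if it holds for classes of positive degree. -/
theorem comm_of_pos (hσ : ∀ a, ε (σ a) = ε a)
    (H : ∀ {p q n : ℕ} (h : p + 1 + (q + 1) = n) (h' : q + 1 + (p + 1) = n) {i : ℤ}
      {a : HH ε (p + 1)} (b : HH ε (q + 1)), a ∈ hhGr ε 𝒜 (p + 1) i → smile ε h a b =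
        (-1 : k) ^ ((p + 1) * (q + 1)) • smile ε h' ((hhT ε σ hσ (q + 1) ^ i) b) a)
    {p q n : ℕ} (h : p + q = n) (h' : q + p = n) {i : ℤ} {a : HH ε p} (b : HH ε q)
    (ha : a ∈ hhGr ε 𝒜 p i) :
    smile ε h a b = (-1 : k) ^ (p * q) • smile ε h' ((hhT ε σ hσ q ^ i) b) a := by
  match p, q with
  | 0, q =>
    obtain rfl : q = n := by omega
    by_cases hi : i = 0
    · subst hi
      obtain ⟨c, rfl⟩ := HH_zero_eq_smul a
      rw [zpow_zero, map_smul, map_smul, LinearMap.smul_apply, one_smile, zero_mul, pow_zero,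
        one_smul]
      exact congrArg (c • ·) (smile_one _ b).symm
    · rw [hhGr_zero_eq_zero hi ha]
      simp
  | p + 1, 0 =>
    obtain rfl : p + 1 = n := by omega
    obtain ⟨c, rfl⟩ := HH_zero_eq_smul b
    rw [hhT_zero, one_zpow, LinearEquiv.coe_one, id, map_smul, map_smul, LinearMap.smul_apply,
      one_smile, mul_zero, pow_zero, one_smul]
    exact congrArg (c • ·) (smile_one _ a)
  | p + 1, q + 1 => exact H h h' b ha

end LowDegreeCochains

namespace JordanPlane

theorem aug_eq_one (i : Fin ((resolution k).rank 0)) : (resolution k).aug i = 1 := by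
  revert i
  exact (Fin.forall_fin_one (p := fun i => (![1] : Fin 1 → JordanPlane k) i = 1)).2 rfl

theorem barEval_x (f : Cochain k (JordanPlane k) 1) :
    barEval (ε k) 1 f ((resolution k).toBar 1 (Pi.single (0 : Fin 2) 1)) = f.lin (x k) := by
  refine (barEval_toBar_one _ aug_eq_one f _).trans ((Fin.sum_univ_one _).trans ?_)
  refine congrArg f.lin (?_ : Env.left (ε k) (commutatorMatrix (x k) (y k) 0 0) = _)
  simp [commutatorMatrix, el, Env.left_tmul, ε_x]

theorem barEval_y (f : Cochain k (JordanPlane k) 1) :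
    barEval (ε k) 1 f ((resolution k).toBar 1 (Pi.single (1 : Fin 2) 1)) = f.lin (y k) := by
  refine (barEval_toBar_one _ aug_eq_one f _).trans ((Fin.sum_univ_one _).trans ?_)
  refine congrArg f.lin (?_ : Env.left (ε k) (commutatorMatrix (x k) (y k) 1 0) = _)
  simp [commutatorMatrix, el, Env.left_tmul, ε_y]

theorem barEval_cup (f g : Cochain k (JordanPlane k) 1) (h : 1 + 1 = 2) :
    barEval (ε k) 2 (cup h f g) ((resolution k).toBar 2 (Pi.single (0 : Fin 1) 1)) =
      (f.lin (y k) + 2⁻¹ * f.lin (x k)) * g.lin (x k) - f.lin (x k) * g.lin (y k) := by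
  refine (barEval_cup_one _ aug_eq_one h f g _).trans ((Fin.sum_univ_two _).trans ?_)
  rw [sub_eq_add_neg, ← neg_mul]
  refine congrArg₂ (· + ·) (congrArg₂ (· * ·) ?_ (barEval_x g)) (congrArg₂ (· * ·) ?_ (barEval_y g))
  · have : Env.left (ε k) (relMatrix k 0 0) = y k + (2⁻¹ : k) • x k := by
      simp only [relMatrix, smul_el]
      simp [el, Env.left_tmul, ε_x, ε_y]
    refine (congrArg f.lin this).trans ?_
    rw [map_add, map_smul, smul_eq_mul]
  · have : Env.left (ε k) (relMatrix k 0 1) = - x k := by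
      simp only [relMatrix, smul_el]
      simp [el, Env.left_tmul, ε_x]
    exact (congrArg f.lin this).trans (map_neg _ _)

theorem hh_one_eq_zero {i : ℤ} (hi : i ≠ -1) {a : HH (ε k) 1} (ha : a ∈ hhGr (ε k) (gr k) 1 i) :
    a = 0 := by
  refine BimoduleComplex.hhEval_ext isMinimal computesHH fun j => ?_
  rw [BimoduleComplex.hhEval_eq_zero isMinimal counit_gr ha, map_zero]
  · rfl
  · have : (resolution k).deg 1 j = 1 := by
      revert j
      exact (Fin.forall_fin_two (p := fun j => (![1, 1] : Fin 2 → ℤ) j = 1)).2 ⟨rfl, rfl⟩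
    omega

/-- Both sides are read at the single generator `r`. The contribution of `t⁻¹ y = y - x` changes the
coefficient `1/2` of the symmetric term into `-1/2`. -/
theorem smile_hhT (h2 : (2 : k) ≠ 0) (a b : HH (ε k) 1) : smile (ε k) (p := 1) (q := 1) (n := 2) rfl a
    (hhT (ε k) (t k) (ε_t k) 1 b) = -smile (ε k) (p := 1) (q := 1) (n := 2) rfl b a := by
  refine BimoduleComplex.hhEval_ext isMinimal computesHH ?_
  induction a using HH_induction with | _ f
  induction b using HH_induction with | _ g
  refine (Fin.forall_fin_one (p := fun i => _ = _)).2 ?_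
  rw [map_neg]
  refine (barEval_cup (cochainT (t k) 1 g.1) f.1 rfl).trans
    (Eq.trans ?_ (congrArg Neg.neg (barEval_cup f.1 g.1 rfl)).symm)
  have hT : ∀ a, (cochainT (t k) 1 g.1).lin a = g.1.lin ((t k).symm a) := fun a =>
    congrArg g.1 (by ext i; rw [Fin.fin_one_eq_zero i]; rfl)
  rw [hT, hT, t_symm_x, t_symm_y, map_sub]
  have h : (2⁻¹ : k) + 2⁻¹ = 1 := by rw [← two_mul, mul_inv_cancel₀ h2]
  linear_combination (g.1.lin (x k) * f.1.lin (x k)) * h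

theorem isGradedBraidedCommAlgebra (h2 : (2 : k) ≠ 0) : IsGradedBraidedCommAlgebra
    (hhT (ε k) (t k) (ε_t k)) (hhGr (ε k) (gr k)) (hhOne (ε k)) (smile (ε k)) := by
  refine HochYD.isGradedBraidedCommAlgebra (ε_t k)
    (BimoduleComplex.hh_yd isMinimal yd counit_gr (ε_t k) computesHH)
    (comm_of_pos (ε_t k) fun {p q n} h h' {i a} b ha => ?_)
  match p, q with
  | 0, 0 =>
    obtain rfl : 2 = n := h
    by_cases hi : i = -1
    · subst hi
      -- The generators of `P₁` have degree 1, so the braiding involves `t⁻¹`; writing the second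
      -- factor as `t b` removes the inverse.
      obtain ⟨b, rfl⟩ := (hhT (ε k) (t k) (ε_t k) 1).surjective b
      rw [zpow_neg_one]
      refine (smile_hhT h2 a b).trans ?_
      have : (hhT (ε k) (t k) (ε_t k) 1)⁻¹ (hhT (ε k) (t k) (ε_t k) 1 b) = b :=
        LinearEquiv.symm_apply_apply _ _
      rw [this]
      simp
    · rw [hh_one_eq_zero hi ha]
      simp
  | p + 1, q =>
    obtain rfl : p + q + 3 = n := by omega
    exact BimoduleComplex.hhEval_ext isMinimal computesHH fun i => Fin.elim0 (show Fin 0 from i)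
  | 0, q + 1 =>
    obtain rfl : q + 3 = n := by omega
    exact BimoduleComplex.hhEval_ext isMinimal computesHH fun i => Fin.elim0 (show Fin 0 from i)

end JordanPlane
end
end HochYD

namespace HochYD
noncomputable section
variable {k : Type*} [Field k]

/-! ### The super Jordan plane: coproduct, normal form and annihilators. -/

namespace SuperJordanPlane

theorem adjoin_eq_top : Algebra.adjoin k {x k, y k} = ⊤ := by
  let S := Algebra.adjoin k {x k, y k}
  let f : SuperJordanPlane k →ₐ[k] S := lift ⟨x k, Algebra.subset_adjoin (by simp)⟩
    ⟨y k, Algebra.subset_adjoin (by simp)⟩ (Subtype.ext (sq k)) (Subtype.ext (rel k))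
  have hf : S.val.comp f = AlgHom.id k _ := hom_ext (by simp [f]) (by simp [f])
  rw [Algebra.eq_top_iff]
  intro a
  rw [← AlgHom.id_apply (R := k) a, ← hf]
  exact (f a).2

theorem ε_x : ε k (x k) = 0 := by simp [ε]

theorem ε_y : ε k (y k) = 0 := by simp [ε]

theorem t_x : t k (x k) = -x k := by simp [t]

theorem t_y : t k (y k) = x k - y k := by simp [t]

theorem t_symm_x : (t k).symm (x k) = -x k := by rw [AlgEquiv.symm_apply_eq, map_neg, t_x, neg_neg]

theorem t_symm_y : (t k).symm (y k) = -x k - y k := by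
  rw [AlgEquiv.symm_apply_eq, map_sub, map_neg, t_x, t_y]
  abel

theorem x_mul_x_mul (a : SuperJordanPlane k) : x k * (x k * a) = 0 := by
  rw [← mul_assoc, sq, zero_mul]

theorem y_mul_y_mul_x : y k * (y k * x k) = x k * (y k * y k) + x k * (y k * x k) := by
  rw [← sub_eq_zero, ← rel k]
  noncomm_ring

theorem y_mul_y_mul_x_mul (a : SuperJordanPlane k) :
    y k * (y k * (x k * a)) = x k * (y k * (y k * a)) + x k * (y k * (x k * a)) := by
  have := congrArg (· * a) (y_mul_y_mul_x (k := k))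
  simpa only [add_mul, mul_assoc] using this

theorem x_mem : x k ∈ gr k 1 := left_mem_wordGr

theorem y_mem : y k ∈ gr k 1 := right_mem_wordGr

instance : SetLike.GradedMonoid (gr k) :=
  inferInstanceAs (SetLike.GradedMonoid (wordGr (k := k) (x k) (y k)))

variable (k) in
/-- The grading of the super Jordan plane as a coaction of the polynomial bialgebra. -/
def coaction : SuperJordanPlane k →ₐ[k] Polynomial (SuperJordanPlane k) :=
  lift (Polynomial.monomial 1 (x k)) (Polynomial.monomial 1 (y k))
    (by rw [Polynomial.monomial_mul_monomial, sq, map_zero])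
    (by
      simp only [Polynomial.monomial_mul_monomial]
      rw [← map_sub, ← map_sub, rel, map_zero])

theorem coaction_x : coaction k (x k) = Polynomial.monomial 1 (x k) := by simp [coaction]

theorem coaction_y : coaction k (y k) = Polynomial.monomial 1 (y k) := by simp [coaction]

theorem yd : IsYetterDrinfeld (t k).toLinearEquiv (gr k) :=
  wordGr_yd adjoin_eq_top coaction_x coaction_y _
    (by rw [t_x]; exact neg_mem x_mem) (by rw [t_y]; exact sub_mem x_mem y_mem)
    (by rw [t_symm_x]; exact neg_mem x_mem)
    (by rw [t_symm_y]; exact sub_mem (neg_mem x_mem) y_mem)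

theorem counit_gr {i : ℤ} {a : SuperJordanPlane k} (ha : a ∈ gr k i) (hi : i ≠ 0) : ε k a = 0 :=
  counit_wordGr ε_x ε_y ha hi

/-- The mixed terms cancel because `t x = -x`, which needs no assumption on the characteristic. -/
theorem primMul_sq : primMul (t k) (x k) * primMul (t k) (x k) = 0 := by
  refine TensorProduct.ext' fun a b => ?_
  simp only [Module.End.mul_apply, primMul_tmul, map_add, map_mul, t_x, x_mul_x_mul,
    TensorProduct.zero_tmul, TensorProduct.tmul_zero, LinearMap.zero_apply, neg_mul,
    TensorProduct.neg_tmul]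
  abel

theorem primMul_rel :
    primMul (t k) (y k) * primMul (t k) (y k) * primMul (t k) (x k) -
      primMul (t k) (x k) * primMul (t k) (y k) * primMul (t k) (y k) -
      primMul (t k) (x k) * primMul (t k) (y k) * primMul (t k) (x k) = 0 := by
  refine TensorProduct.ext' fun a b => ?_
  simp only [LinearMap.sub_apply, Module.End.mul_apply, primMul_tmul, map_add, map_sub, map_neg,
    map_mul, t_x, t_y, neg_mul, mul_neg, sub_mul, mul_sub, x_mul_x_mul,
    y_mul_y_mul_x_mul, TensorProduct.add_tmul, TensorProduct.sub_tmul,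
    TensorProduct.neg_tmul, TensorProduct.tmul_add,
    TensorProduct.zero_tmul, TensorProduct.tmul_zero, LinearMap.zero_apply]
  abel

theorem existsUnique_comul :
    ∃! Δ : SuperJordanPlane k →ₗ[k] SuperJordanPlane k ⊗[k] SuperJordanPlane k,
      Δ (x k) = x k ⊗ₜ[k] 1 + 1 ⊗ₜ[k] x k ∧ Δ (y k) = y k ⊗ₜ[k] 1 + 1 ⊗ₜ[k] y k ∧
        IsBimonoidYD (t k) (gr k) (ε k) Δ :=
  HochYD.existsUnique_comul adjoin_eq_top yd ε_x ε_y (ε_t k)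
    (lift (primMul (t k) (x k)) (primMul (t k) (y k)) primMul_sq primMul_rel) (by simp) (by simp)

section Regular
open Polynomial

variable (k) in
/-- The element `x y + y x`, which commutes with `x`. -/
def z : SuperJordanPlane k := x k * y k + y k * x k

theorem z_mul_x : z k * x k = x k * z k := by
  rw [z, add_mul, mul_add, x_mul_x_mul, zero_add, mul_assoc, mul_assoc, sq, mul_zero, add_zero]

theorem z_mul_y : z k * y k = y k * z k - z k * x k := by
  rw [z_mul_x]
  simp only [z, add_mul, mul_add, mul_assoc, x_mul_x_mul, y_mul_y_mul_x]
  abel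

/-- With `z x = x z` and `x y = z - y x` this reduces every product to combinations of `yⁱ zʲ` and
`yⁱ zʲ x`. In `polyRightY` the outer variable is `z`, the inner one `y`; the term with `n` is the
derivative, moved to the component of `x`. -/
theorem z_pow_mul_y (n : ℕ) : z k ^ n * y k = y k * z k ^ n - (n : k) • (z k ^ n * x k) := by
  induction n with
  | zero => simp
  | succ n ih =>
    have h : z k ^ n * x k * z k = z k ^ (n + 1) * x k := by
      rw [mul_assoc, ← z_mul_x, ← mul_assoc, ← pow_succ]
    rw [pow_succ, mul_assoc, z_mul_y, mul_sub, ← mul_assoc, ih, sub_mul, smul_mul_assoc, h,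
      ← mul_assoc (z k ^ n) (z k), ← pow_succ, mul_assoc, ← pow_succ, Nat.cast_succ, add_smul,
      one_smul, sub_sub]

variable (k) in
/-- Right multiplication by `x` in terms of the basis `yⁱ zʲ`, `yⁱ zʲ x`. -/
def polyRightX : Module.End k (k[X][X] × k[X][X]) :=
  LinearMap.inr k _ _ ∘ₗ LinearMap.fst k _ _

variable (k) in
/-- Right multiplication by `y` in terms of the basis `yⁱ zʲ`, `yⁱ zʲ x`. -/
def polyRightY : Module.End k (k[X][X] × k[X][X]) :=
  LinearMap.prod
    (LinearMap.mulLeft k (C X) ∘ₗ LinearMap.fst k _ _ + LinearMap.mulLeft k X ∘ₗ LinearMap.snd k _ _)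
    (-(LinearMap.mulLeft k X ∘ₗ derivative.restrictScalars k ∘ₗ LinearMap.fst k _ _) -
      LinearMap.mulLeft k (C X) ∘ₗ LinearMap.snd k _ _)

theorem polyRightX_apply (p q : k[X][X]) : polyRightX k (p, q) = (0, p) := rfl

theorem polyRightY_apply (p q : k[X][X]) : polyRightY k (p, q) =
    (C X * p + X * q, -(X * derivative p) - C X * q) := rfl

variable (k) in
/-- The right regular representation in terms of the basis `yⁱ zʲ`, `yⁱ zʲ x`. -/
def polyRep : SuperJordanPlane k →ₐ[k] (Module.End k (k[X][X] × k[X][X]))ᵐᵒᵖ :=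
  lift (MulOpposite.op (polyRightX k)) (MulOpposite.op (polyRightY k))
    (by
      apply MulOpposite.unop_injective
      exact LinearMap.ext fun ⟨p, q⟩ => rfl)
    (by
      apply MulOpposite.unop_injective
      refine LinearMap.ext fun ⟨p, q⟩ => ?_
      simp only [MulOpposite.unop_sub, MulOpposite.unop_mul, MulOpposite.unop_op,
        MulOpposite.unop_zero, LinearMap.sub_apply, Module.End.mul_apply, polyRightX_apply,
        polyRightY_apply, LinearMap.zero_apply, Prod.mk_sub_mk,
        map_zero, mul_zero]
      refine Prod.ext ?_ ?_
      · simp only [Prod.fst_zero]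
        ring
      · simp only [Prod.snd_zero]
        simp
        ring)

variable (k) in
/-- The linear map `yⁱ zʲ ↦ yⁱ zʲ` from polynomials to the super Jordan plane. -/
def ofPolyLeft : k[X][X] →ₗ[k] SuperJordanPlane k :=
  lsum fun n => LinearMap.mulRight k (z k ^ n) ∘ₗ (aeval (y k)).toLinearMap

theorem ofPolyLeft_monomial (n : ℕ) (c : k[X]) :
    ofPolyLeft k (monomial n c) = aeval (y k) c * z k ^ n := by
  simp [ofPolyLeft, lsum_apply, sum_monomial_index]

theorem ofPolyLeft_X_mul (p : k[X][X]) : ofPolyLeft k (X * p) = ofPolyLeft k p * z k := by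
  induction p using Polynomial.induction_on' with
  | add p q hp hq => rw [mul_add, map_add, hp, hq, map_add, add_mul]
  | monomial n c => rw [X_mul_monomial, ofPolyLeft_monomial, ofPolyLeft_monomial, pow_succ, mul_assoc]

theorem ofPolyLeft_mul_y (p : k[X][X]) : ofPolyLeft k p * y k =
    ofPolyLeft k (C X * p) - ofPolyLeft k (X * derivative p) * x k := by
  induction p using Polynomial.induction_on' with
  | add p q hp hq =>
    rw [map_add, add_mul, hp, hq, mul_add, map_add, map_add, mul_add, map_add, add_mul]
    abel
  | monomial n c =>
    have h1 : X * derivative (monomial n c) = (n : k) • monomial n c := by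
      rw [derivative_monomial, X_mul_monomial, smul_monomial]
      rcases n with _ | n
      · simp
      · rw [show n + 1 - 1 + 1 = n + 1 by omega]
        congr 1
        rw [smul_eq_C_mul]
        push_cast
        simp
        ring
    have hc : aeval (y k) c * y k = y k * aeval (y k) c := by
      simpa using congrArg (aeval (y k)) (mul_comm c X)
    rw [h1, C_mul_monomial, map_smul, ofPolyLeft_monomial, ofPolyLeft_monomial, mul_assoc,
      z_pow_mul_y, mul_sub, mul_smul_comm, map_mul, aeval_X, ← mul_assoc (aeval (y k) c), hc,
      smul_mul_assoc, mul_assoc (aeval (y k) c)]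

variable (k) in
/-- The linear map from pairs of polynomials to the super Jordan plane with respect to the basis
`yⁱ zʲ`, `yⁱ zʲ x`. -/
def ofPoly : k[X][X] × k[X][X] →ₗ[k] SuperJordanPlane k :=
  LinearMap.coprod (ofPolyLeft k) (LinearMap.mulRight k (x k) ∘ₗ ofPolyLeft k)

theorem ofPoly_apply (p q : k[X][X]) :
    ofPoly k (p, q) = ofPolyLeft k p + ofPolyLeft k q * x k := by
  simp [ofPoly]

theorem ofPoly_polyRightX (m : k[X][X] × k[X][X]) :
    ofPoly k (polyRightX k m) = ofPoly k m * x k := by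
  obtain ⟨p, q⟩ := m
  rw [polyRightX_apply, ofPoly_apply, ofPoly_apply, map_zero, zero_add, add_mul, mul_assoc, sq,
    mul_zero, add_zero]

theorem ofPoly_polyRightY (m : k[X][X] × k[X][X]) :
    ofPoly k (polyRightY k m) = ofPoly k m * y k := by
  obtain ⟨p, q⟩ := m
  have h : x k * y k = z k - y k * x k := by rw [z, add_sub_cancel_right]
  rw [polyRightY_apply, ofPoly_apply, ofPoly_apply, add_mul, ofPolyLeft_mul_y, mul_assoc, h,
    mul_sub, ← mul_assoc, ofPolyLeft_mul_y, sub_mul, mul_assoc _ (x k) (x k), sq, mul_zero, sub_zero,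
    map_add, map_sub, map_neg, ofPolyLeft_X_mul q, sub_mul, neg_mul]
  abel

variable (k) in
/-- The coordinates of an element with respect to the basis `yⁱ zʲ`, `yⁱ zʲ x`. -/
def toPoly : SuperJordanPlane k →ₗ[k] k[X][X] × k[X][X] :=
  LinearMap.applyₗ ((1, 0) : k[X][X] × k[X][X]) ∘ₗ
    (MulOpposite.opLinearEquiv k).symm.toLinearMap ∘ₗ (polyRep k).toLinearMap

theorem toPoly_one : toPoly k 1 = (1, 0) := by
  simp [toPoly]

theorem toPoly_mul_x (a : SuperJordanPlane k) : toPoly k (a * x k) = polyRightX k (toPoly k a) := by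
  simp [toPoly, polyRep]

theorem toPoly_mul_y (a : SuperJordanPlane k) : toPoly k (a * y k) = polyRightY k (toPoly k a) := by
  simp [toPoly, polyRep]

theorem ofPoly_toPoly (a : SuperJordanPlane k) : ofPoly k (toPoly k a) = a := by
  refine right_induction adjoin_eq_top
    (S := LinearMap.eqLocus (ofPoly k ∘ₗ toPoly k) LinearMap.id) ?_ (fun a ha => ?_)
    (fun a ha => ?_) a
  · change ofPoly k (toPoly k 1) = 1
    rw [toPoly_one, ofPoly_apply, map_zero, zero_mul, add_zero, ← monomial_zero_one,
      ofPolyLeft_monomial, map_one, one_mul, pow_zero]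
  · change ofPoly k (toPoly k (a * x k)) = a * x k
    rw [toPoly_mul_x, ofPoly_polyRightX, show ofPoly k (toPoly k a) = a from ha]
  · change ofPoly k (toPoly k (a * y k)) = a * y k
    rw [toPoly_mul_y, ofPoly_polyRightY, show ofPoly k (toPoly k a) = a from ha]

variable (k) in
/-- A contracting homotopy for right multiplication by `x`. -/
def divX : SuperJordanPlane k →ₗ[k] SuperJordanPlane k :=
  ofPolyLeft k ∘ₗ LinearMap.snd k _ _ ∘ₗ toPoly k

/-- For `a = p + q x` one has `a x = p x`, so `divX` returns `p` on `a x` and `q` on `a`. In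
particular the elements annihilated by `x` on the right are the multiples of `x`. -/
theorem divX_mul_x_add (a : SuperJordanPlane k) : divX k (a * x k) + divX k a * x k = a := by
  conv_rhs => rw [← ofPoly_toPoly a]
  change ofPolyLeft k (toPoly k (a * x k)).2 + ofPolyLeft k (toPoly k a).2 * x k = _
  rw [toPoly_mul_x]
  exact (ofPoly_apply _ _).symm

/-- Coefficients in the outer variable are compared: the right side in degree `n + 1` contains only
a multiple of the coefficient of `p` in degree `n`, zero by induction. No assumption on the
characteristic is needed. -/
theorem eq_zero_of_mul_eq_mul_derivative {p : k[X][X]} (h : C X * (C X * p) = X * (X * derivative p)) :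
    p = 0 := by
  ext1 n
  rw [coeff_zero]
  induction n with
  | zero =>
    have := congrArg (fun q => coeff q 0) h
    simpa [mul_coeff_zero] using this
  | succ n ih =>
    have := congrArg (fun q => coeff q (n + 1)) h
    simp only [coeff_C_mul, coeff_X_mul] at this
    have h0 : (X * derivative p).coeff n = 0 := by
      rcases n with _ | n
      · simp [mul_coeff_zero]
      · rw [coeff_X_mul, coeff_derivative, ih, zero_mul]
    rw [h0] at this
    simpa using this

/-- For `a = p + q x` the equation reads `y p + z q = 0` and `z p' + y q = 0` in commuting
variables. Eliminating `q` leaves `y² p = z² p'`. -/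
theorem mul_y_eq_zero {a : SuperJordanPlane k} (h : a * y k = 0) : a = 0 := by
  have h1 : polyRightY k (toPoly k a) = 0 := by rw [← toPoly_mul_y, h, map_zero]
  rw [← ofPoly_toPoly a]
  generalize toPoly k a = m at h1
  obtain ⟨p, q⟩ := m
  rw [polyRightY_apply] at h1
  obtain ⟨h3, h4⟩ := Prod.mk_eq_zero.1 h1
  have hp : p = 0 := by
    refine eq_zero_of_mul_eq_mul_derivative ?_
    have e3 := congrArg (C X * ·) h3
    have e4 := congrArg (X * ·) h4
    simp only [mul_zero] at e3 e4
    linear_combination e3 + e4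
  rw [hp, mul_zero, zero_add] at h3
  rw [hp, (mul_eq_zero.1 h3).resolve_left X_ne_zero]
  exact map_zero _

end Regular

end SuperJordanPlane
end
end HochYD

namespace HochYD
noncomputable section
variable {k : Type*} [Field k]

/-! ### The resolution of the super Jordan plane. -/

theorem linearCombination_apply_zero {E : Type*} [Ring E] (v : Fin 2 → Fin 2 → E) (m : Fin 2 → E) :
    Fintype.linearCombination E v m 0 = m 0 * v 0 0 + m 1 * v 1 0 := by
  simp [Fintype.linearCombination_apply]

theorem linearCombination_apply_one {E : Type*} [Ring E] (v : Fin 2 → Fin 2 → E) (m : Fin 2 → E) :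
    Fintype.linearCombination E v m 1 = m 0 * v 0 1 + m 1 * v 1 1 := by
  simp [Fintype.linearCombination_apply]

/-- If `c ξ = c β`, the contraction gives `c = Θ(c ξ) + Θ(c) ξ = Θ(c) (ξ + β)`, so the annihilator
of `ξ - β` consists of the multiples of `ξ + β`, and likewise with the signs exchanged. The
off-diagonal `η` can be moved past `ξ + β`, so the triangular system is solved one coordinate at a
time. The regular factor `κ` covers the exceptional entry of `d₁`. -/
theorem exact_of_square_zero {E : Type*} [Ring E] {v w : Fin 2 → Fin 2 → E} {ξ β η κ : E}
    (Θ : E →+ E) (hξ : ξ * ξ = 0) (hβ : β * β = 0) (hξβ : Commute ξ β) (hη : Commute η (ξ + β))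
    (hΘξ : ∀ c, Θ (c * ξ) + Θ c * ξ = c) (hΘβ : ∀ c, Θ (c * β) = Θ c * β)
    (hκ : ∀ c, c * κ = 0 → c = 0) (v00 : v 0 0 = ξ + β) (v01 : v 0 1 = 0) (v10 : v 1 0 = η)
    (v11 : v 1 1 = -((ξ - β) * κ)) (w00 : w 0 0 = ξ - β) (w01 : w 0 1 = 0) (w10 : w 1 0 = η)
    (w11 : w 1 1 = -(ξ + β)) :
    Function.Exact (Fintype.linearCombination E w) (Fintype.linearCombination E v) := by
  have e1 : (ξ + β) * (ξ - β) = 0 := by rw [← hξβ.mul_self_sub_mul_self_eq, hξ, hβ, sub_zero]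
  have e2 : (ξ - β) * (ξ + β) = 0 := by rw [← hξβ.mul_self_sub_mul_self_eq', hξ, hβ, sub_zero]
  intro m
  constructor
  · intro hm
    have h1 := congrFun hm 1
    have h0 := congrFun hm 0
    rw [linearCombination_apply_one, v01, v11, mul_zero, zero_add, mul_neg, ← mul_assoc,
      Pi.zero_apply, neg_eq_zero] at h1
    rw [linearCombination_apply_zero, v00, v10, Pi.zero_apply] at h0
    have h1 := hκ _ h1
    have h2 : Θ (m 1) * (ξ + β) = m 1 := by
      rw [mul_sub, sub_eq_zero] at h1
      rw [mul_add, ← hΘβ, ← h1, add_comm, hΘξ]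
    -- Once `m 1 = Θ (m 1) (ξ + β)`, the term `m 1 η` becomes a multiple of `ξ + β` and is absorbed
    -- into the first coordinate.
    have h3 : (m 0 + Θ (m 1) * η) * (ξ + β) = 0 := by
      rw [add_mul, mul_assoc _ η, hη.eq, ← mul_assoc, h2, h0]
    have h4 : Θ (m 0 + Θ (m 1) * η) * (ξ - β) = m 0 + Θ (m 1) * η := by
      rw [mul_add] at h3
      rw [mul_sub, ← hΘβ, eq_neg_of_add_eq_zero_right h3, map_neg, sub_neg_eq_add, add_comm, hΘξ]
    refine ⟨![Θ (m 0 + Θ (m 1) * η), -Θ (m 1)], ?_⟩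
    ext i
    revert i
    rw [Fin.forall_fin_two, linearCombination_apply_zero, linearCombination_apply_one, w00, w01,
      w10, w11]
    simp only [Matrix.cons_val_zero, Matrix.cons_val_one]
    constructor
    · rw [h4, neg_mul, add_neg_cancel_right]
    · rw [neg_mul_neg, h2, mul_zero, zero_add]
  · rintro ⟨m, rfl⟩
    ext i
    revert i
    rw [Fin.forall_fin_two, linearCombination_apply_zero, linearCombination_apply_one,
      linearCombination_apply_zero, linearCombination_apply_one, v00, v01, v10, v11, w00, w01,
      w10, w11]
    constructor
    · rw [add_mul, mul_assoc, e2, mul_zero, mul_assoc, hη.eq, zero_add, zero_add,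
        mul_assoc, neg_mul, mul_neg, add_neg_cancel, Pi.zero_apply]
    · rw [linearCombination_apply_one, w01, w11, mul_zero, mul_zero, zero_add, zero_add, mul_assoc,
        neg_mul_neg, ← mul_assoc (ξ + β), e1, zero_mul, mul_zero, Pi.zero_apply]

namespace SuperJordanPlane

section Generic
variable {A : Type*} [Ring A] [Algebra k A] {x y : A}

variable (k x y) in
/-- The differential `A ⊗ V₂ ⊗ A → A ⊗ V₁ ⊗ A` on generators. -/
def relMatrix : Fin 2 → Fin 2 → Env k A :=
  ![el 1 0 x + el x 0 1,
    el (y * y) 0 1 + el y 1 x + el 1 1 (y * x)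
      - el (x * y) 1 1 - el x 1 y - el 1 0 (y * y)
      - el (x * y) 0 1 - el x 1 x - el 1 0 (y * x)]

variable (x y) in
/-- The differential `A ⊗ Vₙ₊₁ ⊗ A → A ⊗ Vₙ ⊗ A` on generators for `n ≥ 2`, where `s = (-1) ^ (n + 1)`. -/
def highMatrix (s : k) : Fin 2 → Fin 2 → Env k A :=
  ![el x 0 1 + el 1 0 (s • x),
    el (y * y) 0 1 + el 1 1 (s • x) - el x 1 1
      - el (x * y) 0 1 - el 1 0 (y * y) - el 1 0 (y * x)]

variable (x y) in
/-- The action on the generators of `A ⊗ Vₙ ⊗ A` for `n ≥ 2`, where `s = (-1) ^ n`. -/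
def highAction (s : k) : Fin 2 → Fin 2 → Env k A :=
  ![el (s • 1) 0 1, -el 1 0 y + el (-s • (x - y)) 0 1 + el (-s • 1) 1 1]

theorem highMatrix_zero_zero (s : k) : highMatrix x y s 0 0 =
    x ⊗ₜ 1 + 1 ⊗ₜ MulOpposite.op (s • x) := by
  simp [highMatrix, el]

theorem highMatrix_zero_one (s : k) : highMatrix x y s 0 1 = 0 := by
  simp [highMatrix, el]

theorem highMatrix_one_zero (s : k) : highMatrix x y s 1 0 =
    (y * y) ⊗ₜ 1 - (x * y) ⊗ₜ 1 - 1 ⊗ₜ MulOpposite.op (y * y) -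
      1 ⊗ₜ MulOpposite.op (y * x) := by
  simp [highMatrix, el]

theorem highMatrix_one_one (s : k) : highMatrix x y s 1 1 =
    1 ⊗ₜ MulOpposite.op (s • x) - x ⊗ₜ 1 := by
  simp [highMatrix, el]

theorem relMatrix_zero_zero : relMatrix k x y 0 0 = highMatrix (k := k) x y 1 0 0 := by
  rw [highMatrix_zero_zero]
  simp [relMatrix, el, add_comm]

theorem relMatrix_zero_one : relMatrix k x y 0 1 = 0 := by
  simp [relMatrix, el]

theorem relMatrix_one_zero : relMatrix k x y 1 0 = highMatrix (k := k) x y 1 1 0 := by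
  rw [highMatrix_one_zero]
  simp [relMatrix, el]
  abel

/-- The only entry in which `d₁` departs from the pattern of the higher differentials with `s = 1`,
and it does so by a right factor. -/
theorem relMatrix_one_one (hsq : x * x = 0) : relMatrix k x y 1 1 = highMatrix (k := k) x y 1 1 1 *
    (y ⊗ₜ 1 + 1 ⊗ₜ (MulOpposite.op y + MulOpposite.op x)) := by
  rw [highMatrix_one_one]
  simp [relMatrix, el, mul_add, sub_mul, TensorProduct.tmul_add, ← MulOpposite.op_mul, hsq]
  abel

variable (D : A →ₗ[k] A)

/-- The map `D` on the left tensor factor. -/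
def envLeftMap : Env k A →ₗ[k] Env k A :=
  TensorProduct.map D LinearMap.id

theorem envLeftMap_mul_add (hD : ∀ a, D (a * x) + D a * x = a) (c : Env k A) :
    envLeftMap D (c * (x ⊗ₜ 1)) + envLeftMap D c * (x ⊗ₜ 1) = c := by
  induction c using TensorProduct.induction_on with
  | zero => simp
  | add c c' h h' =>
    conv_rhs => rw [← h, ← h']
    rw [add_mul, map_add, map_add, add_mul]
    abel
  | tmul a b => simp [envLeftMap, ← TensorProduct.add_tmul, hD]

theorem envLeftMap_mul_right (c : Env k A) (b : Aᵐᵒᵖ) :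
    envLeftMap D (c * (1 ⊗ₜ b)) = envLeftMap D c * (1 ⊗ₜ b) := by
  induction c using TensorProduct.induction_on with
  | zero => simp
  | add c c' h h' => rw [add_mul, map_add, map_add, add_mul, h, h']
  | tmul a b => simp [envLeftMap]

/-- Here `ξ = x ⊗ 1`, `β = 1 ⊗ s x`, and `Θ` applies `D` to the left factor. Passing to the next
differential changes `s` to `-s`, hence exchanges `ξ + β` and `ξ - β`. -/
theorem exact_highMatrix (hsq : x * x = 0)
    (hrel : y * (y * x) = x * (y * y) + x * (y * x)) (hD : ∀ a, D (a * x) + D a * x = a) {s : k}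
    {v w : Fin 2 → Fin 2 → Env k A} {κ : Env k A} (hκ : ∀ c, c * κ = 0 → c = 0)
    (h00 : v 0 0 = highMatrix x y s 0 0) (h01 : v 0 1 = 0) (h10 : v 1 0 = highMatrix x y s 1 0)
    (h11 : v 1 1 = highMatrix x y s 1 1 * κ) (hw : w = highMatrix x y (-s)) :
    Function.Exact (Fintype.linearCombination (Env k A) w)
      (Fintype.linearCombination (Env k A) v) := by
  subst hw
  have hneg : (1 ⊗ₜ MulOpposite.op (-s • x) : Env k A) = -(1 ⊗ₜ MulOpposite.op (s • x)) := by
    rw [neg_smul, MulOpposite.op_neg, TensorProduct.tmul_neg]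
  have hη : (highMatrix x y s 1 0 : Env k A) =
      (y * y - x * y) ⊗ₜ 1 - 1 ⊗ₜ MulOpposite.op (y * y + y * x) := by
    rw [highMatrix_one_zero, TensorProduct.sub_tmul, MulOpposite.op_add, TensorProduct.tmul_add]
    abel
  -- The cubic relation says that `y² - x y` and `y² + y x` commute with `x`; this makes `η` commute
  -- with `ξ + β`.
  have hl : (y * y - x * y) * x = x * (y * y - x * y) := by
    rw [sub_mul, mul_sub, mul_assoc, mul_assoc, hrel, ← mul_assoc x x, hsq, zero_mul]
    abel
  have hr : s • x * (y * y + y * x) = (y * y + y * x) * s • x := by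
    rw [smul_mul_assoc, mul_smul_comm, mul_add, add_mul, mul_assoc, mul_assoc, hsq, mul_zero, hrel,
      add_zero]
  refine exact_of_square_zero (envLeftMap D).toAddMonoidHom
    (ξ := x ⊗ₜ 1) (β := 1 ⊗ₜ MulOpposite.op (s • x)) (η := highMatrix x y s 1 0) (κ := κ) ?_ ?_ ?_ ?_
    (envLeftMap_mul_add D hD) (fun c => envLeftMap_mul_right D c _) hκ
    (h00.trans (highMatrix_zero_zero s)) h01 h10 (h11.trans ?_) ?_ (highMatrix_zero_one _) ?_ ?_
  · rw [Algebra.TensorProduct.tmul_mul_tmul, hsq, TensorProduct.zero_tmul]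
  · rw [Algebra.TensorProduct.tmul_mul_tmul, ← MulOpposite.op_mul, smul_mul_smul_comm, hsq,
      smul_zero, MulOpposite.op_zero, TensorProduct.tmul_zero]
  · rw [Commute, SemiconjBy, Algebra.TensorProduct.tmul_mul_tmul,
      Algebra.TensorProduct.tmul_mul_tmul, one_mul, mul_one, one_mul, mul_one]
  · rw [hη]
    refine Commute.sub_left (Commute.add_right ?_ ?_) (Commute.add_right ?_ ?_) <;>
      rw [Commute, SemiconjBy, Algebra.TensorProduct.tmul_mul_tmul,
        Algebra.TensorProduct.tmul_mul_tmul]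
    · rw [hl]
    · simp only [one_mul, mul_one]
    · simp only [one_mul, mul_one]
    · rw [← MulOpposite.op_mul, ← MulOpposite.op_mul, hr]
  · rw [highMatrix_one_one, sub_mul, sub_mul, neg_sub]
  · rw [highMatrix_zero_zero, hneg]
    exact (sub_eq_add_neg _ _).symm
  · rw [highMatrix_one_zero, highMatrix_one_zero]
  · rw [highMatrix_one_one, hneg]
    exact (neg_add' _ _).symm.trans (congrArg _ (add_comm _ _))

theorem relMatrix_mul_commutator (hsq : x * x = 0)
    (hrel : y * (y * x) = x * (y * y) + x * (y * x)) (i : Fin 2) :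
    relMatrix k x y i 0 * (x ⊗ₜ 1 - 1 ⊗ₜ MulOpposite.op x) +
      relMatrix k x y i 1 * (y ⊗ₜ 1 - 1 ⊗ₜ MulOpposite.op y) = 0 := by
  revert i
  rw [Fin.forall_fin_two]
  constructor
  · simp [relMatrix, el, mul_sub, add_mul, ← MulOpposite.op_mul, hsq]
  · simp [relMatrix, el, mul_sub, add_mul, sub_mul, mul_assoc, hrel, TensorProduct.add_tmul,
      TensorProduct.tmul_add, ← MulOpposite.op_mul]
    abel

theorem linearCombination_commutatorMatrix_action {σ : A ≃ₐ[k] A} (hx : σ x = -x)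
    (hy : σ y = x - y) (i : Fin 2) :
    Fintype.linearCombination (Env k A) (commutatorMatrix x y)
      ((![-el 1 0 1, el 1 0 1 - el 1 1 1] : Fin 2 → Fin 2 → Env k A) i) =
      freeMap σ ![el 1 0 1] (commutatorMatrix x y i) := by
  revert i
  rw [Fin.forall_fin_two]
  simp only [commutatorMatrix, Matrix.cons_val_zero, Matrix.cons_val_one, map_sub, map_neg,
    linearCombination_el, freeMap_el, tmul_smul_el, smul_sub, hx, hy, map_one, one_mul,
    mul_one, el_sub_left, el_sub_right, el_neg_left, el_neg_right]
  exact ⟨by abel, by abel⟩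

theorem linearCombination_relMatrix_action {σ : A ≃ₐ[k] A} (hx : σ x = -x) (hy : σ y = x - y)
    (hsq : x * x = 0) (i : Fin 2) :
    Fintype.linearCombination (Env k A) (relMatrix k x y) (highAction x y (1 : k) i) =
      freeMap σ ![-el 1 0 1, el 1 0 1 - el 1 1 1] (relMatrix k x y i) := by
  revert i
  rw [Fin.forall_fin_two]
  simp only [relMatrix, highAction, Matrix.cons_val_zero, Matrix.cons_val_one, map_sub, map_neg,
    map_add, map_mul, one_smul, neg_smul, linearCombination_el, freeMap_el, tmul_smul_el, smul_sub,
    smul_add, smul_neg, hx, hy, map_one, one_mul, mul_one, sub_mul, mul_sub, neg_mul, mul_neg,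
    ← mul_assoc, el_sub_left, el_sub_right, el_neg_left, el_neg_right, hsq, el_zero_left,
    el_zero_right, mul_zero]
  exact ⟨by abel, by abel⟩

theorem linearCombination_highMatrix_action {σ : A ≃ₐ[k] A} (hx : σ x = -x) (hy : σ y = x - y)
    (hsq : x * x = 0) {s : k} (hs : s = 1 ∨ s = -1) (i : Fin 2) :
    Fintype.linearCombination (Env k A) (highMatrix x y (-s)) (highAction x y (-s) i) =
      freeMap σ (highAction x y s) (highMatrix x y (-s) i) := by
  revert i
  rw [Fin.forall_fin_two]
  rcases hs with rfl | rfl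
  · simp only [highMatrix, highAction, Matrix.cons_val_zero, Matrix.cons_val_one, map_sub, map_neg,
      map_add, map_mul, one_smul, neg_smul, linearCombination_el, freeMap_el, tmul_smul_el,
      smul_sub, smul_add, smul_neg, hx, hy, map_one, one_mul, mul_one, sub_mul, mul_sub, neg_mul,
      mul_neg, ← mul_assoc, el_sub_left, el_sub_right, el_neg_left, el_neg_right, hsq,
      el_zero_left, el_zero_right, mul_zero, neg_neg]
    exact ⟨by abel, by abel⟩
  · simp only [highMatrix, highAction, Matrix.cons_val_zero, Matrix.cons_val_one, map_sub, map_neg,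
      map_add, map_mul, one_smul, neg_smul, linearCombination_el, freeMap_el, tmul_smul_el,
      smul_sub, smul_add, smul_neg, hx, hy, map_one, one_mul, mul_one, sub_mul, mul_sub, neg_mul,
      mul_neg, ← mul_assoc, el_sub_left, el_sub_right, el_neg_left, el_neg_right, hsq,
      el_zero_left, el_zero_right, mul_zero, neg_neg]
    exact ⟨trivial, by abel⟩

end Generic

theorem d_add_two (n : ℕ) : ((resolution k).d (n + 2) : Fin 2 → Fin 2 → _) =
    highMatrix (x k) (y k) ((-1 : k) ^ (n + 3)) := by
  rw [highMatrix]
  simp only [el_smul_right]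
  rfl

theorem t_add_two (n : ℕ) : ((resolution k).t (n + 2) : Fin 2 → Fin 2 → _) =
    highAction (x k) (y k) ((-1 : k) ^ (n + 2)) := by
  have : -(-1 : k) ^ (n + 2) = (-1) ^ (n + 1) := by ring
  rw [highAction, this]
  simp only [el_smul_left]
  rfl

theorem exact_relMatrix : Function.Exact
    (Fintype.linearCombination (Env k (SuperJordanPlane k)) (relMatrix k (x k) (y k)))
    (Fintype.linearCombination (Env k (SuperJordanPlane k))
      (commutatorMatrix (k := k) (x k) (y k))) := by
  refine exact_linearCombination_commutatorMatrix adjoin_eq_top _ ?_ fun q hq =>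
    ⟨lift _ _ ?_ ?_, lift_x _ _ _ _, lift_y _ _ _ _⟩
  · exact relMatrix_mul_commutator (sq k) y_mul_y_mul_x
  · rw [derOp_mul, sq, ← derOp_zero]
    congr 1
    rw [← show q (relMatrix k (x k) (y k) 0) = 0 from hq 0, ← map_smul, ← map_smul, ← map_add]
    congr 1
    simp only [relMatrix, Matrix.cons_val_zero, tmul_smul_el, tmul_one_smul_el, one_mul, mul_one]
  · rw [derOp_mul, derOp_mul, derOp_mul, derOp_mul, derOp_mul, derOp_sub, derOp_sub, rel,
      ← derOp_zero]
    congr 1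
    rw [← show q (relMatrix k (x k) (y k) 1) = 0 from hq 1]
    simp only [← map_smul, ← map_add, ← map_sub]
    congr 1
    simp only [relMatrix, Matrix.cons_val_one, Matrix.cons_val_fin_one, smul_add, tmul_smul_el, tmul_one_smul_el, one_mul,
      mul_one]
    abel

theorem augMap_apply (m : Fin 1 → Env k (SuperJordanPlane k)) :
    (resolution k).augMap m = AlgHom.mulLeftRight k _ (m 0) 1 := by
  exact LinearMap.congr_fun (Fin.sum_univ_one fun i : Fin 1 =>
    (AlgHom.mulLeftRight k (SuperJordanPlane k)).toLinearMap.flip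
      ((![1] : Fin 1 → SuperJordanPlane k) i) ∘ₗ
      LinearMap.proj (φ := fun _ : Fin 1 => Env k (SuperJordanPlane k)) i) m

theorem exact_zero : Function.Exact ((resolution k).dMap 0) (resolution k).augMap := fun m =>
  (iff_of_eq (congrArg (· = 0) (augMap_apply m))).trans
    (exact_commutatorMatrix adjoin_eq_top m)

theorem exact_of_eq_highMatrix {s : k} {v w : Fin 2 → Fin 2 → Env k (SuperJordanPlane k)}
    (hv : v = highMatrix (x k) (y k) s) (hw : w = highMatrix (x k) (y k) (-s)) :
    Function.Exact (Fintype.linearCombination (Env k (SuperJordanPlane k)) w)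
      (Fintype.linearCombination (Env k (SuperJordanPlane k)) v) := by
  subst hv
  exact exact_highMatrix (divX k) (sq k) y_mul_y_mul_x divX_mul_x_add (κ := 1)
    (fun c hc => (mul_one c).symm.trans hc) rfl (highMatrix_zero_one _) rfl (mul_one _).symm hw

/-- The extra factor is `y ⊗ 1` plus a term in the right factor, so its regularity comes from that
of `y`. -/
theorem exact_of_eq_relMatrix {v w : Fin 2 → Fin 2 → Env k (SuperJordanPlane k)}
    (hv : v = relMatrix k (x k) (y k)) (hw : w = highMatrix (x k) (y k) (-1 : k)) :
    Function.Exact (Fintype.linearCombination (Env k (SuperJordanPlane k)) w)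
      (Fintype.linearCombination (Env k (SuperJordanPlane k)) v) := by
  subst hv
  exact exact_highMatrix (divX k) (sq k) y_mul_y_mul_x divX_mul_x_add
    (fun _ => env_right_regular adjoin_eq_top coaction_x coaction_y y_mem
      (fun _ => mul_y_eq_zero) _)
    relMatrix_zero_zero relMatrix_zero_one relMatrix_one_zero (relMatrix_one_one (sq k)) hw

theorem exact_succ (n : ℕ) :
    Function.Exact ((resolution k).dMap (n + 1)) ((resolution k).dMap n) := by
  match n with
  | 0 => exact exact_relMatrix
  | 1 => exact exact_of_eq_relMatrix rfl ((d_add_two 0).trans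
      (congrArg (highMatrix (x k) (y k)) (by norm_num)))
  | n + 2 =>
    exact exact_of_eq_highMatrix (d_add_two n) ((d_add_two (n + 1)).trans
      (congrArg (highMatrix (x k) (y k)) (by rw [pow_succ, mul_neg_one])))

theorem isMinimal : (resolution k).IsMinimal (ε k) := by
  refine BimoduleComplex.isMinimal_of fun n => ?_
  match n with
  | 0 =>
    change ∀ (j : Fin 2) (i : Fin 1), _
    simp [Fin.forall_fin_two, resolution, el, Env.ε_tmul, ε_x, ε_y]
  | 1 =>
    have : ∀ j i : Fin 2, Env.ε (ε k) (relMatrix k (x k) (y k) j i) = 0 := by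
      simp [Fin.forall_fin_two, relMatrix, el, Env.ε_tmul, ε_x, ε_y]
    exact this
  | n + 2 =>
    have : ∀ j i : Fin 2, Env.ε (ε k) (highMatrix (x k) (y k) ((-1 : k) ^ (n + 3)) j i) = 0 := by
      simp [Fin.forall_fin_two, highMatrix_zero_zero, highMatrix_zero_one, highMatrix_one_zero,
        highMatrix_one_one, Env.ε_tmul, ε_x, ε_y]
    exact fun j i => (congrArg (Env.ε (ε k)) (congrFun (congrFun (d_add_two n) j) i)).trans
      (this j i)

theorem tMap_bijective (n : ℕ) : Function.Bijective ((resolution k).tMap (t k) n) := by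
  refine BimoduleComplex.tMap_bijective_of ?_
  match n with
  | 0 => exact linearCombination_bijective_one (v := ![el 1 0 1]) (el_one_apply_self (0 : Fin 1))
  | 1 =>
    refine linearCombination_bijective_two (v := ![-el 1 0 1, el 1 0 1 - el 1 1 1])
      (a := -1) (b := -1) ?_ ?_ ?_ <;> simp [el, ← Algebra.TensorProduct.one_def]
  | n + 2 =>
    have key : ∀ s : k, s = 1 ∨ s = -1 → Function.Bijective
        (Fintype.linearCombination (Env k (SuperJordanPlane k)) (highAction (x k) (y k) s)) := by
      rintro _ (rfl | rfl)
      · refine linearCombination_bijective_two (a := 1) (b := -1) ?_ ?_ ?_ <;>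
          simp [highAction, el, ← Algebra.TensorProduct.one_def, TensorProduct.neg_tmul]
      · refine linearCombination_bijective_two (a := -1) (b := 1) ?_ ?_ ?_ <;>
          simp [highAction, el, ← Algebra.TensorProduct.one_def, TensorProduct.neg_tmul]
    have := key _ (neg_one_pow_eq_or k (n + 2))
    rw [← t_add_two] at this
    exact this

theorem linearCombination_action_of_eq {s : k} (hs : s = 1 ∨ s = -1)
    {v t₀ t₁ : Fin 2 → Fin 2 → Env k (SuperJordanPlane k)} (hv : v = highMatrix (x k) (y k) (-s))
    (h₀ : t₀ = highAction (x k) (y k) s) (h₁ : t₁ = highAction (x k) (y k) (-s)) (i : Fin 2) :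
    Fintype.linearCombination (Env k (SuperJordanPlane k)) v (t₁ i) =
      freeMap (t k) t₀ (v i) := by
  subst hv h₀ h₁
  exact linearCombination_highMatrix_action t_x t_y (sq k) hs i

theorem d_t (n : ℕ) (i : Fin ((resolution k).rank (n + 1))) :
    (resolution k).dMap n ((resolution k).t (n + 1) i) =
      (resolution k).tMap (t k) n ((resolution k).d n i) := by
  revert i
  have hneg (n : ℕ) : (-1 : k) ^ (n + 3) = -(-1) ^ (n + 2) := by rw [pow_succ _ (n + 2), mul_neg_one]
  match n with
  | 0 => exact linearCombination_commutatorMatrix_action t_x t_y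
  | 1 =>
    have h := linearCombination_relMatrix_action (k := k) t_x t_y (sq k)
    rw [show highAction (x k) (y k) (1 : k) = highAction (x k) (y k) ((-1) ^ (0 + 2)) by norm_num,
      ← t_add_two] at h
    exact h
  | n + 2 =>
    exact linearCombination_action_of_eq (neg_one_pow_eq_or k (n + 2))
      ((d_add_two n).trans (congrArg (highMatrix (x k) (y k)) (hneg n))) (t_add_two n)
      ((t_add_two (n + 1)).trans (congrArg (highAction (x k) (y k)) (hneg n)))

theorem t_gr (n : ℕ) (i : Fin ((resolution k).rank n)) :
    (resolution k).t n i ∈ (resolution k).gr (gr k) n ((resolution k).deg n i) := by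
  have h1 : (1 : SuperJordanPlane k) ∈ gr k 0 := SetLike.GradedOne.one_mem
  revert i
  match n with
  | 0 =>
    have : ∀ i : Fin 1, (![el 1 0 1] : Fin 1 → _) i ∈ freeGr ![0] (gr k) (![0] i) := by
      rw [Fin.forall_fin_one]
      exact el_mem_freeGr h1 h1 _ (by simp)
    exact this
  | 1 =>
    have : ∀ i : Fin 2, (![-el 1 0 1, el 1 0 1 - el 1 1 1] : Fin 2 → _) i ∈
        freeGr ![1, 1] (gr k) (![1, 1] i) := by
      rw [Fin.forall_fin_two]
      exact ⟨neg_mem (el_mem_freeGr h1 h1 _ (by simp)),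
        sub_mem (el_mem_freeGr h1 h1 _ (by simp)) (el_mem_freeGr h1 h1 _ (by simp))⟩
    exact this
  | n + 2 =>
    have : ∀ i : Fin 2, highAction (x k) (y k) ((-1 : k) ^ (n + 2)) i ∈
        freeGr ![(n : ℤ) + 2, (n : ℤ) + 3] (gr k) (![(n : ℤ) + 2, (n : ℤ) + 3] i) := by
      rw [Fin.forall_fin_two]
      refine ⟨el_mem_freeGr (Submodule.smul_mem _ _ h1) h1 _ (by simp),
        add_mem (add_mem (neg_mem (el_mem_freeGr h1 y_mem _ ?_)) (el_mem_freeGr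
          (Submodule.smul_mem _ _ (sub_mem x_mem y_mem)) h1 _ ?_))
          (el_mem_freeGr (Submodule.smul_mem _ _ h1) h1 _ ?_)⟩ <;>
      simp <;> omega
    rw [← t_add_two] at this
    exact this

theorem mul_mem_gr_two {a b : SuperJordanPlane k} (ha : a ∈ gr k 1) (hb : b ∈ gr k 1) :
    a * b ∈ gr k 2 := by
  have := SetLike.mul_mem_graded (A := gr k) ha hb
  rwa [one_add_one_eq_two] at this

theorem commutatorMatrix_mem (i : Fin 2) :
    commutatorMatrix (x k) (y k) i ∈ freeGr ![0] (gr k) ((![1, 1] : Fin 2 → ℤ) i) := by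
  have h1 : (1 : SuperJordanPlane k) ∈ gr k 0 := SetLike.GradedOne.one_mem
  revert i
  rw [Fin.forall_fin_two]
  exact ⟨sub_mem (el_mem_freeGr x_mem h1 _ (by simp)) (el_mem_freeGr h1 x_mem _ (by simp)),
    sub_mem (el_mem_freeGr y_mem h1 _ (by simp)) (el_mem_freeGr h1 y_mem _ (by simp))⟩

theorem relMatrix_mem (i : Fin 2) :
    relMatrix k (x k) (y k) i ∈ freeGr ![1, 1] (gr k) ((![2, 3] : Fin 2 → ℤ) i) := by
  have h1 : (1 : SuperJordanPlane k) ∈ gr k 0 := SetLike.GradedOne.one_mem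
  revert i
  rw [Fin.forall_fin_two]
  have h3 : ∀ {a b : SuperJordanPlane k} (i : Fin 2) {p q : ℤ}, a ∈ gr k p → b ∈ gr k q →
      p + q = 2 → el a i b ∈ freeGr ![1, 1] (gr k) 3 := fun {a b} i {p q} ha hb h => by
    refine el_mem_freeGr ha hb i ?_
    revert i
    rw [Fin.forall_fin_two]
    exact ⟨show p + 1 + q = 3 by omega, show p + 1 + q = 3 by omega⟩
  have hx : x k * y k ∈ gr k 2 := mul_mem_gr_two x_mem y_mem
  have hy : y k * y k ∈ gr k 2 := mul_mem_gr_two y_mem y_mem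
  have hz : y k * x k ∈ gr k 2 := mul_mem_gr_two y_mem x_mem
  exact ⟨add_mem (el_mem_freeGr h1 x_mem _ rfl) (el_mem_freeGr x_mem h1 _ rfl),
    sub_mem (sub_mem (sub_mem (sub_mem (sub_mem (sub_mem (add_mem (add_mem
      (h3 _ hy h1 rfl) (h3 _ y_mem x_mem rfl)) (h3 _ h1 hz rfl)) (h3 _ hx h1 rfl))
      (h3 _ x_mem y_mem rfl)) (h3 _ h1 hy rfl)) (h3 _ hx h1 rfl)) (h3 _ x_mem x_mem rfl))
      (h3 _ h1 hz rfl)⟩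

theorem highMatrix_mem {s : k} {v : Fin 2 → Fin 2 → Env k (SuperJordanPlane k)}
    (hv : v = highMatrix (x k) (y k) s) {d e e' : ℤ} (h : e = d + 1) (h' : e' = d + 2) (i : Fin 2) :
    v i ∈ freeGr ![d, e] (gr k) ((![e, e'] : Fin 2 → ℤ) i) := by
  subst hv
  have h1 : (1 : SuperJordanPlane k) ∈ gr k 0 := SetLike.GradedOne.one_mem
  revert i
  rw [Fin.forall_fin_two]
  have h0 : ∀ {a b : SuperJordanPlane k} {p q : ℤ}, a ∈ gr k p → b ∈ gr k q →
      p + q = 2 → el a 0 b ∈ freeGr ![d, e] (gr k) e' := fun {a b} {p q} ha hb hpq =>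
    el_mem_freeGr ha hb _ (show p + d + q = e' by omega)
  have hx : x k * y k ∈ gr k 2 := mul_mem_gr_two x_mem y_mem
  have hy : y k * y k ∈ gr k 2 := mul_mem_gr_two y_mem y_mem
  have hz : y k * x k ∈ gr k 2 := mul_mem_gr_two y_mem x_mem
  have hs : s • x k ∈ gr k 1 := Submodule.smul_mem _ _ x_mem
  exact ⟨add_mem (el_mem_freeGr x_mem h1 _ (show 1 + d + 0 = e by omega))
      (el_mem_freeGr h1 hs _ (show 0 + d + 1 = e by omega)),
    sub_mem (sub_mem (sub_mem (sub_mem (add_mem (h0 hy h1 rfl)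
      (el_mem_freeGr h1 hs _ (show 0 + e + 1 = e' by omega)))
      (el_mem_freeGr x_mem h1 _ (show 1 + e + 0 = e' by omega))) (h0 hx h1 rfl)) (h0 h1 hy rfl))
      (h0 h1 hz rfl)⟩

theorem d_gr (n : ℕ) (i : Fin ((resolution k).rank (n + 1))) :
    (resolution k).d n i ∈ (resolution k).gr (gr k) n ((resolution k).deg (n + 1) i) := by
  revert i
  match n with
  | 0 => exact commutatorMatrix_mem
  | 1 => exact relMatrix_mem
  | n + 2 =>
    exact highMatrix_mem (d_add_two n) (by ring) (by push_cast; ring)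

theorem isResolutionYD : (resolution k).IsResolutionYD (t k) (gr k)
    fun n => LinearEquiv.ofBijective ((resolution k).tMap (t k) n) (tMap_bijective n) := by
  have h1 : (1 : SuperJordanPlane k) ∈ gr k 0 := SetLike.GradedOne.one_mem
  refine BimoduleComplex.isResolutionYD_of yd
    ((resolution k).gr_internal adjoin_eq_top coaction_x coaction_y) _ t_gr d_gr d_t ?_ ?_ ?_
    exact_zero exact_succ
  · change ∀ i : Fin 1, (![1] : Fin 1 → _) i ∈ gr k (![0] i)
    rw [Fin.forall_fin_one]
    exact h1
  · change ∀ i : Fin 1, (resolution k).augMap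
      ((![el 1 0 1] : Fin 1 → Fin 1 → Env k (SuperJordanPlane k)) i) =
      t k ((![1] : Fin 1 → _) i)
    rw [Fin.forall_fin_one]
    exact (augMap_apply _).trans (by simp [el_apply_self])
  · intro a
    exact ⟨(el a 0 1 : Fin 1 → _), (augMap_apply _).trans (by simp [el_apply_self])⟩

theorem computesHH : HochYD.ComputesHH (ε_t k) isResolutionYD
    (BimoduleComplex.toBar_isComparison (isResolutionYD (k := k))) :=
  BimoduleComplex.computesHH isMinimal counit_gr (ε_t k) isResolutionYD
    (m₀ := (el 1 0 1 : Fin 1 → _))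
    (el_mem_freeGr (deg := ![0]) SetLike.GradedOne.one_mem SetLike.GradedOne.one_mem _ (by simp))
    ((augMap_apply _).trans (by simp [el_apply_self]))

end SuperJordanPlane
end
end HochYD

namespace HochYD
noncomputable section
variable {k : Type*} [Field k]

/-! ### Braided commutativity for the super Jordan plane. -/

section LowDegreeCocycles
variable {A : Type*} [Ring A] [Algebra k A] {ε : A →ₐ[k] k} {σ : A ≃ₐ[k] A}

/-- A cocycle of degree 1 is a derivation to the trivial bimodule, so it kills products of elements
of the augmentation ideal. -/
theorem Cochain.lin_mul {f : Cochain k A 1} (hf : cochainD ε 1 f = 0) {a b : A} (ha : ε a = 0)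
    (hb : ε b = 0) : f.lin (a * b) = 0 := by
  have h := congrArg (fun g : Cochain k A 2 => g ![a, b]) hf
  simp only [cochainD_apply, Fin.sum_univ_one] at h
  have h' : (Fin.contractNth (0 : Fin 1).castSucc (· * ·) ![a, b] : Fin 1 → A) = ![a * b] := by
    ext i
    rw [Fin.fin_one_eq_zero i]
    rfl
  rw [h'] at h
  change ε a * _ + _ + _ * (ε b * _) = 0 at h
  rw [ha, hb] at h
  have : f ![a * b] = 0 := by simpa using h
  exact this

/-- A `2`-cochain as a bilinear map. -/
def Cochain.bilin (f : Cochain k A 2) : A →ₗ[k] A →ₗ[k] k :=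
  LinearMap.mk₂ k (fun a b => f ![a, b])
    (fun a a' b => congrArg (fun g : Cochain k A 1 => g ![b]) (f.curryLeft.map_add a a'))
    (fun c a b => congrArg (fun g : Cochain k A 1 => g ![b]) (f.curryLeft.map_smul c a))
    (fun a b b' => (Cochain.lin (k := k) (A := A) (f.curryLeft a)).map_add b b')
    (fun c a b => (Cochain.lin (k := k) (A := A) (f.curryLeft a)).map_smul c b)

/-- On the augmentation ideal the outer terms of the cocycle condition vanish, and what remains is
that the form is balanced. -/
theorem Cochain.bilin_mul {f : Cochain k A 2} (hf : cochainD ε 2 f = 0) {a b c : A} (ha : ε a = 0)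
    (hc : ε c = 0) : f.bilin (a * b) c = f.bilin a (b * c) := by
  have h := congrArg (fun g : Cochain k A 3 => g ![a, b, c]) hf
  simp only [cochainD_apply, Fin.sum_univ_two] at h
  have h0 : (Fin.contractNth (0 : Fin 2).castSucc (· * ·) ![a, b, c] : Fin 2 → A) =
      ![a * b, c] := by
    ext i
    revert i
    rw [Fin.forall_fin_two]
    exact ⟨rfl, rfl⟩
  have h1 : (Fin.contractNth (1 : Fin 2).castSucc (· * ·) ![a, b, c] : Fin 2 → A) =
      ![a, b * c] := by
    ext i
    revert i
    rw [Fin.forall_fin_two]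
    exact ⟨rfl, rfl⟩
  rw [h0, h1] at h
  change ε a * _ + _ + _ * (ε c * _) = 0 at h
  rw [ha, hc, Fin.val_zero, Fin.val_one] at h
  change f ![a * b, c] = f ![a, b * c]
  linear_combination -h

theorem hhT_zpow_eigen {n : ℕ} {hσ : ∀ a, ε (σ a) = ε a} {φ : HH ε n → k} {c : k} (hc : c * c = 1)
    (h : ∀ b, φ (hhT ε σ hσ n b) = c * φ b) (i : ℤ) (b : HH ε n) :
    φ ((hhT ε σ hσ n ^ i) b) = c ^ i * φ b := by
  have hc0 : c ≠ 0 := left_ne_zero_of_mul_eq_one hc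
  induction i with
  | zero => simp
  | succ i ih =>
    rw [add_comm (i : ℤ) 1, zpow_add, zpow_add₀ hc0, zpow_one, zpow_one, mul_assoc, ← ih]
    exact h _
  | pred i ih =>
    rw [sub_eq_add_neg, add_comm (-(i : ℤ)) (-1), zpow_add, zpow_add₀ hc0, zpow_neg_one, zpow_neg_one, mul_assoc,
      ← ih]
    set b' := (hhT ε σ hσ n ^ (-(i : ℤ))) b
    have h' := h ((hhT ε σ hσ n)⁻¹ b')
    rw [show hhT ε σ hσ n ((hhT ε σ hσ n)⁻¹ b') = b' from LinearEquiv.apply_symm_apply _ _] at h'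
    rw [h', ← mul_assoc, inv_mul_cancel₀ hc0, one_mul]
    rfl

theorem smile_smile {p q r l m n : ℕ} (hl : p + q = l) (hm : q + r = m) (hln : l + r = n)
    (hmn : p + m = n) (a : HH ε p) (b : HH ε q) (c : HH ε r) :
    smile ε hln (smile ε hl a b) c = smile ε hmn a (smile ε hm b c) := by
  induction a using HH_induction with | _ f
  induction b using HH_induction with | _ g
  induction c using HH_induction with | _ h
  simp only [smile_mk]
  exact mk_eq_mk (cup_assoc _ _ _ _ _ _ _).symm

end LowDegreeCocycles

theorem BimoduleComplex.exists_hom {A : Type*} [Ring A] [Algebra k A] {ε : A →ₐ[k] k}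
    {R : BimoduleComplex k A} {n : ℕ} (c : Fin (R.rank n) → k) :
    ∃ f : R.Hom ε n, ∀ i, f.1 (Pi.single i 1) = c i := by
  refine ⟨⟨∑ i, c i • ((Env.ε ε).toLinearMap ∘ₗ LinearMap.proj i), fun z m => ?_⟩, fun i => ?_⟩
  · simp [LinearMap.sum_apply, Finset.mul_sum, mul_left_comm]
  · simp only [LinearMap.sum_apply]
    rw [Finset.sum_eq_single i]
    · simp
    · intro j _ hj
      simp [hj]
    · simp

namespace SuperJordanPlane

theorem aug_eq_one (i : Fin ((resolution k).rank 0)) : (resolution k).aug i = 1 := by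
  revert i
  exact (Fin.forall_fin_one (p := fun i => (![1] : Fin 1 → SuperJordanPlane k) i = 1)).2 rfl

theorem left_commutatorMatrix (i : Fin 2) :
    Env.left (ε k) (commutatorMatrix (x k) (y k) i 0) = ![x k, y k] i := by
  revert i
  rw [Fin.forall_fin_two]
  constructor <;> simp [commutatorMatrix, el, Env.left_tmul, ε_x, ε_y]

theorem left_relMatrix (i j : Fin 2) : Env.left (ε k) (relMatrix k (x k) (y k) i j) =
    ![![x k, 0], ![y k * y k - x k * y k, -(x k * y k)]] i j := by
  revert i j
  simp only [Fin.forall_fin_two]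
  refine ⟨⟨?_, ?_⟩, ?_, ?_⟩ <;> simp [relMatrix, el, Env.left_tmul, ε_x, ε_y]

theorem left_highMatrix (s : k) (i j : Fin 2) : Env.left (ε k) (highMatrix (x k) (y k) s i j) =
    ![![x k, 0], ![y k * y k - x k * y k, -x k]] i j := by
  revert i j
  simp only [Fin.forall_fin_two]
  refine ⟨⟨?_, ?_⟩, ?_, ?_⟩ <;> simp [highMatrix, el, Env.left_tmul, ε_x, ε_y]

variable (k) in
/-- The matrix of the differential in positive degrees. -/
def dMat (n : ℕ) : Fin 2 → Fin 2 → Env k (SuperJordanPlane k) := (resolution k).d (n + 1)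

theorem left_dMat_zero (i j : Fin 2) : Env.left (ε k) (dMat k 0 i j) =
    ![![x k, 0], ![y k * y k - x k * y k, -(x k * y k)]] i j := left_relMatrix i j

theorem left_dMat_succ (n : ℕ) (i j : Fin 2) : Env.left (ε k) (dMat k (n + 1) i j) =
    ![![x k, 0], ![y k * y k - x k * y k, -x k]] i j :=
  (congrArg (Env.left (ε k)) (congrFun (congrFun (d_add_two n) i) j)).trans (left_highMatrix _ i j)

/-- The value of a cochain on a generator of the resolution. -/
def evalGen (n : ℕ) (i : Fin 2) (f : Cochain k (SuperJordanPlane k) (n + 1)) : k :=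
  barEval (ε k) (n + 1) f ((resolution k).toBar (n + 1)
    (Pi.single (show Fin ((resolution k).rank (n + 1)) from i) 1))

theorem evalGen_one (f : Cochain k (SuperJordanPlane k) 1) (i : Fin 2) :
    evalGen 0 i f = f.lin (![x k, y k] i) :=
  (barEval_toBar_one _ aug_eq_one f _).trans ((Fin.sum_univ_one _).trans
    (congrArg f.lin (left_commutatorMatrix i)))

theorem evalGen_two (f : Cochain k (SuperJordanPlane k) 2) (i : Fin 2) :
    evalGen 1 i f = f.bilin (![x k, y k * y k - x k * y k] i) (x k) +
      f.bilin (![0, -(x k * y k)] i) (y k) := by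
  refine (barEval_toBar_two _ aug_eq_one f _).trans ((Fin.sum_univ_two _).trans ?_)
  refine congrArg₂ (· + ·) ((Fin.sum_univ_one _).trans ?_) ((Fin.sum_univ_one _).trans ?_)
  · refine congrArg₂ (fun a b => f.bilin a b) ((left_relMatrix i 0).trans ?_)
      (left_commutatorMatrix 0)
    revert i
    exact Fin.forall_fin_two.2 ⟨rfl, rfl⟩
  · refine congrArg₂ (fun a b => f.bilin a b) ((left_relMatrix i 1).trans ?_)
      (left_commutatorMatrix 1)
    revert i
    exact Fin.forall_fin_two.2 ⟨rfl, rfl⟩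

theorem evalGen_cup_one (f : Cochain k (SuperJordanPlane k) 1) {n : ℕ} (h : 1 + (n + 1) = n + 2)
    (g : Cochain k (SuperJordanPlane k) (n + 1)) {m : Fin 2 → Fin 2 → SuperJordanPlane k}
    (hm : ∀ i j, Env.left (ε k) (dMat k n i j) = m i j)
    (i : Fin 2) : evalGen (n + 1) i (cup h f g) =
      f.lin (m i 0) * evalGen n 0 g + f.lin (m i 1) * evalGen n 1 g :=
  (barEval_cup_one _ aug_eq_one h f g _).trans ((Fin.sum_univ_two _).trans
    (congrArg₂ (· + ·) (congrArg (· * _) (congrArg f.lin (hm i 0)))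
      (congrArg (· * _) (congrArg f.lin (hm i 1)))))

theorem evalGen_cup_two (f : Cochain k (SuperJordanPlane k) 2) {n : ℕ} (h : 2 + (n + 1) = n + 3)
    (g : Cochain k (SuperJordanPlane k) (n + 1)) {m m' : Fin 2 → Fin 2 → SuperJordanPlane k}
    (hm : ∀ i j, Env.left (ε k) (dMat k n i j) = m i j)
    (hm' : ∀ i j, Env.left (ε k) (dMat k (n + 1) i j) = m' i j)
    (i : Fin 2) : evalGen (n + 2) i (cup h f g) =
      (f.bilin (m' i 0) (m 0 0) * evalGen n 0 g + f.bilin (m' i 0) (m 0 1) * evalGen n 1 g) +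
      (f.bilin (m' i 1) (m 1 0) * evalGen n 0 g + f.bilin (m' i 1) (m 1 1) * evalGen n 1 g) := by
  have key : ∀ j l : Fin 2,
      f ![Env.left (ε k) (dMat k (n + 1) i j),
        Env.left (ε k) (dMat k n j l)] * evalGen n l g =
      f.bilin (m' i j) (m j l) * evalGen n l g := fun j l => by
    rw [hm, hm']
    rfl
  refine (barEval_cup_two _ aug_eq_one h f g _).trans ((Fin.sum_univ_two _).trans
    (congrArg₂ (· + ·) ((Fin.sum_univ_two _).trans ?_) ((Fin.sum_univ_two _).trans ?_)))
  · exact congrArg₂ (· + ·) (key 0 0) (key 0 1)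
  · exact congrArg₂ (· + ·) (key 1 0) (key 1 1)

/-- The value of a cohomology class on a generator of the resolution. -/
def classVal (n : ℕ) (i : Fin 2) (a : HH (ε k) (n + 1)) : k :=
  (BimoduleComplex.hhEval isMinimal isResolutionYD (n + 1) a).1
    (Pi.single (show Fin ((resolution k).rank (n + 1)) from i) 1)

theorem classVal_ext {n : ℕ} {a b : HH (ε k) (n + 1)} (h : ∀ i, classVal n i a = classVal n i b) :
    a = b :=
  BimoduleComplex.hhEval_ext isMinimal computesHH h

theorem classVal_smul (n : ℕ) (i : Fin 2) (c : k) (a : HH (ε k) (n + 1)) :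
    classVal n i (c • a) = c * classVal n i a := by
  rw [classVal, map_smul]
  rfl

theorem exists_classVal (n : ℕ) (c : Fin 2 → k) :
    ∃ a : HH (ε k) (n + 1), ∀ i, classVal n i a = c i := by
  obtain ⟨f, hf⟩ := BimoduleComplex.exists_hom (ε := ε k) (R := resolution k) (n := n + 1) c
  obtain ⟨a, rfl⟩ := BimoduleComplex.hhEval_surjective isMinimal computesHH (n + 1) f
  exact ⟨a, hf⟩

/-- The coefficient of a class at `xⁿ⁺¹`. -/
def coeffX (n : ℕ) (a : HH (ε k) (n + 1)) : k := classVal n 0 a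

/-- The coefficient of a class at `y² xⁿ`, or zero in degree one. -/
def coeffY : ∀ n, HH (ε k) (n + 1) → k
  | 0, _ => 0
  | n + 1, a => classVal (n + 1) 1 a

theorem coeffX_mk (n : ℕ) (f : LinearMap.ker (cochainD (ε k) (n + 1))) :
    coeffX n (Cohomology.mk _ _ f) = evalGen n 0 f.1 := rfl

theorem coeffY_zero (a : HH (ε k) 1) : coeffY 0 a = 0 := rfl

theorem coeffY_mk (n : ℕ) (f : LinearMap.ker (cochainD (ε k) (n + 2))) :
    coeffY (n + 1) (Cohomology.mk _ _ f) = evalGen (n + 1) 1 f.1 := rfl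

/-- Since `f` kills `y²` and `x y`, only its value at `x` enters. The values of either factor at `y`
in degree 1 never contribute, which is why `coeffY` is set to zero there. -/
theorem smile_one_left {n m : ℕ} (h : n + 1 + 1 = m + 1) (a : HH (ε k) 1) (b : HH (ε k) (n + 1)) :
    coeffX m (smile (ε k) h b a) = coeffX 0 a * coeffX n b ∧
      coeffY m (smile (ε k) h b a) = -(coeffX 0 a * coeffY n b) := by
  obtain rfl : m = n + 1 := by omega
  induction a using HH_induction with | _ f
  induction b using HH_induction with | _ g
  have hf : cochainD (ε k) 1 f.1 = 0 := f.2
  have hyy : f.1.lin (y k * y k) = 0 := Cochain.lin_mul hf ε_y ε_y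
  have hxy : f.1.lin (x k * y k) = 0 := Cochain.lin_mul hf ε_x ε_y
  have hx : evalGen 0 0 f.1 = f.1.lin (x k) := evalGen_one _ 0
  rw [smile_mk]
  simp only [coeffX_mk, coeffY_mk, hx]
  match n with
  | 0 =>
    rw [evalGen_cup_one _ _ _ left_dMat_zero, evalGen_cup_one _ _ _ left_dMat_zero]
    simp [hyy, hxy, coeffY_zero]
  | n + 1 =>
    rw [coeffY_mk, evalGen_cup_one _ _ _ (left_dMat_succ n), evalGen_cup_one _ _ _ (left_dMat_succ n)]
    simp [hyy, hxy]

/-- A separate base case: by the formula for degree 1, products of two classes of degree 1 have no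
coefficient at `y² x`, so they do not reach all classes of degree 2. -/
theorem smile_two_left {n : ℕ} (h : n + 1 + 2 = n + 3) (a : HH (ε k) 2) (b : HH (ε k) (n + 1)) :
    coeffX (n + 2) (smile (ε k) h b a) = coeffX 1 a * coeffX n b ∧
      coeffY (n + 2) (smile (ε k) h b a) = coeffY 1 a * coeffX n b + coeffX 1 a * coeffY n b := by
  induction a using HH_induction with | _ f
  induction b using HH_induction with | _ g
  have hf : cochainD (ε k) 2 f.1 = 0 := f.2
  have h1 : f.1.bilin (x k * y k) (y k) = f.1.bilin (x k) (y k * y k) :=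
    Cochain.bilin_mul hf ε_x ε_y
  have h2 : f.1.bilin (x k) (x k * y k) = 0 := by
    rw [← Cochain.bilin_mul hf ε_x ε_y, sq, map_zero, LinearMap.zero_apply]
  have e0 : evalGen 1 0 f.1 = f.1.bilin (x k) (x k) := by
    rw [evalGen_two]
    simp
  have e1 : evalGen 1 1 f.1 = f.1.bilin (y k * y k - x k * y k) (x k) -
      f.1.bilin (x k) (y k * y k) := by
    rw [evalGen_two]
    simp [h1]
    ring
  rw [smile_mk]
  simp only [coeffX_mk, coeffY_mk, e0, e1]
  match n with
  | 0 =>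
    rw [evalGen_cup_two _ _ _ left_dMat_zero (left_dMat_succ 0),
      evalGen_cup_two _ _ _ left_dMat_zero (left_dMat_succ 0)]
    simp [h2, coeffY_zero]
    ring
  | n + 1 =>
    rw [coeffY_mk, evalGen_cup_two _ _ _ (left_dMat_succ n) (left_dMat_succ (n + 1)),
      evalGen_cup_two _ _ _ (left_dMat_succ n) (left_dMat_succ (n + 1))]
    simp [h2]
    ring

/-- Induction on the degree of `a`, which is the left factor of the cup product. From degree 3 on,
`a` is the product of the class dual to `x` with a class of degree one less, and associativity
applies. -/
theorem smile_coeff {p q n : ℕ} (h : q + 1 + (p + 1) = n + 1) (a : HH (ε k) (p + 1))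
    (b : HH (ε k) (q + 1)) :
    coeffX n (smile (ε k) h b a) = coeffX p a * coeffX q b ∧
      coeffY n (smile (ε k) h b a) =
        coeffY p a * coeffX q b + (-1) ^ (p + 1) * (coeffX p a * coeffY q b) := by
  induction p generalizing n with
  | zero =>
    have := smile_one_left h a b
    simpa [coeffY] using this
  | succ p ih =>
    match p with
    | 0 =>
      obtain rfl : n = q + 2 := by omega
      have := smile_two_left h a b
      simpa using this
    | p + 1 =>
      obtain ⟨α, hα⟩ := exists_classVal (k := k) 0 ![1, 0]
      -- The sign in the second value undoes the one that multiplication by `α` introduces in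
      -- `coeffY`.
      obtain ⟨a', ha'⟩ := exists_classVal (k := k) (p + 1)
        ![classVal (p + 2) 0 a, -classVal (p + 2) 1 a]
      have hα0 : coeffX 0 α = 1 := hα 0
      have h1 := smile_one_left (n := p + 1) rfl α a'
      obtain rfl : a = smile (ε k) rfl a' α := by
        refine classVal_ext (Fin.forall_fin_two.2 ⟨?_, ?_⟩)
        · refine Eq.trans ?_ h1.1.symm
          rw [hα0, one_mul]
          exact (ha' 0).symm
        · refine Eq.trans ?_ h1.2.symm
          rw [hα0, one_mul]
          exact (neg_eq_iff_eq_neg.1 (ha' 1).symm)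
      have hn : q + 1 + (p + 1 + 1) = q + p + 2 + 1 := by omega
      have hn' : q + p + 2 + 1 + 1 = n + 1 := by omega
      rw [← smile_smile hn rfl hn' h b a' α]
      obtain ⟨i0, i1⟩ := ih hn a'
      obtain ⟨j0, j1⟩ := smile_one_left hn' α (smile (ε k) hn b a')
      refine ⟨j0.trans ?_, j1.trans ?_⟩
      · refine Eq.trans ?_ (congrArg (· * coeffX q b) h1.1.symm)
        rw [i0, hα0]
        ring
      · refine Eq.trans ?_ (congrArg₂ (fun u v => u * coeffX q b +
          (-1) ^ (p + 1 + 1 + 1) * (v * coeffY q b)) h1.2.symm h1.1.symm)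
        rw [i1, hα0]
        ring

/-- Obtained from `(t a)(t v) = a(v)` at a generator `v`; the counit kills the coefficients of
positive degree in `t v`. -/
theorem classVal_hhT (n : ℕ) (i : Fin 2) (a : HH (ε k) (n + 1))
    {m : Fin 2 → Fin 2 → Env k (SuperJordanPlane k)} (hm : (resolution k).t (n + 1) = m) :
    Env.ε (ε k) (m i 0) * classVal n 0 (hhT (ε k) (t k) (ε_t k) (n + 1) a) +
      Env.ε (ε k) (m i 1) * classVal n 1 (hhT (ε k) (t k) (ε_t k) (n + 1) a) = classVal n i a := by
  subst hm
  refine Eq.trans ?_ (BimoduleComplex.hhEval_hhT (hσ := ε_t k) isMinimal a _)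
  refine Eq.trans ?_ (congrArg _ (BimoduleComplex.tMap_single (n + 1) _)).symm
  exact ((BimoduleComplex.Hom.apply_eq_sum _ _).trans (Fin.sum_univ_two _)).symm

/-- In degrees from 2 on, the off-diagonal entries of `t` die under the counit. In degree 1 one
survives, in `t y = x - y`, but the value at `y` is not recorded. -/
theorem coeffX_hhT (n : ℕ) (a : HH (ε k) (n + 1)) :
    coeffX n (hhT (ε k) (t k) (ε_t k) (n + 1) a) = (-1) ^ (n + 1) * coeffX n a := by
  match n with
  | 0 =>
    have h := classVal_hhT 0 0 a (m := ![-el 1 0 1, el 1 0 1 - el 1 1 1]) rfl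
    simp [el, Env.ε_tmul] at h
    simp [coeffX, ← h]
  | n + 1 =>
    have h := classVal_hhT (n + 1) 0 a (t_add_two n)
    simp [highAction, el, Env.ε_tmul] at h
    simp only [coeffX, ← h, ← mul_assoc, ← mul_pow]
    simp

theorem coeffY_hhT (n : ℕ) (a : HH (ε k) (n + 1)) :
    coeffY n (hhT (ε k) (t k) (ε_t k) (n + 1) a) = (-1) ^ n * coeffY n a := by
  match n with
  | 0 => simp [coeffY]
  | n + 1 =>
    have h := classVal_hhT (n + 1) 1 a (t_add_two n)
    simp [highAction, el, Env.ε_tmul, ε_x, ε_y] at h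
    rw [coeffY, coeffY, ← h]
    have : (-1 : k) ^ (n + 1) * -(-1) ^ (n + 2) = 1 := by
      rw [pow_succ _ (n + 1), mul_neg_one, neg_neg, ← mul_pow]
      simp
    linear_combination (-classVal (n + 1) 1 (hhT (ε k) (t k) (ε_t k) (n + 1 + 1) a)) * this

theorem coeffX_eq_zero {n : ℕ} {i : ℤ} (hi : i ≠ -(n + 1)) {a : HH (ε k) (n + 1)}
    (ha : a ∈ hhGr (ε k) (gr k) (n + 1) i) : coeffX n a = 0 := by
  refine BimoduleComplex.hhEval_eq_zero isMinimal counit_gr ha ?_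
  match n with
  | 0 => exact (show (1 : ℤ) + i ≠ 0 by simp at hi; omega)
  | n + 1 => exact (show (n : ℤ) + 2 + i ≠ 0 by push_cast at hi; omega)

theorem coeffY_eq_zero {n : ℕ} {i : ℤ} (hi : i ≠ -(n + 2)) {a : HH (ε k) (n + 1)}
    (ha : a ∈ hhGr (ε k) (gr k) (n + 1) i) : coeffY n a = 0 := by
  match n with
  | 0 => rfl
  | n + 1 =>
    refine BimoduleComplex.hhEval_eq_zero isMinimal counit_gr ha ?_
    exact (show (n : ℤ) + 3 + i ≠ 0 by push_cast at hi; omega)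

/-- For cohomological degree `p + 1`, a class of internal degree `-(p + 1)` has only the coefficient
at `x^(p+1)`, one of internal degree `-(p + 2)` only that at `y² x^p`, and in all other degrees both
vanish. In each case the power of `t` contributes exactly the sign by which the two products differ.
-/
theorem isGradedBraidedCommAlgebra : IsGradedBraidedCommAlgebra
    (hhT (ε k) (t k) (ε_t k)) (hhGr (ε k) (gr k)) (hhOne (ε k)) (smile (ε k)) := by
  refine HochYD.isGradedBraidedCommAlgebra (ε_t k)
    (BimoduleComplex.hh_yd isMinimal yd counit_gr (ε_t k) computesHH)
    (comm_of_pos (ε_t k) fun {p q n} h h' {i a} b ha => ?_)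
  obtain rfl : n = p + q + 2 := by omega
  obtain ⟨h0, h1⟩ := smile_coeff h b a
  obtain ⟨h0', h1'⟩ := smile_coeff h' a ((hhT (ε k) (t k) (ε_t k) (q + 1) ^ i) b)
  have hone (n : ℕ) : (-1 : k) ^ n * (-1) ^ n = 1 := by rw [← mul_pow]; simp
  have hX := hhT_zpow_eigen (hone _) (coeffX_hhT (k := k) q) i b
  have hY := hhT_zpow_eigen (hone _) (coeffY_hhT (k := k) q) i b
  have hpow (n m : ℕ) : ((-1 : k) ^ n) ^ (-(m : ℤ)) = (-1) ^ (n * m) := by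
    rw [zpow_neg, zpow_natCast, ← inv_pow, ← inv_pow, inv_neg_one, pow_mul]
  rw [hX] at h0' h1'
  rw [hY] at h1'
  refine classVal_ext (Fin.forall_fin_two.2 ⟨?_, ?_⟩)
  · rw [classVal_smul]
    refine h0.trans (Eq.trans ?_ (congrArg _ h0'.symm))
    by_cases hi : i = -((p + 1 : ℕ) : ℤ)
    · rw [hi, hpow]
      linear_combination (-(coeffX p a * coeffX q b)) * hone ((p + 1) * (q + 1))
    · rw [coeffX_eq_zero (by push_cast at hi; exact hi) ha]
      simp
  · rw [classVal_smul]
    refine h1.trans (Eq.trans ?_ (congrArg _ h1'.symm))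
    by_cases hi : i = -((p + 1 : ℕ) : ℤ)
    · rw [coeffY_eq_zero (by push_cast at hi; omega) ha, hi, hpow, hpow]
      linear_combination (-(coeffX p a * coeffY q b)) * hone ((p + 1) * (q + 1))
    · rw [coeffX_eq_zero (by push_cast at hi; exact hi) ha]
      by_cases hi' : i = -((p + 2 : ℕ) : ℤ)
      · rw [hi', hpow]
        linear_combination (-((-1) ^ (q + 1) * coeffY p a * coeffX q b)) * hone ((p + 1) * (q + 1))
      · rw [coeffY_eq_zero (by push_cast at hi'; exact hi') ha]
        simp

end SuperJordanPlane
end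
end HochYD

theorem mainTheorem3 (k : Type*) [Field k] :
    ((2 : k) ≠ 0 →
      (∃! Δ : HochYD.JordanPlane k →ₗ[k] HochYD.JordanPlane k ⊗[k] HochYD.JordanPlane k,
        Δ (HochYD.JordanPlane.x k) =
          HochYD.JordanPlane.x k ⊗ₜ[k] 1 + 1 ⊗ₜ[k] HochYD.JordanPlane.x k ∧
        Δ (HochYD.JordanPlane.y k) =
          HochYD.JordanPlane.y k ⊗ₜ[k] 1 + 1 ⊗ₜ[k] HochYD.JordanPlane.y k ∧
        HochYD.IsBimonoidYD (HochYD.JordanPlane.t k) (HochYD.JordanPlane.gr k)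
          (HochYD.JordanPlane.ε k) Δ) ∧
      (HochYD.JordanPlane.resolution k).IsMinimal (HochYD.JordanPlane.ε k) ∧
      (∃ (τ : ∀ n, (HochYD.JordanPlane.resolution k).P n ≃ₗ[k]
            (HochYD.JordanPlane.resolution k).P n)
          (hR : (HochYD.JordanPlane.resolution k).IsResolutionYD (HochYD.JordanPlane.t k)
            (HochYD.JordanPlane.gr k) τ)
          (φ : ∀ n, (HochYD.JordanPlane.resolution k).P n →ₗ[HochYD.Env k (HochYD.JordanPlane k)]
            HochYD.Bar k (HochYD.JordanPlane k) n)
          (hφ : (HochYD.JordanPlane.resolution k).IsComparison φ),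
        HochYD.ComputesHH (HochYD.JordanPlane.ε_t k) hR hφ) ∧
      HochYD.IsGradedBraidedCommAlgebra
        (HochYD.hhT (HochYD.JordanPlane.ε k) (HochYD.JordanPlane.t k) (HochYD.JordanPlane.ε_t k))
        (HochYD.hhGr (HochYD.JordanPlane.ε k) (HochYD.JordanPlane.gr k))
        (HochYD.hhOne (HochYD.JordanPlane.ε k))
        (HochYD.smile (HochYD.JordanPlane.ε k))) ∧
    ((∃! Δ : HochYD.SuperJordanPlane k →ₗ[k]
          HochYD.SuperJordanPlane k ⊗[k] HochYD.SuperJordanPlane k,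
        Δ (HochYD.SuperJordanPlane.x k) =
          HochYD.SuperJordanPlane.x k ⊗ₜ[k] 1 + 1 ⊗ₜ[k] HochYD.SuperJordanPlane.x k ∧
        Δ (HochYD.SuperJordanPlane.y k) =
          HochYD.SuperJordanPlane.y k ⊗ₜ[k] 1 + 1 ⊗ₜ[k] HochYD.SuperJordanPlane.y k ∧
        HochYD.IsBimonoidYD (HochYD.SuperJordanPlane.t k) (HochYD.SuperJordanPlane.gr k)
          (HochYD.SuperJordanPlane.ε k) Δ) ∧
      (HochYD.SuperJordanPlane.resolution k).IsMinimal (HochYD.SuperJordanPlane.ε k) ∧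
      (∃ (τ : ∀ n, (HochYD.SuperJordanPlane.resolution k).P n ≃ₗ[k]
            (HochYD.SuperJordanPlane.resolution k).P n)
          (hR : (HochYD.SuperJordanPlane.resolution k).IsResolutionYD (HochYD.SuperJordanPlane.t k)
            (HochYD.SuperJordanPlane.gr k) τ)
          (φ : ∀ n, (HochYD.SuperJordanPlane.resolution k).P n
            →ₗ[HochYD.Env k (HochYD.SuperJordanPlane k)]
            HochYD.Bar k (HochYD.SuperJordanPlane k) n)
          (hφ : (HochYD.SuperJordanPlane.resolution k).IsComparison φ),
        HochYD.ComputesHH (HochYD.SuperJordanPlane.ε_t k) hR hφ) ∧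
      HochYD.IsGradedBraidedCommAlgebra
        (HochYD.hhT (HochYD.SuperJordanPlane.ε k) (HochYD.SuperJordanPlane.t k)
          (HochYD.SuperJordanPlane.ε_t k))
        (HochYD.hhGr (HochYD.SuperJordanPlane.ε k) (HochYD.SuperJordanPlane.gr k))
        (HochYD.hhOne (HochYD.SuperJordanPlane.ε k))
        (HochYD.smile (HochYD.SuperJordanPlane.ε k))) := by
  refine ⟨fun h2 => ⟨HochYD.JordanPlane.existsUnique_comul h2, HochYD.JordanPlane.isMinimal,
    ⟨_, HochYD.JordanPlane.isResolutionYD, _, _, HochYD.JordanPlane.computesHH⟩,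
    HochYD.JordanPlane.isGradedBraidedCommAlgebra h2⟩, HochYD.SuperJordanPlane.existsUnique_comul,
    HochYD.SuperJordanPlane.isMinimal, ⟨_, HochYD.SuperJordanPlane.isResolutionYD, _, _,
    HochYD.SuperJordanPlane.computesHH⟩, HochYD.SuperJordanPlane.isGradedBraidedCommAlgebra⟩
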